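/- **Theorem 1.9.** Let $\mathbb D=\{z\in\mathbb C:|z|<1\}$, $\partial u=\tfrac12(u_x-iu_y)$, $\bar\partial u=\tfrac12(u_x+iu_y)$. For $\alpha>-1$ a function $u:\mathbb D\to\mathbb C$ is called $\alpha$-harmonic if $u\in C^2(\mathbb D)$ and $T_\alpha u=0$ in $\mathbb D$, where $$T_\alpha=-\frac{\alpha^2}{4}(1-|z|^2)^{-\alpha-1}+\frac{\alpha}{2}(1-|z|^2)^{-\alpha-1}\bigl(z\partial+\bar z\bar\partial\bigr)+\frac14(1-|z|^2)^{-\alpha}\Delta .$$ For $K\ge 1$ and a domain $\Omega\subset\mathbb C$, let $QCH_\alpha(\mathbb D,\Omega;K)$ be the class of $\alpha$-harmonic mappings $u$ that are $K$-quasiconformal from $\mathbb D$ onto $\Omega$, i.e. $u:\mathbb D\to\Omega$ is a homeomorphism of class $W^{1,2}_{loc}$ with $u_{\bar z}=\mu u_z$ almost everywhere for some measurable $\mu$ with $\|\mu\|_\infty\le\frac{K-1}{K+1}$. Put $c_\alpha=\Gamma(\alpha/2+1)^2/\Gamma(1+\alpha)$, let $F(a,b;c;x)$ be the Gauss hypergeometric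 function, and let $|\gamma|$ be the length of a curve $\gamma$. Let $\alpha>-1$, $K\ge1$, and let $u\in QCH_\alpha(\mathbb D,\Omega;K)$, where $\Omega$ is a bounded domain whose boundary is a rectifiable Jordan curve $\gamma$. Then for every $0<r<1$ $$\int_{|z|=r}|\partial u|\,|dz|\le\frac{K+1}{2}\,c_\alpha F\Bigl(-\frac\alpha2,-\frac\alpha2;1;r^2\Bigr)|\gamma|,\qquad \int_{|z|=r}|\bar\partial u|\,|dz|\le\frac{K-1}{2}\,c_\alpha F\Bigl(-\frac\alpha2,-\frac\alpha2;1;r^2\Bigr)|\gamma| .$$ In particular, $$\sup_{0<r<1}\int_{|z|=r}|\partial u|\,|dz|\le\frac{K+1}{2}|\gamma|,\qquad \sup_{0<r<1}\int_{|z|=r}|\bar\partial u|\,|dz|\le\frac{K-1}{2}|\gamma| .$$ The constants $\frac{K+1}2$ and $\frac{K-1}2$ in the last two inequalities are sharp in the limit case $\alpha=0$, $K\to1$, in the following sense. For $\alpha=0$ and $K=1$ there are $\Omega$, $\gamma$ and $u\in QCH_0(\mathbb D,\Omega;1)$ as above for which equality holds in both inequalities. Moreover, for every $\varepsilon>0$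 there is $\delta>0$ such that for every $K\in[1,1+\delta)$ there are $\Omega$, $\gamma$ and $u\in QCH_0(\mathbb D,\Omega;K)$ as above with $$\sup_{0<r<1}\int_{|z|=r}|\partial u|\,|dz|\ge(1-\varepsilon)\frac{K+1}{2}|\gamma|\quad\text{and}\quad \sup_{0<r<1}\int_{|z|=r}|\bar\partial u|\,|dz|\ge(1-\varepsilon)\frac{K-1}{2}|\gamma| .$$ -/

import Mathlib

open Set MeasureTheory
open scoped ENNReal ContDiff Laplacian

noncomputable section

/-- The open unit disk of the complex plane. -/
def unitDisk : Set ℂ := Metric.ball 0 1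

/-- The Wirtinger derivative `∂u = (u_x - i u_y) / 2`. -/
def wirtinger (u : ℂ → ℂ) (z : ℂ) : ℂ :=
  (fderiv ℝ u z 1 - Complex.I * fderiv ℝ u z Complex.I) / 2

/-- The Wirtinger derivative `∂̄u = (u_x + i u_y) / 2`. -/
def wirtingerBar (u : ℂ → ℂ) (z : ℂ) : ℂ :=
  (fderiv ℝ u z 1 + Complex.I * fderiv ℝ u z Complex.I) / 2

/-- The differential operator
`T_α = -(α²/4) (1-|z|²)^(-α-1) + (α/2) (1-|z|²)^(-α-1) (z ∂ + z̄ ∂̄) + (1/4) (1-|z|²)^(-α) Δ`. -/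
def opT (α : ℝ) (u : ℂ → ℂ) (z : ℂ) : ℂ :=
  -(((α ^ 2 / 4 * (1 - ‖z‖ ^ 2) ^ (-α - 1) : ℝ) : ℂ) * u z)
    + ((α / 2 * (1 - ‖z‖ ^ 2) ^ (-α - 1) : ℝ) : ℂ)
        * (z * wirtinger u z + (starRingEnd ℂ) z * wirtingerBar u z)
    + ((1 / 4 * (1 - ‖z‖ ^ 2) ^ (-α) : ℝ) : ℂ) * (Δ u) z

/-- `u` is `α`-harmonic on the unit disk: a classical `C²` solution of `T_α u = 0`
(the parameter range `α > -1` is imposed where the notion is used). -/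
structure IsAlphaHarmonic (α : ℝ) (u : ℂ → ℂ) : Prop where
  contDiffOn : ContDiffOn ℝ 2 u unitDisk
  eq_zero : ∀ z ∈ unitDisk, opT α u z = 0

/-- `g` is locally square integrable on `Ω`. -/
def IsLocL2On (Ω : Set ℂ) (g : ℂ → ℂ) : Prop :=
  ∀ C : Set ℂ, C ⊆ Ω → IsCompact C → MemLp g 2 (volume.restrict C)

/-- `g` is the weak derivative of `f` on `Ω` in the direction `v`, tested against the real-valued
smooth functions with compact support in `Ω`. -/
def IsWeakDirDerivOn (Ω : Set ℂ) (v : ℂ) (f g : ℂ → ℂ) : Prop :=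
  ∀ φ : ℂ → ℝ, ContDiff ℝ ∞ φ → HasCompactSupport φ → tsupport φ ⊆ Ω →
    ∫ z in Ω, (fderiv ℝ φ z v) • f z = -∫ z in Ω, φ z • g z

/-- `f` is a `K`-quasiconformal mapping of `Ω` onto `Ω'`: a homeomorphism in the Sobolev class
`W^{1,2}_loc(Ω)` (with weak partial derivatives `fx`, `fy`) that satisfies a Beltrami equation
`f_z̄ = μ f_z` almost everywhere, with `‖μ‖_∞ ≤ (K-1)/(K+1)`. -/
structure IsQuasiconformal (K : ℝ) (Ω Ω' : Set ℂ) (f : ℂ → ℂ) : Prop where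
  homeo : ∃ e : Ω ≃ₜ Ω', ∀ z : Ω, (e z : ℂ) = f z
  sobolev_beltrami : ∃ fx fy μ : ℂ → ℂ,
    IsLocL2On Ω f ∧ IsLocL2On Ω fx ∧ IsLocL2On Ω fy ∧
    IsWeakDirDerivOn Ω 1 f fx ∧ IsWeakDirDerivOn Ω Complex.I f fy ∧
    Measurable μ ∧
    (∀ᵐ z ∂(volume.restrict Ω), ‖μ z‖ ≤ (K - 1) / (K + 1)) ∧
    (∀ᵐ z ∂(volume.restrict Ω),
      (fx z + Complex.I * fy z) / 2 = μ z * ((fx z - Complex.I * fy z) / 2))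

/-- The class `QCH_α(𝔻, Ω; K)` of the `α`-harmonic `K`-quasiconformal mappings of the unit disk
onto `Ω`. -/
def QCH (α : ℝ) (Ω : Set ℂ) (K : ℝ) : Set (ℂ → ℂ) :=
  {u | IsQuasiconformal K unitDisk Ω u ∧ IsAlphaHarmonic α u}

/-- The length of the curve `γ : [0,1] → ℂ`, as the supremum of the lengths of inscribed
polygons. -/
def curveLength (γ : ℝ → ℂ) : ℝ≥0∞ := eVariationOn γ (Icc 0 1)

/-- `γ`, restricted to `[0,1]`, parametrizes a rectifiable Jordan curve. -/
structure IsRectifiableJordanCurve (γ : ℝ → ℂ) : Prop where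
  continuousOn : ContinuousOn γ (Icc 0 1)
  closed : γ 0 = γ 1
  injOn : InjOn γ (Ico 0 1)
  rectifiable : curveLength γ ≠ ⊤

/-- `Ω` is a domain bounded by the rectifiable Jordan curve `γ`: a bounded domain whose boundary
is the trace of `γ`. -/
structure IsDomainBoundedBy (Ω : Set ℂ) (γ : ℝ → ℂ) : Prop where
  isOpen : IsOpen Ω
  isConnected : IsConnected Ω
  isBounded : Bornology.IsBounded Ω
  jordan : IsRectifiableJordanCurve γ
  frontier_eq : frontier Ω = γ '' Icc 0 1

/-- The integral `∫_{|z|=r} |g(z)| |dz|` with respect to arc length, for `r ≥ 0`. -/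
def arcIntegral (r : ℝ) (g : ℂ → ℂ) : ℝ≥0∞ :=
  ∫⁻ θ in Ioc 0 (2 * Real.pi), ‖g (circleMap 0 r θ)‖ₑ * ENNReal.ofReal r

/-- The supremum of `∫_{|z|=r} |g(z)| |dz|` over `0 < r < 1`. -/
def supArcIntegral (g : ℂ → ℂ) : ℝ≥0∞ :=
  ⨆ r ∈ Ioo (0 : ℝ) 1, arcIntegral r g

/-- The constant `c_α = Γ(α/2+1)² / Γ(1+α)`. -/
def cConst (α : ℝ) : ℝ := Real.Gamma (α / 2 + 1) ^ 2 / Real.Gamma (1 + α)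

/-- The factor `c_α F(-α/2, -α/2; 1; r²)`, with Gauss' hypergeometric function. -/
def cF (α r : ℝ) : ℝ := cConst α * ₂F₁ (-α / 2) (-α / 2) (1 : ℝ) (r ^ 2)

end

/-! Both integrals are controlled by the angular derivative. On `|z| = r`, `∂_θ u = Du(iz)` has
modulus at least `r (|∂u| - |∂̄u|)`, and the dilatation bound `|∂̄u| ≤ (K-1)/(K+1) |∂u|` turns this
into `r |∂u| ≤ (K+1)/2 |∂_θ u|` and `r |∂̄u| ≤ (K-1)/2 |∂_θ u|`
(`IsQuasiconformal.wirtinger_mul_le`). It remains to bound `∫ |∂_θ u| dθ` by `min 1 (c_α F) |γ|`,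
where `F(r) = ₂F₁(-α/2, -α/2; 1; r²)` is the radial solution of the equation.

The bound is proved for the differences `u(r e^{i(s+2π/n)}) - u(r e^{is})`, which solve the same
equation because it is rotation invariant. The modulus of a solution is, after regularization, a
subsolution (Kato's inequality), so its circular mean is a radial subsolution. A Wronskian
comparison shows that this mean divided by `F` is nondecreasing in `r`
(`IsPolarSolution.monotoneOn_integral_norm_div`). The interior is thereby controlled by the limit `r
→ 1`, and Fatou's lemma as `n → ∞` recovers `∂_θ u` (`lintegral_enorm_angular_deriv_le`).

At the boundary no continuous extension of `u` is used. The Dirichlet integral of `u` is at most `K`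
times the area of the image, so almost every radius has a limit (`ae_exists_hasRadialLimit`). The
limits lie on the boundary curve and run through it monotonically. Otherwise four of them would be
interlaced, and a Janiszewski-type separation argument, carried out with continuous logarithms of
`(z-p)/(z-q)`, would join two points of the disk without crossing two radii that separate them
(`radial_limits_not_interlaced`). Hence a closed polygon inscribed in the radial limits is no longer
than `γ` (`sum_edist_radial_limits_le`).

The comparison gives `F(r₀) X ≤ F(r) |γ|` for all `r₀`, with `X` the mean at radius `r`. Taking `r₀
= r` yields the constant `1`. Letting `r₀ → 1` yields `c_α F(r)`, once `F` is known to reach at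
least Gauss's value `Γ(1+α)/Γ(α/2+1)²` (`Gamma_div_le_of_forall_hypSum_le`, from Parseval and a beta
integral).

Sharpness comes from the affine maps `z + k z̄` with `k = (K-1)/(K+1)`, whose image ellipses have
length at most `2π(1+k)`. -/

noncomputable section

open Filter Topology

/-! ### Plane separation by means of continuous logarithms. -/

section

/-- The quotient `(z - p) / (z - q)` has a continuous logarithm on `Y`. -/
def HasLogRatio (Y : Set ℂ) (p q : ℂ) : Prop :=
  ∃ l : ℂ → ℂ, ContinuousOn l Y ∧ ∀ z ∈ Y, Complex.exp (l z) * (z - q) = z - p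

lemma HasLogRatio.symm {Y : Set ℂ} {p q : ℂ} (h : HasLogRatio Y p q) : HasLogRatio Y q p := by
  obtain ⟨l, hl, h⟩ := h
  refine ⟨fun z => -l z, hl.neg, fun z hz => ?_⟩
  rw [← h z hz, ← mul_assoc, ← Complex.exp_add]
  simp

lemma HasLogRatio.trans {Y : Set ℂ} {p q r : ℂ} (h : HasLogRatio Y p q) (h' : HasLogRatio Y q r) :
    HasLogRatio Y p r := by
  obtain ⟨l, hl, h⟩ := h
  obtain ⟨m, hm, h'⟩ := h'
  refine ⟨fun z => l z + m z, hl.add hm, fun z hz => ?_⟩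
  rw [Complex.exp_add, mul_assoc, h' z hz, h z hz]

/-- Since `(z-q)/(z-p) = 1 + (p-q)/(z-p)` stays in the unit disk about `1`, the principal branch of
the logarithm serves. -/
lemma hasLogRatio_of_dist_lt {Y : Set ℂ} {p q : ℂ} (h : ∀ z ∈ Y, ‖p - q‖ < ‖z - p‖) :
    HasLogRatio Y q p := by
  have key : ∀ z ∈ Y, (z - q) / (z - p) ∈ Complex.slitPlane := by
    intro z hz
    have h1 := h z hz
    have h0 : z - p ≠ 0 := by
      intro h0
      rw [h0, norm_zero] at h1
      exact absurd h1 (not_lt.2 (norm_nonneg _))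
    have : (z - q) / (z - p) = 1 + (p - q) / (z - p) := by
      field_simp
      ring
    rw [this]
    apply Complex.mem_slitPlane_of_norm_lt_one
    rw [norm_div, div_lt_one (norm_pos_iff.2 h0)]
    exact h1
  have hne : ∀ z ∈ Y, z - p ≠ 0 := by
    intro z hz h0
    have h1 := h z hz
    rw [h0, norm_zero] at h1
    exact absurd h1 (not_lt.2 (norm_nonneg _))
  refine ⟨fun z => Complex.log ((z - q) / (z - p)), ?_, fun z hz => ?_⟩
  · refine ContinuousOn.clog ?_ key
    exact ContinuousOn.div (by fun_prop) (by fun_prop) hne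
  · rw [Complex.exp_log (Complex.slitPlane_ne_zero (key z hz)), div_mul_cancel₀ _ (hne z hz)]

/-- Points closer to each other than to `Y` have a logarithm of their ratio. The relation is an
equivalence, so it spreads from neighbourhoods to the whole connected set. -/
lemma IsPreconnected.hasLogRatio {S Y : Set ℂ} (hS : IsPreconnected S) (hY : IsClosed Y)
    (hSY : Disjoint S Y) {p q : ℂ} (hp : p ∈ S) (hq : q ∈ S) : HasLogRatio Y p q := by
  refine hS.induction₂ (HasLogRatio Y) ?_ (fun _ _ _ _ _ _ h h' => h.trans h')
    (fun _ _ _ _ h => h.symm) hp hq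
  intro x hx
  have hxY : x ∈ Yᶜ := fun h => Set.disjoint_left.1 hSY hx h
  obtain ⟨ε, hε, hb⟩ := Metric.isOpen_iff.1 hY.isOpen_compl x hxY
  refine mem_nhdsWithin_of_mem_nhds ?_
  filter_upwards [Metric.ball_mem_nhds x hε] with y hy
  refine (hasLogRatio_of_dist_lt fun z hz => ?_).symm
  have h1 : z ∉ Metric.ball x ε := fun h => hb h hz
  rw [Metric.mem_ball, dist_eq_norm] at h1 hy
  rw [norm_sub_rev]
  linarith

/-- A continuous function whose exponential is constant on a preconnected set is constant there. -/
lemma IsPreconnected.constant_of_exp_eq_one {B : Set ℂ} (hB : IsPreconnected B) {d : ℂ → ℂ}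
    (hd : ContinuousOn d B) (h : ∀ z ∈ B, Complex.exp (d z) = 1) {x y : ℂ} (hx : x ∈ B)
    (hy : y ∈ B) : d x = d y := by
  have hT : IsDiscrete (AddSubgroup.zmultiples (2 * Real.pi * Complex.I) : Set ℂ) :=
    ⟨NormedSpace.discreteTopology_zmultiples (2 * Real.pi * Complex.I : ℂ)⟩
  refine hB.constant_of_mapsTo hT hd (fun z hz => ?_) hx hy
  obtain ⟨n, hn⟩ := Complex.exp_eq_one_iff.1 (h z hz)
  exact AddSubgroup.mem_zmultiples_iff.2 ⟨n, by simp [hn]⟩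

/-- Logarithms on two closed sets with connected intersection can be glued. -/
lemma HasLogRatio.union {Y Z : Set ℂ} (hY : IsClosed Y) (hZ : IsClosed Z)
    (hYZ : IsPreconnected (Y ∩ Z)) {p q : ℂ} (hqZ : q ∉ Z)
    (h : HasLogRatio Y p q) (h' : HasLogRatio Z p q) : HasLogRatio (Y ∪ Z) p q := by
  classical
  obtain ⟨l, hl, h⟩ := h
  obtain ⟨m, hm, h'⟩ := h'
  have hone : ∀ z ∈ Y ∩ Z, Complex.exp (l z - m z) = 1 := by
    rintro z ⟨hzY, hzZ⟩
    have hne : z - q ≠ 0 := fun h0 => hqZ (by rwa [sub_eq_zero.1 h0] at hzZ)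
    rw [Complex.exp_sub, div_eq_one_iff_eq (Complex.exp_ne_zero _)]
    exact mul_right_cancel₀ hne ((h z hzY).trans (h' z hzZ).symm)
  -- The two logarithms differ by a multiple of `2πi` on the intersection. Connectedness makes that
  -- multiple a single constant, which is absorbed into `m`.
  obtain ⟨c, hc1, hc⟩ : ∃ c : ℂ, Complex.exp c = 1 ∧ ∀ z ∈ Y ∩ Z, l z = m z + c := by
    rcases (Y ∩ Z).eq_empty_or_nonempty with he | ⟨x, hx⟩
    · exact ⟨0, Complex.exp_zero, by simp [he]⟩
    · refine ⟨l x - m x, hone x hx, fun z hz => ?_⟩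
      have hd : ContinuousOn (fun z => l z - m z) (Y ∩ Z) :=
        (hl.mono inter_subset_left).sub (hm.mono inter_subset_right)
      have := hYZ.constant_of_exp_eq_one hd hone hz hx
      rw [← this]
      ring
  have hgY : ∀ z ∈ Y, (if z ∈ Y then l z else m z + c) = l z := fun z hz => if_pos hz
  have hgZ : ∀ z ∈ Z, (if z ∈ Y then l z else m z + c) = m z + c := by
    intro z hz
    by_cases hzY : z ∈ Y
    · rw [if_pos hzY, hc z ⟨hzY, hz⟩]
    · rw [if_neg hzY]
  refine ⟨fun z => if z ∈ Y then l z else m z + c, ?_, ?_⟩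
  · refine ContinuousOn.union_of_isClosed (hl.congr hgY) ((hm.add continuousOn_const).congr hgZ)
      hY hZ
  · rintro z (hz | hz)
    · simp only [hgY z hz]
      exact h z hz
    · simp only [hgZ z hz, Complex.exp_add, hc1, mul_one]
      exact h' z hz

/-- A nowhere vanishing continuous function on the plane does not equal `z - p` on a circle
centred at `p`. -/
lemma not_eqOn_sub_of_continuous_of_ne_zero {G : ℂ → ℂ} (hG : Continuous G) (h0 : ∀ z, G z ≠ 0)
    {p : ℂ} {R : ℝ} (hR : 0 < R) (h : ∀ z, ‖z - p‖ = R → G z = z - p) : False := by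
  -- The plane is simply connected, so `G` lifts through the covering `exp` to a global logarithm
  -- `H`.
  obtain ⟨H, ⟨-, hH⟩, -⟩ := Complex.isCoveringMapOn_exp.existsUnique_continuousMap_lifts
    (⟨G, hG⟩ : C(ℂ, ℂ)) (a₀ := 0) (e₀ := Complex.log (G 0)) (Complex.exp_log (h0 0))
    (fun a => h0 a)
  have hexp : ∀ z, Complex.exp (H z) = G z := fun z => congrFun hH z
  -- Along the circle `H` must agree with `log R + iz` up to a constant. Periodicity of the first
  -- term of `d` then forces `2πi = 0` when `0` and `2π` are compared.
  let d : ℂ → ℂ := fun z =>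
    H (p + R * Complex.exp (z * Complex.I)) - z * Complex.I - Complex.log R
  have hd : Continuous d := by
    have := H.continuous
    fun_prop
  have hRne : (R : ℂ) ≠ 0 := by exact_mod_cast hR.ne'
  have hseg : IsPreconnected (range ((↑) : ℝ → ℂ)) := isPreconnected_range Complex.continuous_ofReal
  have hone : ∀ z ∈ range ((↑) : ℝ → ℂ), Complex.exp (d z) = 1 := by
    rintro _ ⟨t, rfl⟩
    simp only [d, Complex.exp_sub, hexp]
    rw [h, Complex.exp_log hRne]
    · field_simp [Complex.exp_ne_zero]
      ring
    · simp [Complex.norm_exp, abs_of_pos hR]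
  have := hseg.constant_of_exp_eq_one hd.continuousOn hone ⟨0, rfl⟩ ⟨2 * Real.pi, rfl⟩
  simp only [d] at this
  push_cast at this
  rw [Complex.exp_two_pi_mul_I] at this
  have h2 : (2 * Real.pi * Complex.I : ℂ) = 0 := by
    simp only [zero_mul, Complex.exp_zero] at this
    linear_combination this
  exact Complex.two_pi_I_ne_zero h2

/-- Components of an open set are open and pairwise disjoint, so a boundary point of one of them
cannot lie in another. -/
lemma frontier_connectedComponentIn_compl_subset {Y : Set ℂ} (hY : IsClosed Y) (p : ℂ) :
    frontier (connectedComponentIn Yᶜ p) ⊆ Y := by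
  intro x hx
  by_contra hxY
  have hopen : IsOpen (connectedComponentIn Yᶜ p) := hY.isOpen_compl.connectedComponentIn
  have hnhds : connectedComponentIn Yᶜ x ∈ 𝓝 x :=
    hY.isOpen_compl.connectedComponentIn.mem_nhds (mem_connectedComponentIn hxY)
  obtain ⟨y, hyx, hyp⟩ := mem_closure_iff_nhds.1 hx.1 _ hnhds
  have he : connectedComponentIn Yᶜ p = connectedComponentIn Yᶜ x :=
    (connectedComponentIn_eq hyp).trans (connectedComponentIn_eq hyx).symm
  rw [hopen.frontier_eq] at hx
  exact hx.2 (he ▸ mem_connectedComponentIn hxY)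

lemma isPreconnected_setOf_lt_norm (R : ℝ) (hR : 0 < R) : IsPreconnected {z : ℂ | R < ‖z‖} := by
  have : {z : ℂ | R < ‖z‖} = Complex.exp '' {w : ℂ | Real.log R < w.re} := by
    ext z
    constructor
    · intro hz
      have hz' : R < ‖z‖ := hz
      have h0 : z ≠ 0 := norm_pos_iff.1 (hR.trans hz')
      refine ⟨Complex.log z, ?_, Complex.exp_log h0⟩
      simp only [mem_ofPred_eq, Complex.log_re]
      exact Real.log_lt_log hR hz'
    · rintro ⟨w, hw, rfl⟩
      simp only [mem_ofPred_eq, Complex.norm_exp] at hw ⊢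
      exact (Real.log_lt_iff_lt_exp hR).1 hw
  rw [this]
  exact (convex_halfSpace_re_gt _).isPreconnected.image _ Complex.continuous_exp.continuousOn

/-- If `q` were outside the bounded component `U` of `p`, then replacing `z - p` inside `U` by
`exp(L) (z - q)`, with `L` an extension of the logarithm, would remove its only zero without
altering it on large circles. That contradicts the nontrivial winding there. -/
lemma HasLogRatio.mem_connectedComponentIn_of_isBounded {Y : Set ℂ} (hY : IsClosed Y) {p q : ℂ}
    (hp : p ∉ Y) (hq : q ∉ Y) (h : HasLogRatio Y p q)
    (hb : Bornology.IsBounded (connectedComponentIn Yᶜ p)) :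
    q ∈ connectedComponentIn Yᶜ p := by
  classical
  by_contra hqU
  set U := connectedComponentIn Yᶜ p with hU
  have hfr : frontier U ⊆ Y := frontier_connectedComponentIn_compl_subset hY p
  have hpU : p ∈ U := mem_connectedComponentIn hp
  have hqcl : q ∉ closure U := by
    rw [closure_eq_self_union_frontier]
    rintro (h | h)
    exacts [hqU h, hq (hfr h)]
  obtain ⟨l, hl, h⟩ := h
  -- Tietze extension of the logarithm from `Y` to the plane.
  obtain ⟨L, hL⟩ := ContinuousMap.exists_restrict_eq hY ⟨Y.domRestrict l, hl.domRestrict⟩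
  have hLY : ∀ z ∈ Y, L z = l z := fun z hz => congrArg (fun f => f ⟨z, hz⟩) hL
  -- The two formulas agree on `frontier U ⊆ Y`, where `exp(l)(z - q) = z - p`. Neither vanishes on
  -- its region, because `q ∉ U` and `p ∈ U`.
  let G : ℂ → ℂ := fun z => if z ∈ U then Complex.exp (L z) * (z - q) else z - p
  have hG : Continuous G := by
    refine Continuous.if (fun z hz => ?_) ?_ ?_
    · rw [hLY z (hfr hz), h z (hfr hz)]
    · have := L.continuous
      fun_prop
    · fun_prop
  have hG0 : ∀ z, G z ≠ 0 := by
    intro z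
    by_cases hz : z ∈ U
    · simp only [G, if_pos hz]
      refine mul_ne_zero (Complex.exp_ne_zero _) fun h0 => ?_
      rw [sub_eq_zero.1 h0] at hz
      exact hqU hz
    · simp only [G, if_neg hz]
      intro h0
      rw [sub_eq_zero.1 h0] at hz
      exact hz hpU
  obtain ⟨R, hR0, hR⟩ := hb.subset_ball_lt 0 p
  refine not_eqOn_sub_of_continuous_of_ne_zero hG hG0 hR0 (p := p) fun z hz => ?_
  have : z ∉ U := fun hzU => by
    have := hR hzU
    rw [Metric.mem_ball, dist_eq_norm, hz] at this
    exact lt_irrefl _ this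
  simp only [G, if_neg this]

/-- If `(z - p) / (z - q)` has a continuous logarithm on a compact set, then this set does not
separate `p` from `q`. -/
lemma HasLogRatio.mem_connectedComponentIn {Y : Set ℂ} (hY : IsCompact Y) {p q : ℂ}
    (hp : p ∉ Y) (hq : q ∉ Y) (h : HasLogRatio Y p q) : q ∈ connectedComponentIn Yᶜ p := by
  by_cases hbp : Bornology.IsBounded (connectedComponentIn Yᶜ p)
  · exact h.mem_connectedComponentIn_of_isBounded hY.isClosed hp hq hbp
  by_cases hbq : Bornology.IsBounded (connectedComponentIn Yᶜ q)
  · have := h.symm.mem_connectedComponentIn_of_isBounded hY.isClosed hq hp hbq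
    rw [← connectedComponentIn_eq this]
    exact _root_.mem_connectedComponentIn hq
  -- If both components are unbounded, both meet the connected exterior of a disk containing `Y`,
  -- hence they coincide.
  obtain ⟨R, hR0, hR⟩ := hY.isBounded.subset_ball_lt 0 0
  have hsub : {z : ℂ | R < ‖z‖} ⊆ Yᶜ := fun z hz hzY => by
    have := hR hzY
    rw [mem_ball_zero_iff] at this
    exact lt_asymm this hz
  have hex : ∀ x : ℂ, ¬ Bornology.IsBounded (connectedComponentIn Yᶜ x) →
      ∃ y ∈ connectedComponentIn Yᶜ x, R < ‖y‖ := by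
    intro x hx
    by_contra! hcon
    exact hx (Metric.isBounded_closedBall.subset fun y hy => mem_closedBall_zero_iff.2 (hcon y hy))
  obtain ⟨x, hxp, hx⟩ := hex p hbp
  obtain ⟨y, hyq, hy⟩ := hex q hbq
  have hyx : y ∈ connectedComponentIn Yᶜ x :=
    (isPreconnected_setOf_lt_norm R hR0).subset_connectedComponentIn hx hsub hy
  rw [connectedComponentIn_eq hxp, connectedComponentIn_eq hyx, ← connectedComponentIn_eq hyq]
  exact _root_.mem_connectedComponentIn hq

end

/-! ### Radii of the disk, and why their limits cannot interlace on the boundary. -/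

section

lemma circleMap_mem_unitDisk {r : ℝ} (h0 : 0 ≤ r) (h1 : r < 1) (θ : ℝ) :
    circleMap 0 r θ ∈ unitDisk := by
  simp [unitDisk, abs_of_nonneg h0, h1]

lemma continuous_circleMap_left (θ : ℝ) : Continuous fun r : ℝ => circleMap 0 r θ := by
  simp only [circleMap]
  fun_prop

/-- The image of a radius together with its end point. -/
def radialArc (u : ℂ → ℂ) (θ : ℝ) (w : ℂ) : Set ℂ :=
  Function.update (fun r : ℝ => u (circleMap 0 r θ)) 1 w '' Icc 0 1

section radialArc

variable {u : ℂ → ℂ} {θ : ℝ} {w : ℂ}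

lemma continuousOn_radialArc (hu : ContinuousOn u unitDisk)
    (hw : Tendsto (fun r : ℝ => u (circleMap 0 r θ)) (𝓝[<] 1) (𝓝 w)) :
    ContinuousOn (Function.update (fun r : ℝ => u (circleMap 0 r θ)) 1 w) (Icc 0 1) := by
  have he : Icc (0 : ℝ) 1 \ {1} = Ico 0 1 := by
    ext r
    simp only [Set.mem_sdiff, mem_Icc, mem_singleton_iff, mem_Ico]
    exact ⟨fun h => ⟨h.1.1, lt_of_le_of_ne h.1.2 h.2⟩, fun h => ⟨⟨h.1, h.2.le⟩, h.2.ne⟩⟩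
  rw [continuousOn_update_iff, he]
  refine ⟨hu.comp (continuous_circleMap_left θ).continuousOn fun r hr =>
    circleMap_mem_unitDisk hr.1 hr.2 θ, fun _ => hw.mono_left (nhdsWithin_mono _ fun r hr => hr.2)⟩

lemma isCompact_radialArc (hu : ContinuousOn u unitDisk)
    (hw : Tendsto (fun r : ℝ => u (circleMap 0 r θ)) (𝓝[<] 1) (𝓝 w)) :
    IsCompact (radialArc u θ w) :=
  isCompact_Icc.image_of_continuousOn (continuousOn_radialArc hu hw)

lemma mem_radialArc_iff {z : ℂ} :
    z ∈ radialArc u θ w ↔ z = w ∨ ∃ r ∈ Ico (0 : ℝ) 1, u (circleMap 0 r θ) = z := by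
  constructor
  · rintro ⟨r, hr, rfl⟩
    rcases eq_or_ne r 1 with rfl | h
    · simp
    · rw [Function.update_of_ne h]
      exact Or.inr ⟨r, ⟨hr.1, lt_of_le_of_ne hr.2 h⟩, rfl⟩
  · rintro (rfl | ⟨r, hr, rfl⟩)
    · exact ⟨1, by simp⟩
    · exact ⟨r, Ico_subset_Icc_self hr, Function.update_of_ne hr.2.ne _ _⟩

end radialArc

lemma IsPreconnected.subset_of_disjoint_frontier {X : Type*} [TopologicalSpace X] {C Ω : Set X}
    (hC : IsPreconnected C) (hΩ : IsOpen Ω) (h : Disjoint C (frontier Ω)) (hne : (C ∩ Ω).Nonempty) :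
    C ⊆ Ω := by
  refine hC.subset_left_of_subset_union hΩ isClosed_closure.isOpen_compl
    (disjoint_left.2 fun x hx hx' => hx' (subset_closure hx)) (fun x hx => ?_) hne
  by_cases hxΩ : x ∈ Ω
  · exact Or.inl hxΩ
  · refine Or.inr fun hcl => disjoint_left.1 h hx ?_
    rw [hΩ.frontier_eq]
    exact ⟨hcl, hxΩ⟩

lemma exists_exp_eq_im_mem_Ico {z : ℂ} (hz : z ≠ 0) (a : ℝ) :
    ∃ w : ℂ, Complex.exp w = z ∧ w.im ∈ Ico a (a + 2 * Real.pi) := by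
  refine ⟨Real.log ‖z‖ + (toIcoMod Real.two_pi_pos a z.arg : ℝ) * Complex.I, ?_, ?_⟩
  · have h := toIcoMod_add_toIcoDiv_zsmul Real.two_pi_pos a z.arg
    have h2 : ((toIcoMod Real.two_pi_pos a z.arg : ℝ) : ℂ) =
        z.arg - toIcoDiv Real.two_pi_pos a z.arg * (2 * Real.pi) := by
      rw [← Complex.ofReal_ofNat, ← Complex.ofReal_mul, ← Complex.ofReal_intCast,
        ← Complex.ofReal_mul, ← Complex.ofReal_sub, eq_sub_of_add_eq h, zsmul_eq_mul]
    rw [h2, sub_mul, ← add_sub_assoc, Complex.exp_sub, ← Complex.log,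
      Complex.exp_log hz, mul_assoc, Complex.exp_int_mul_two_pi_mul_I, div_one]
  · simpa using toIcoMod_mem_Ico Real.two_pi_pos a z.arg

lemma exp_eq_circleMap (w : ℂ) : Complex.exp w = circleMap 0 ‖Complex.exp w‖ w.im := by
  rw [circleMap_zero, Complex.norm_exp, Complex.ofReal_exp, ← Complex.exp_add, Complex.re_add_im]

lemma circleMap_eq_exp {r : ℝ} (hr : 0 < r) (θ : ℝ) :
    circleMap 0 r θ = Complex.exp (Real.log r + θ * Complex.I) := by
  rw [circleMap_zero, Complex.exp_add, ← Complex.ofReal_exp, Real.exp_log hr]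

lemma circleMap_mem_sector {a b r θ : ℝ} (hr : 0 < r) (hθ : θ ∈ Ioo a b) :
    circleMap 0 r θ ∈ Complex.exp '' {w | w.im ∈ Ioo a b} :=
  ⟨_, by simpa using hθ, (circleMap_eq_exp hr θ).symm⟩

lemma isOpen_sector (a b : ℝ) : IsOpen (Complex.exp '' {w | w.im ∈ Ioo a b}) :=
  Complex.isOpenMap_exp _ (isOpen_Ioo.preimage Complex.continuous_im)

/-- Two radii separate the disk. -/
lemma IsPreconnected.not_separated_by_radii {C : Set ℂ} (hC : IsPreconnected C)
    (hD : C ⊆ unitDisk) {θ₀ θ₁ θ₂ θ₃ r₁ r₃ : ℝ} (h01 : θ₀ < θ₁) (h12 : θ₁ < θ₂) (h23 : θ₂ < θ₃)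
    (h30 : θ₃ < θ₀ + 2 * Real.pi) (hr₁ : 0 < r₁) (hr₃ : 0 < r₃) (h1 : circleMap 0 r₁ θ₁ ∈ C)
    (h3 : circleMap 0 r₃ θ₃ ∈ C) (h0 : ∀ r ∈ Ico (0 : ℝ) 1, circleMap 0 r θ₀ ∉ C)
    (h2 : ∀ r ∈ Ico (0 : ℝ) 1, circleMap 0 r θ₂ ∉ C) : False := by
  set S₁ := Complex.exp '' {w | w.im ∈ Ioo θ₀ θ₂}
  set S₂ := Complex.exp '' {w | w.im ∈ Ioo θ₂ (θ₀ + 2 * Real.pi)}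
  -- A common point would have two arguments that differ by `2πn` with `0 < n < 1`.
  have hdisj : Disjoint S₁ S₂ := by
    rw [disjoint_left]
    rintro _ ⟨w, hw, rfl⟩ ⟨w', hw', he⟩
    obtain ⟨n, hn⟩ := Complex.exp_eq_exp_iff_exists_int.1 he
    have him : w'.im = w.im + n * (2 * Real.pi) := by
      rw [hn]
      simp
    simp only [mem_ofPred_eq, mem_Ioo] at hw hw'
    have hpi := Real.pi_pos
    have hn0 : (0 : ℝ) < n := by
      by_contra! hcon
      nlinarith
    have hn1 : (n : ℝ) < 1 := by
      by_contra! hcon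
      nlinarith
    have h0 : 0 < n := by exact_mod_cast hn0
    have h1 : n < 1 := by exact_mod_cast hn1
    omega
  -- The radii are taken with `r = 0` included, so `C` omits the origin and every point of it has an
  -- argument.
  have hcover : C ⊆ S₁ ∪ S₂ := by
    intro z hz
    have hz0 : z ≠ 0 := by
      rintro rfl
      exact h0 0 ⟨le_rfl, one_pos⟩ (by simpa using hz)
    have hz1 : ‖z‖ < 1 := by simpa [unitDisk] using hD hz
    obtain ⟨w, rfl, hw⟩ := exists_exp_eq_im_mem_Ico hz0 θ₀
    have hne0 : w.im ≠ θ₀ := fun h => by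
      rw [exp_eq_circleMap, h] at hz
      exact h0 _ ⟨norm_nonneg _, hz1⟩ hz
    have hne2 : w.im ≠ θ₂ := fun h => by
      rw [exp_eq_circleMap, h] at hz
      exact h2 _ ⟨norm_nonneg _, hz1⟩ hz
    rcases lt_or_gt_of_ne hne2 with h | h
    · exact Or.inl ⟨w, ⟨lt_of_le_of_ne hw.1 hne0.symm, h⟩, rfl⟩
    · exact Or.inr ⟨w, ⟨h, hw.2⟩, rfl⟩
  have hsub := hC.subset_left_of_subset_union (isOpen_sector _ _) (isOpen_sector _ _) hdisj hcover
    ⟨_, h1, circleMap_mem_sector hr₁ ⟨h01, h12⟩⟩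
  exact disjoint_left.1 hdisj (hsub h3) (circleMap_mem_sector hr₃ ⟨h23, h30⟩)

/-- The radial limits of a homeomorphism of the disk onto a bounded domain are not interlaced on
the boundary of the domain. -/
lemma radial_limits_not_interlaced {Ω B : Set ℂ} {u : ℂ → ℂ} (e : unitDisk ≃ₜ Ω)
    (he : ∀ z : unitDisk, (e z : ℂ) = u z) (hΩ : IsOpen Ω) (hΩc : IsPreconnected Ω)
    (hΩb : Bornology.IsBounded Ω)
    (hBc : IsClosed B) (hB : IsPreconnected B) (hBΩ : B ⊆ frontier Ω)
    (hB' : IsPreconnected (frontier Ω \ B)) {θ₀ θ₁ θ₂ θ₃ : ℝ} (h01 : θ₀ < θ₁) (h12 : θ₁ < θ₂)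
    (h23 : θ₂ < θ₃) (h30 : θ₃ < θ₀ + 2 * Real.pi) {w₀ w₁ w₂ w₃ : ℂ}
    (hw₀ : Tendsto (fun r : ℝ => u (circleMap 0 r θ₀)) (𝓝[<] 1) (𝓝 w₀))
    (hw₁ : Tendsto (fun r : ℝ => u (circleMap 0 r θ₁)) (𝓝[<] 1) (𝓝 w₁))
    (hw₂ : Tendsto (fun r : ℝ => u (circleMap 0 r θ₂)) (𝓝[<] 1) (𝓝 w₂))
    (hw₃ : Tendsto (fun r : ℝ => u (circleMap 0 r θ₃)) (𝓝[<] 1) (𝓝 w₃))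
    (hB₀ : w₀ ∈ B) (hB₂ : w₂ ∈ B) (hB₁ : w₁ ∈ frontier Ω \ B) (hB₃ : w₃ ∈ frontier Ω \ B) :
    False := by
  have hmem : ∀ z ∈ unitDisk, u z ∈ Ω := fun z hz => by
    rw [← he ⟨z, hz⟩]
    exact (e ⟨z, hz⟩).2
  have hinj : InjOn u unitDisk := fun x hx y hy hxy => by
    have h1 := he ⟨x, hx⟩
    have h2 := he ⟨y, hy⟩
    have : e ⟨x, hx⟩ = e ⟨y, hy⟩ := Subtype.ext (by rw [h1, h2, hxy])
    exact congrArg Subtype.val (e.injective this)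
  have hu : ContinuousOn u unitDisk := by
    rw [continuousOn_iff_continuous_domRestrict]
    exact (continuous_subtype_val.comp e.continuous).congr he
  have hfr : Disjoint Ω (frontier Ω) := by
    rw [hΩ.frontier_eq]
    exact disjoint_sdiff_right
  set X := radialArc u θ₀ w₀ ∪ radialArc u θ₂ w₂ with hX
  have hXc : IsCompact X := (isCompact_radialArc hu hw₀).union (isCompact_radialArc hu hw₂)
  have hXmem : ∀ z ∈ X, z ∈ B ∨ (∃ r ∈ Ico (0 : ℝ) 1, u (circleMap 0 r θ₀) = z) ∨
      ∃ r ∈ Ico (0 : ℝ) 1, u (circleMap 0 r θ₂) = z := by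
    rintro z (hz | hz) <;> rcases mem_radialArc_iff.1 hz with rfl | h
    · exact Or.inl hB₀
    · exact Or.inr (Or.inl h)
    · exact Or.inl hB₂
    · exact Or.inr (Or.inr h)
  -- The cross-cut `X` meets the boundary only at its end points, which lie in `B`.
  have hXB : ∀ z ∈ X, z ∈ frontier Ω → z ∈ B := by
    intro z hz hzf
    rcases hXmem z hz with h | ⟨r, hr, rfl⟩ | ⟨r, hr, rfl⟩
    · exact h
    · exact (disjoint_left.1 hfr (hmem _ (circleMap_mem_unitDisk hr.1 hr.2 _)) hzf).elim
    · exact (disjoint_left.1 hfr (hmem _ (circleMap_mem_unitDisk hr.1 hr.2 _)) hzf).elim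
  have hJc : IsCompact (frontier Ω) :=
    Metric.isCompact_of_isClosed_isBounded isClosed_frontier
      (hΩb.closure.subset frontier_subset_closure)
  have hBcomp : IsCompact B := hJc.of_isClosed_subset hBc hBΩ
  have hXBc : IsClosed (X ∪ B) := hXc.isClosed.union hBc
  -- Near its limit `w`, outside `X ∪ B`, a radial image can be joined to `w` within a ball that
  -- misses `X ∪ B`.
  have hnear : ∀ θ w, Tendsto (fun r : ℝ => u (circleMap 0 r θ)) (𝓝[<] 1) (𝓝 w) →
      w ∈ frontier Ω \ B → ∃ r ∈ Ioo (0 : ℝ) 1, ∃ V : Set ℂ, IsPreconnected V ∧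
        Disjoint V (X ∪ B) ∧ w ∈ V ∧ u (circleMap 0 r θ) ∈ V := by
    intro θ w hw hwB
    have hwX : w ∈ (X ∪ B)ᶜ := by
      rintro (h | h)
      exacts [hwB.2 (hXB w h hwB.1), hwB.2 h]
    obtain ⟨ε, hε, hb⟩ := Metric.isOpen_iff.1 hXBc.isOpen_compl w hwX
    have h1 := hw.eventually (Metric.ball_mem_nhds w hε)
    have h2 : ∀ᶠ r : ℝ in 𝓝[<] 1, r ∈ Ioo (0 : ℝ) 1 := Ioo_mem_nhdsLT one_pos
    obtain ⟨r, hr1, hr2⟩ := (h1.and h2).exists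
    exact ⟨r, hr2, _, (convex_ball w ε).isPreconnected, disjoint_left.2 fun x hx => hb hx,
      Metric.mem_ball_self hε, hr1⟩
  obtain ⟨r₁, hr₁, V₁, hV₁, hd₁, hwV₁, hp⟩ := hnear θ₁ w₁ hw₁ hB₁
  obtain ⟨r₃, hr₃, V₃, hV₃, hd₃, hwV₃, hq⟩ := hnear θ₃ w₃ hw₃ hB₃
  have hz₁ := circleMap_mem_unitDisk hr₁.1.le hr₁.2 θ₁
  have hz₃ := circleMap_mem_unitDisk hr₃.1.le hr₃.2 θ₃
  set p := u (circleMap 0 r₁ θ₁) with hpdef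
  set q := u (circleMap 0 r₃ θ₃) with hqdef
  have hpΩ : p ∈ Ω := hmem _ hz₁
  have hqΩ : q ∈ Ω := hmem _ hz₃
  -- `p` and `q` are connected off `X ∪ B` by going through the boundary, along the complementary
  -- arc `frontier Ω \ B`.
  have hlog₁ : HasLogRatio (X ∪ B) p q := by
    have hS : IsPreconnected (V₁ ∪ (frontier Ω \ B) ∪ V₃) :=
      (hV₁.union w₁ hwV₁ hB₁ hB').union w₃ (Or.inr hB₃) hwV₃ hV₃
    refine hS.hasLogRatio hXBc ?_ (Or.inl (Or.inl hp)) (Or.inr hq)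
    rw [disjoint_union_left, disjoint_union_left]
    refine ⟨⟨hd₁, disjoint_left.2 ?_⟩, hd₃⟩
    rintro z ⟨hz, hzB⟩ (h | h)
    exacts [hzB (hXB z h hz), hzB h]
  -- Off the boundary, `p` and `q` are connected through `Ω` itself.
  have hlog₂ : HasLogRatio (frontier Ω) p q :=
    hΩc.hasLogRatio isClosed_frontier hfr hpΩ hqΩ
  have hinter : (X ∪ B) ∩ frontier Ω = B := by
    ext z
    constructor
    · rintro ⟨h | h, hz⟩
      exacts [hXB z h hz, h]
    · exact fun h => ⟨Or.inr h, hBΩ h⟩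
  have hpJ : p ∉ frontier Ω := disjoint_left.1 hfr hpΩ
  have hqJ : q ∉ frontier Ω := disjoint_left.1 hfr hqΩ
  -- Janiszewski's principle: neither closed set separates `p` from `q` and their intersection `B`
  -- is connected, so their union does not separate them either.
  have hlog := hlog₁.union hXBc isClosed_frontier (by rwa [hinter]) hqJ hlog₂
  have hpY : p ∉ X ∪ B ∪ frontier Ω := by
    rintro (h | h)
    exacts [disjoint_left.1 hd₁ hp h, hpJ h]
  have hqY : q ∉ X ∪ B ∪ frontier Ω := by
    rintro (h | h)
    exacts [disjoint_left.1 hd₃ hq h, hqJ h]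
  have hcomp := hlog.mem_connectedComponentIn ((hXc.union hBcomp).union hJc) hpY hqY
  set C := connectedComponentIn (X ∪ B ∪ frontier Ω)ᶜ p with hC
  have hpC : p ∈ C := _root_.mem_connectedComponentIn hpY
  have hCsub : C ⊆ (X ∪ B ∪ frontier Ω)ᶜ := connectedComponentIn_subset _ _
  have hCpre : IsPreconnected C := isPreconnected_connectedComponentIn
  have hCΩ : C ⊆ Ω := hCpre.subset_of_disjoint_frontier hΩ
    (disjoint_left.2 fun z hz hz' => hCsub hz (Or.inr hz')) ⟨p, hpC, hpΩ⟩
  -- The component joining `p` to `q` lies in `Ω` and avoids the images of the radii `θ₀` and `θ₂`.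
  -- Its preimage is therefore a connected subset of the disk that crosses from one side of these
  -- radii to the other.
  have hpre : IsPreconnected (((↑) : unitDisk → ℂ) '' (e.symm '' (((↑) : Ω → ℂ) ⁻¹' C))) := by
    refine IsPreconnected.image ?_ _ continuous_subtype_val.continuousOn
    refine IsPreconnected.image ?_ _ e.symm.continuous.continuousOn
    rw [← Topology.IsInducing.subtypeVal.isPreconnected_image, Subtype.image_preimage_coe,
      inter_eq_self_of_subset_right hCΩ]
    exact hCpre
  have hpull : ∀ z (hz : z ∈ unitDisk), z ∈ ((↑) : unitDisk → ℂ) '' (e.symm ''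
      (((↑) : Ω → ℂ) ⁻¹' C)) ↔ u z ∈ C := by
    intro z hz
    constructor
    · rintro ⟨_, ⟨y, hy, rfl⟩, rfl⟩
      rw [← he, e.apply_symm_apply]
      exact hy
    · intro h
      refine ⟨⟨z, hz⟩, ⟨e ⟨z, hz⟩, ?_, e.symm_apply_apply _⟩, rfl⟩
      rw [mem_preimage, he]
      exact h
  refine hpre.not_separated_by_radii (by rintro _ ⟨y, -, rfl⟩; exact y.2) h01 h12 h23 h30
    hr₁.1 hr₃.1 ((hpull _ hz₁).2 hpC) ((hpull _ hz₃).2 hcomp) ?_ ?_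
  · intro r hr
    rw [hpull _ (circleMap_mem_unitDisk hr.1 hr.2 _)]
    exact fun h => hCsub h (Or.inl (Or.inl (Or.inl (mem_radialArc_iff.2 (Or.inr ⟨r, hr, rfl⟩)))))
  · intro r hr
    rw [hpull _ (circleMap_mem_unitDisk hr.1 hr.2 _)]
    exact fun h => hCsub h (Or.inl (Or.inl (Or.inr (mem_radialArc_iff.2 (Or.inr ⟨r, hr, rfl⟩)))))

end

/-! ### Monotone traversal of the boundary curve by the radial limits. -/

section

/-- The curve `γ` with its base point moved to `γ c`. -/
def rotateCurve (γ : ℝ → ℂ) (c t : ℝ) : ℂ := if t ≤ 1 - c then γ (t + c) else γ (t + c - 1)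

section rotateCurve

variable {γ : ℝ → ℂ} {c : ℝ}

lemma rotateCurve_of_le {t : ℝ} (h : t ≤ 1 - c) : rotateCurve γ c t = γ (t + c) := if_pos h

lemma rotateCurve_of_ge (h01 : γ 0 = γ 1) {t : ℝ} (h : 1 - c ≤ t) :
    rotateCurve γ c t = γ (t + c - 1) := by
  rcases h.eq_or_lt with rfl | h
  · rw [rotateCurve_of_le le_rfl]
    simp [h01]
  · exact if_neg (not_le.2 h)

lemma rotateCurve_zero (hc : c < 1) : rotateCurve γ c 0 = γ c := by
  rw [rotateCurve_of_le (by linarith), zero_add]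

lemma image_rotateCurve (h01 : γ 0 = γ 1) (hc : c ∈ Ico (0 : ℝ) 1) :
    rotateCurve γ c '' Icc 0 1 = γ '' Icc 0 1 := by
  ext z
  constructor
  · rintro ⟨t, ht, rfl⟩
    rcases le_total t (1 - c) with h | h
    · exact ⟨t + c, ⟨by linarith [ht.1, hc.1], by linarith⟩, (rotateCurve_of_le h).symm⟩
    · exact ⟨t + c - 1, ⟨by linarith, by linarith [ht.2, hc.2]⟩, (rotateCurve_of_ge h01 h).symm⟩
  · rintro ⟨t, ht, rfl⟩
    rcases le_total c t with h | h
    · refine ⟨t - c, ⟨by linarith, by linarith [ht.2, hc.1]⟩, ?_⟩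
      rw [rotateCurve_of_le (by linarith [ht.2]), sub_add_cancel]
    · refine ⟨t - c + 1, ⟨by linarith [ht.1, hc.2], by linarith⟩, ?_⟩
      rw [rotateCurve_of_ge h01 (by linarith [ht.1])]
      congr 1
      ring

/-- The rotation exchanges the arcs over `[0,c]` and `[c,1]`, and variation is additive over them.
-/
lemma eVariationOn_rotateCurve_le (h01 : γ 0 = γ 1) (hc : c ∈ Ico (0 : ℝ) 1) :
    eVariationOn (rotateCurve γ c) (Icc 0 1) ≤ eVariationOn γ (Icc 0 1) := by
  have h1 : eVariationOn (rotateCurve γ c) (Icc 0 (1 - c)) ≤ eVariationOn γ (Icc c 1) := by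
    rw [eVariationOn.congr (g := γ ∘ fun t => t + c) fun t ht => rotateCurve_of_le ht.2]
    exact eVariationOn.comp_le_of_monotoneOn _ _ (fun x _ y _ h => by simpa using h)
      fun t ht => ⟨by linarith [ht.1], by linarith [ht.2]⟩
  have h2 : eVariationOn (rotateCurve γ c) (Icc (1 - c) 1) ≤ eVariationOn γ (Icc 0 c) := by
    rw [eVariationOn.congr (g := γ ∘ fun t => t + c - 1) fun t ht => rotateCurve_of_ge h01 ht.1]
    exact eVariationOn.comp_le_of_monotoneOn _ _ (fun x _ y _ h => by simpa using h)
      fun t ht => ⟨by linarith [ht.1], by linarith [ht.2]⟩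
  have e1 := eVariationOn.Icc_add_Icc (rotateCurve γ c) (s := univ) (a := 0) (b := 1 - c) (c := 1)
    (by linarith [hc.2]) (by linarith [hc.1]) (mem_univ _)
  have e2 := eVariationOn.Icc_add_Icc γ (s := univ) (a := 0) (b := c) (c := 1)
    hc.1 hc.2.le (mem_univ _)
  simp only [univ_inter] at e1 e2
  rw [← e1, ← e2, add_comm]
  exact add_le_add h2 h1

lemma IsRectifiableJordanCurve.rotateCurve (h : IsRectifiableJordanCurve γ)
    (hc : c ∈ Ico (0 : ℝ) 1) : IsRectifiableJordanCurve (rotateCurve γ c) where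
  continuousOn := by
    have hu : Icc (0 : ℝ) 1 = Icc 0 (1 - c) ∪ Icc (1 - c) 1 :=
      (Icc_union_Icc_eq_Icc (by linarith [hc.2]) (by linarith [hc.1])).symm
    rw [hu]
    refine ContinuousOn.union_of_isClosed ?_ ?_ isClosed_Icc isClosed_Icc
    · refine ContinuousOn.congr (f := γ ∘ fun t => t + c) ?_ fun t ht => rotateCurve_of_le ht.2
      exact h.continuousOn.comp (by fun_prop) fun t ht =>
        ⟨by linarith [ht.1, hc.1], by linarith [ht.2]⟩
    · refine ContinuousOn.congr (f := γ ∘ fun t => t + c - 1) ?_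
        fun t ht => rotateCurve_of_ge h.closed ht.1
      exact h.continuousOn.comp (by fun_prop) fun t ht =>
        ⟨by linarith [ht.1, hc.1], by linarith [ht.2, hc.2]⟩
  closed := by
    rw [rotateCurve_zero hc.2, rotateCurve_of_ge h.closed (by linarith [hc.1])]
    congr 1
    ring
  injOn := by
    intro x hx y hy hxy
    rcases lt_or_ge x (1 - c) with hx' | hx' <;> rcases lt_or_ge y (1 - c) with hy' | hy'
    · rw [rotateCurve_of_le hx'.le, rotateCurve_of_le hy'.le] at hxy
      have := h.injOn ⟨by linarith [hx.1, hc.1], by linarith⟩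
        ⟨by linarith [hy.1, hc.1], by linarith⟩ hxy
      linarith
    · rw [rotateCurve_of_le hx'.le, rotateCurve_of_ge h.closed hy'] at hxy
      have := h.injOn ⟨by linarith [hx.1, hc.1], by linarith⟩
        ⟨by linarith, by linarith [hy.2, hc.2]⟩ hxy
      linarith [hx.1, hy.2]
    · rw [rotateCurve_of_ge h.closed hx', rotateCurve_of_le hy'.le] at hxy
      have := h.injOn ⟨by linarith, by linarith [hx.2, hc.2]⟩
        ⟨by linarith [hy.1, hc.1], by linarith⟩ hxy
      linarith [hx.2, hy.1]
    · rw [rotateCurve_of_ge h.closed hx', rotateCurve_of_ge h.closed hy'] at hxy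
      have := h.injOn ⟨by linarith, by linarith [hx.2, hc.2]⟩
        ⟨by linarith, by linarith [hy.2, hc.2]⟩ hxy
      linarith
  rectifiable := ne_top_of_le_ne_top h.rectifiable (eVariationOn_rotateCurve_le h.closed hc)

end rotateCurve

/-- The point with parameter `1` is removed as well, being the base point. What remains is an open
arc, whose connectedness is what the non-interlacing lemma asks for. -/
lemma IsRectifiableJordanCurve.image_diff_image_Icc_zero {γ : ℝ → ℂ}
    (h : IsRectifiableJordanCurve γ) {a : ℝ} (ha : a ∈ Ico (0 : ℝ) 1) :
    γ '' Icc 0 1 \ γ '' Icc 0 a = γ '' Ioo a 1 := by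
  ext z
  constructor
  · rintro ⟨⟨t, ht, rfl⟩, hz⟩
    have hat : a < t := by
      by_contra! hcon
      exact hz ⟨t, ⟨ht.1, hcon⟩, rfl⟩
    refine ⟨t, ⟨hat, lt_of_le_of_ne ht.2 ?_⟩, rfl⟩
    rintro rfl
    exact hz ⟨0, ⟨le_rfl, ha.1⟩, h.closed⟩
  · rintro ⟨t, ht, rfl⟩
    refine ⟨⟨t, ⟨ha.1.trans ht.1.le, ht.2.le⟩, rfl⟩, ?_⟩
    rintro ⟨t', ht', he⟩
    have := h.injOn ⟨ht'.1, ht'.2.trans_lt ha.2⟩ ⟨ha.1.trans ht.1.le, ht.2⟩ he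
    linarith [ht'.2, ht.1]

lemma IsRectifiableJordanCurve.image_diff_image_Icc_one {γ : ℝ → ℂ}
    (h : IsRectifiableJordanCurve γ) {a : ℝ} (ha : a ∈ Ioo (0 : ℝ) 1) :
    γ '' Icc 0 1 \ γ '' Icc a 1 = γ '' Ioo 0 a := by
  ext z
  constructor
  · rintro ⟨⟨t, ht, rfl⟩, hz⟩
    have hat : t < a := by
      by_contra! hcon
      exact hz ⟨t, ⟨hcon, ht.2⟩, rfl⟩
    refine ⟨t, ⟨lt_of_le_of_ne ht.1 ?_, hat⟩, rfl⟩
    rintro rfl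
    exact hz ⟨1, ⟨ha.2.le, le_rfl⟩, h.closed.symm⟩
  · rintro ⟨t, ht, rfl⟩
    refine ⟨⟨t, ⟨ht.1.le, (ht.2.trans ha.2).le⟩, rfl⟩, ?_⟩
    rintro ⟨t', ht', he⟩
    rcases ht'.2.eq_or_lt with rfl | hlt
    · rw [← h.closed] at he
      have := h.injOn ⟨le_rfl, one_pos⟩ ⟨ht.1.le, ht.2.trans ha.2⟩ he
      exact ht.1.ne this
    · have := h.injOn ⟨ha.1.le.trans ht'.1, hlt⟩ ⟨ht.1.le, ht.2.trans ha.2⟩ he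
      linarith [ht'.1, ht.2]

/-- Betweenness makes the parameter `s` monotone or antitone wherever it is nonzero. Angles sent to
the base point cannot lie between two such angles, so they sit at the ends, and there the parameter
may be chosen as `0` or `1` to make the whole reparametrization monotone or antitone. -/
lemma eVariationOn_le_of_mem_uIcc {γ w : ℝ → ℂ} (hγ : γ 0 = γ 1) {s : ℝ → ℝ} {T : Set ℝ}
    (hs : ∀ θ ∈ T, s θ ∈ Ico (0 : ℝ) 1) (hw : ∀ θ ∈ T, γ (s θ) = w θ)
    (hb : ∀ i ∈ T, ∀ j ∈ T, ∀ k ∈ T, i < j → j < k → s i ≠ 0 → s k ≠ 0 → s j ∈ uIcc (s i) (s k)) :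
    eVariationOn w T ≤ eVariationOn γ (Icc 0 1) := by
  classical
  set I : Set ℝ := {θ ∈ T | s θ ≠ 0} with hI
  have hconv : ∀ i ∈ I, ∀ j ∈ T, ∀ k ∈ I, i < j → j < k → j ∈ I := by
    intro i hi j hj k hk hij hjk
    refine ⟨hj, fun h0 => ?_⟩
    have := (hb i hi.1 j hj k hk.1 hij hjk hi.2 hk.2).1
    rw [h0] at this
    have h1 := lt_of_le_of_ne (hs i hi.1).1 hi.2.symm
    have h2 := lt_of_le_of_ne (hs k hk.1).1 hk.2.symm
    exact absurd this (not_le.2 (lt_min h1 h2))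
  have hmono : MonotoneOn s I ∨ AntitoneOn s I := by
    rw [Set.monotoneOn_or_antitoneOn_iff_uIcc]
    intro a ha b hb' c hc hcab
    rcases eq_or_ne c a with rfl | hca
    · exact left_mem_uIcc
    rcases eq_or_ne c b with rfl | hcb
    · exact right_mem_uIcc
    rcases le_total a b with hab | hab
    · rw [uIcc_of_le hab] at hcab
      exact hb a ha.1 c hc.1 b hb'.1 (lt_of_le_of_ne hcab.1 hca.symm)
        (lt_of_le_of_ne hcab.2 hcb) ha.2 hb'.2
    · rw [uIcc_of_ge hab] at hcab
      rw [uIcc_comm]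
      exact hb b hb'.1 c hc.1 a ha.1 (lt_of_le_of_ne hcab.1 hcb.symm)
        (lt_of_le_of_ne hcab.2 hca) hb'.2 ha.2
  -- `S` takes the value `x` at base-point angles before every element of `I` and `y` after some
  -- element of it. The pair `(0,1)` fits the increasing case and `(1,0)` the decreasing one; `γ 0 =
  -- γ 1` makes either choice harmless.
  have hfin : ∀ x y : ℝ, (x = 0 ∧ y = 1 ∨ x = 1 ∧ y = 0) →
      let S : ℝ → ℝ := fun θ => if θ ∈ I then s θ else if ∃ j ∈ I, j < θ then y else x
      MapsTo S T (Icc 0 1) ∧ ∀ θ ∈ T, w θ = γ (S θ) := by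
    intro x y hxy S
    refine ⟨fun θ hθ => ?_, fun θ hθ => ?_⟩
    · by_cases h : θ ∈ I
      · simp only [S, if_pos h]
        exact Ico_subset_Icc_self (hs θ hθ)
      · simp only [S, if_neg h]
        split_ifs <;> rcases hxy with ⟨rfl, rfl⟩ | ⟨rfl, rfl⟩ <;> simp
    · by_cases h : θ ∈ I
      · simp only [S, if_pos h, hw θ hθ]
      · have h0 : s θ = 0 := by
          by_contra hcon
          exact h ⟨hθ, hcon⟩
        rw [← hw θ hθ, h0]
        simp only [S, if_neg h]
        split_ifs <;> rcases hxy with ⟨rfl, rfl⟩ | ⟨rfl, rfl⟩ <;> simp [hγ]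
  rcases hmono with hm | hm
  · obtain ⟨hmaps, heq⟩ := hfin 0 1 (Or.inl ⟨rfl, rfl⟩)
    rw [eVariationOn.congr heq]
    refine eVariationOn.comp_le_of_monotoneOn γ _ ?_ hmaps
    intro a ha b hb' hab
    rcases hab.eq_or_lt with rfl | hab'
    · exact le_rfl
    by_cases haI : a ∈ I <;> by_cases hbI : b ∈ I
    · simp only [if_pos haI, if_pos hbI]
      exact hm haI hbI hab
    · simp only [if_pos haI, if_neg hbI, if_pos (⟨a, haI, hab'⟩ : ∃ j ∈ I, j < b)]
      exact (hs a ha).2.le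
    · have : ¬ ∃ j ∈ I, j < a := fun ⟨j, hj, hja⟩ => haI (hconv j hj a ha b hbI hja hab')
      simp only [if_neg haI, if_pos hbI, if_neg this]
      exact (hs b hb').1
    · simp only [if_neg haI, if_neg hbI]
      by_cases h : ∃ j ∈ I, j < a
      · obtain ⟨j, hj, hja⟩ := h
        rw [if_pos ⟨j, hj, hja⟩, if_pos ⟨j, hj, hja.trans hab'⟩]
      · rw [if_neg h]
        split_ifs <;> norm_num
  · obtain ⟨hmaps, heq⟩ := hfin 1 0 (Or.inr ⟨rfl, rfl⟩)
    rw [eVariationOn.congr heq]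
    refine eVariationOn.comp_le_of_antitoneOn γ _ ?_ hmaps
    intro a ha b hb' hab
    rcases hab.eq_or_lt with rfl | hab'
    · exact le_rfl
    by_cases haI : a ∈ I <;> by_cases hbI : b ∈ I
    · simp only [if_pos haI, if_pos hbI]
      exact hm haI hbI hab
    · simp only [if_pos haI, if_neg hbI, if_pos (⟨a, haI, hab'⟩ : ∃ j ∈ I, j < b)]
      exact (hs a ha).1
    · have : ¬ ∃ j ∈ I, j < a := fun ⟨j, hj, hja⟩ => haI (hconv j hj a ha b hbI hja hab')
      simp only [if_neg haI, if_pos hbI, if_neg this]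
      exact (hs b hb').2.le
    · simp only [if_neg haI, if_neg hbI]
      by_cases h : ∃ j ∈ I, j < a
      · obtain ⟨j, hj, hja⟩ := h
        rw [if_pos ⟨j, hj, hja.trans hab'⟩, if_pos ⟨j, hj, hja⟩]
      · rw [if_neg h]
        split_ifs <;> norm_num

/-- `w` is the radial limit of `u` at the angle `θ`. -/
def HasRadialLimit (u : ℂ → ℂ) (θ : ℝ) (w : ℂ) : Prop :=
  Tendsto (fun r : ℝ => u (circleMap 0 r θ)) (𝓝[<] 1) (𝓝 w)

/-- A limit inside `Ω` would pull back under the inverse homeomorphism to a point of the open disk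
to which the radius converges, whereas the radius converges to the unit circle. -/
lemma HasRadialLimit.mem_frontier {Ω : Set ℂ} {u : ℂ → ℂ} (e : unitDisk ≃ₜ Ω)
    (he : ∀ z : unitDisk, (e z : ℂ) = u z) (hΩ : IsOpen Ω) {θ : ℝ} {w : ℂ}
    (h : HasRadialLimit u θ w) : w ∈ frontier Ω := by
  have hev : ∀ᶠ r : ℝ in 𝓝[<] 1, r ∈ Ioo (0 : ℝ) 1 := Ioo_mem_nhdsLT one_pos
  have hmem : ∀ z ∈ unitDisk, u z ∈ Ω := fun z hz => by
    rw [← he ⟨z, hz⟩]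
    exact (e ⟨z, hz⟩).2
  rw [hΩ.frontier_eq]
  refine ⟨mem_closure_of_tendsto h (hev.mono fun r hr =>
    hmem _ (circleMap_mem_unitDisk hr.1.le hr.2 _)), fun hw => ?_⟩
  have hlim : Tendsto (fun r : ℝ => circleMap 0 r θ) (𝓝[<] 1)
      (𝓝 ((e.symm ⟨w, hw⟩ : unitDisk) : ℂ)) := by
    have h1 : Tendsto (fun r : ℝ => if hr : r ∈ Ioo (0 : ℝ) 1 then
        e ⟨circleMap 0 r θ, circleMap_mem_unitDisk hr.1.le hr.2 θ⟩ else ⟨w, hw⟩)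
        (𝓝[<] 1) (𝓝 (⟨w, hw⟩ : Ω)) := by
      rw [tendsto_subtype_rng]
      refine h.congr' (hev.mono fun r hr => ?_)
      simp only [dif_pos hr, he]
    have h2 := (continuous_subtype_val.tendsto _).comp ((e.symm.continuous.tendsto _).comp h1)
    refine h2.congr' (hev.mono fun r hr => ?_)
    simp only [Function.comp_apply, dif_pos hr, e.symm_apply_apply]
  have hlim' : Tendsto (fun r : ℝ => circleMap 0 r θ) (𝓝[<] 1) (𝓝 (circleMap 0 1 θ)) :=
    ((continuous_circleMap_left θ).tendsto 1).mono_left nhdsWithin_le_nhds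
  have heq := tendsto_nhds_unique hlim hlim'
  have := (e.symm ⟨w, hw⟩ : unitDisk).2
  rw [heq] at this
  simp [unitDisk] at this

/-- The radial limits of a homeomorphism of the disk onto a Jordan domain traverse the boundary
curve monotonically, so that their variation is at most the length of that curve. -/
lemma eVariationOn_radial_limits_le {Ω : Set ℂ} {γ : ℝ → ℂ} {u : ℂ → ℂ} (e : unitDisk ≃ₜ Ω)
    (he : ∀ z : unitDisk, (e z : ℂ) = u z) (h : IsDomainBoundedBy Ω γ) {w : ℝ → ℂ} {T : Set ℝ}
    {θ₀ : ℝ} (hT : T ⊆ Icc θ₀ (θ₀ + 2 * Real.pi)) (h₀ : θ₀ ∈ T)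
    (hlim : ∀ θ ∈ T, HasRadialLimit u θ (w θ)) : eVariationOn w T ≤ curveLength γ := by
  have hsurj : ∀ δ : ℝ → ℂ, δ 0 = δ 1 → ∀ z ∈ δ '' Icc 0 1, ∃ t ∈ Ico (0 : ℝ) 1, δ t = z := by
    rintro δ hδ _ ⟨t, ht, rfl⟩
    rcases ht.2.eq_or_lt with rfl | hlt
    · exact ⟨0, ⟨le_rfl, one_pos⟩, hδ⟩
    · exact ⟨t, ⟨ht.1, hlt⟩, rfl⟩
  have hmem : ∀ θ ∈ T, w θ ∈ γ '' Icc 0 1 := fun θ hθ =>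
    h.frontier_eq ▸ (hlim θ hθ).mem_frontier e he h.isOpen
  -- Moving the base point of the curve to the limit at `θ₀` makes that limit the fixed first point
  -- of every interlacing test.
  obtain ⟨c, hc, hcw⟩ := hsurj γ h.jordan.closed _ (hmem θ₀ h₀)
  set δ := rotateCurve γ c with hδ
  have hδJ : IsRectifiableJordanCurve δ := h.jordan.rotateCurve hc
  have hfr : frontier Ω = δ '' Icc 0 1 := by
    rw [h.frontier_eq, image_rotateCurve h.jordan.closed hc]
  have hex : ∀ θ, ∃ t, θ ∈ T → t ∈ Ico (0 : ℝ) 1 ∧ δ t = w θ := by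
    intro θ
    by_cases hθ : θ ∈ T
    · obtain ⟨t, ht, htw⟩ := hsurj δ hδJ.closed (w θ)
        (by rw [image_rotateCurve h.jordan.closed hc]; exact hmem θ hθ)
      exact ⟨t, fun _ => ⟨ht, htw⟩⟩
    · exact ⟨0, fun h => (hθ h).elim⟩
  choose s hs using hex
  have hδ0 : δ 0 = w θ₀ := by rw [hδ, rotateCurve_zero hc.2, hcw]
  have hs0 : ∀ θ ∈ T, w θ = w θ₀ → s θ = 0 := fun θ hθ hw =>
    hδJ.injOn (hs θ hθ).1 ⟨le_rfl, one_pos⟩ (by rw [(hs θ hθ).2, hδ0, hw])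
  refine (eVariationOn_le_of_mem_uIcc hδJ.closed (fun θ hθ => (hs θ hθ).1)
    (fun θ hθ => (hs θ hθ).2) ?_).trans (eVariationOn_rotateCurve_le h.jordan.closed hc)
  intro i hi j hj k hk hij hjk hi0 hk0
  -- The angles `θ₀` and `θ₀ + 2π` both have parameter `0`, so nonzero parameters force strict
  -- inequalities, as the four-angle lemma requires.
  have hi' : θ₀ < i := by
    refine lt_of_le_of_ne (hT hi).1 ?_
    rintro rfl
    exact hi0 (hs0 _ hi rfl)
  have hk' : k < θ₀ + 2 * Real.pi := by
    refine lt_of_le_of_ne (hT hk).2 ?_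
    rintro rfl
    refine hk0 (hs0 _ hk (tendsto_nhds_unique (hlim _ hk) ?_))
    have : ∀ r : ℝ, circleMap 0 r (θ₀ + 2 * Real.pi) = circleMap 0 r θ₀ := fun r =>
      periodic_circleMap 0 r θ₀
    simp only [this]
    exact hlim _ h₀
  have hipos : 0 < s i := lt_of_le_of_ne (hs i hi).1.1 hi0.symm
  have hkpos : 0 < s k := lt_of_le_of_ne (hs k hk).1.1 hk0.symm
  have hcross := fun (B : Set ℂ) h1 h2 h3 h4 => radial_limits_not_interlaced (B := B) e he h.isOpen
    h.isConnected.isPreconnected h.isBounded h1 h2 h3 h4 hi' hij hjk hk' (hlim _ h₀) (hlim _ hi)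
    (hlim _ hj) (hlim _ hk)
  have hcont : ∀ a b : ℝ, 0 ≤ a → b ≤ 1 → ContinuousOn δ (Icc a b) := fun a b ha hb =>
    hδJ.continuousOn.mono (Icc_subset_Icc ha hb)
  have hconto : ∀ a b : ℝ, 0 ≤ a → b ≤ 1 → IsPreconnected (δ '' Ioo a b) := fun a b ha hb =>
    isPreconnected_Ioo.image _ ((hcont a b ha hb).mono Ioo_subset_Icc_self)
  have hj1 := (hs j hj).1
  by_contra hcon
  rw [uIcc, mem_Icc, not_and_or, not_le, not_le] at hcon
  rcases hcon with hlt | hlt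
  -- If `s j` is below both neighbours, the arc from the base point up to `s j` contains the limits
  -- at `θ₀` and `j` and misses those at `i` and `k`: an interlacing.
  · have hd := hδJ.image_diff_image_Icc_zero hj1
    rw [lt_inf_iff] at hlt
    refine hcross (δ '' Icc 0 (s j))
      (isCompact_Icc.image_of_continuousOn (hcont _ _ le_rfl hj1.2.le)).isClosed
      (isPreconnected_Icc.image _ (hcont _ _ le_rfl hj1.2.le))
      (hfr ▸ image_mono (Icc_subset_Icc le_rfl hj1.2.le)) ?_ ?_ ?_ ?_ ?_
    · rw [hfr, hd]
      exact hconto _ _ hj1.1 le_rfl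
    · exact ⟨0, ⟨le_rfl, hj1.1⟩, hδ0⟩
    · exact ⟨s j, ⟨hj1.1, le_rfl⟩, (hs j hj).2⟩
    · rw [hfr, hd]
      exact ⟨s i, ⟨hlt.1, (hs i hi).1.2⟩, (hs i hi).2⟩
    · rw [hfr, hd]
      exact ⟨s k, ⟨hlt.2, (hs k hk).1.2⟩, (hs k hk).2⟩
  -- If `s j` is above both, the arc from `s j` to parameter `1` plays the same role, reaching the
  -- base point from its other end.
  · rw [sup_lt_iff] at hlt
    have hd := hδJ.image_diff_image_Icc_one ⟨hipos.trans hlt.1, hj1.2⟩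
    refine hcross (δ '' Icc (s j) 1)
      (isCompact_Icc.image_of_continuousOn (hcont _ _ hj1.1 le_rfl)).isClosed
      (isPreconnected_Icc.image _ (hcont _ _ hj1.1 le_rfl))
      (hfr ▸ image_mono (Icc_subset_Icc hj1.1 le_rfl)) ?_ ?_ ?_ ?_ ?_
    · rw [hfr, hd]
      exact hconto _ _ le_rfl hj1.2.le
    · exact ⟨1, ⟨hj1.2.le, le_rfl⟩, hδJ.closed ▸ hδ0⟩
    · exact ⟨s j, ⟨le_rfl, hj1.2.le⟩, (hs j hj).2⟩
    · rw [hfr, hd]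
      exact ⟨s i, ⟨hipos, hlt.1⟩, (hs i hi).2⟩
    · rw [hfr, hd]
      exact ⟨s k, ⟨hkpos, hlt.2⟩, (hs k hk).2⟩

/-- The polygon inscribed into the radial limits at equally spaced angles is not longer than the
boundary curve. -/
lemma sum_edist_radial_limits_le {Ω : Set ℂ} {γ : ℝ → ℂ} {u : ℂ → ℂ} (e : unitDisk ≃ₜ Ω)
    (he : ∀ z : unitDisk, (e z : ℂ) = u z) (h : IsDomainBoundedBy Ω γ) {w : ℝ → ℂ} {n : ℕ}
    (hn : n ≠ 0) {θ : ℝ}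
    (hlim : ∀ j ∈ Finset.range (n + 1),
      HasRadialLimit u (θ + j * (2 * Real.pi / n)) (w (θ + j * (2 * Real.pi / n)))) :
    ∑ j ∈ Finset.range n, edist (w (θ + (j + 1 : ℕ) * (2 * Real.pi / n)))
      (w (θ + j * (2 * Real.pi / n))) ≤ curveLength γ := by
  have hpi := Real.pi_pos
  have hn0 : (0 : ℝ) < n := by positivity
  have hd : 0 < 2 * Real.pi / n := by positivity
  -- The `n + 1` angles include both `θ` and `θ + 2π`, so the polygon is closed.
  set T : Set ℝ := (fun j : ℕ => θ + j * (2 * Real.pi / n)) '' Finset.range (n + 1) with hTdef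
  have hT : T ⊆ Icc θ (θ + 2 * Real.pi) := by
    rintro _ ⟨j, hj, rfl⟩
    have hj' : (j : ℝ) ≤ n := by
      rw [Finset.mem_coe, Finset.mem_range] at hj
      exact_mod_cast Nat.lt_succ_iff.1 hj
    have h1 : (0 : ℝ) ≤ j * (2 * Real.pi / n) := by positivity
    have h2 : (j : ℝ) * (2 * Real.pi / n) ≤ n * (2 * Real.pi / n) := by gcongr
    rw [mul_div_cancel₀ _ hn0.ne'] at h2
    exact ⟨by linarith, by linarith⟩
  refine le_trans ?_ (eVariationOn_radial_limits_le e he h hT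
    ⟨0, by simp, by simp⟩ (by rintro _ ⟨j, hj, rfl⟩; exact hlim j hj))
  refine eVariationOn.sum_le_of_monotoneOn_Iic (u := fun j : ℕ => θ + j * (2 * Real.pi / n)) ?_ ?_
  · intro a _ b _ hab
    have : (a : ℝ) ≤ b := by exact_mod_cast hab
    simp only
    gcongr
  · intro j hj
    exact ⟨j, by simpa [Nat.lt_succ_iff] using hj, rfl⟩

end

/-! ### Pointwise dilatation, finite Dirichlet integral and existence of radial limits. -/

section

lemma isOpen_unitDisk : IsOpen unitDisk := Metric.isOpen_ball

section wirtinger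

variable {u : ℂ → ℂ}

lemma fderiv_apply_eq_wirtinger (u : ℂ → ℂ) (z h : ℂ) :
    fderiv ℝ u z h = wirtinger u z * h + wirtingerBar u z * (starRingEnd ℂ) h := by
  have h1 : h = h.re • (1 : ℂ) + h.im • Complex.I := by
    simp
  have h2 : fderiv ℝ u z h = h.re * fderiv ℝ u z 1 + h.im * fderiv ℝ u z Complex.I := by
    conv_lhs => rw [h1]
    rw [map_add, map_smul, map_smul]
    simp
  have h3 : h = h.re + h.im * Complex.I := (Complex.re_add_im h).symm
  have h4 : (starRingEnd ℂ) h = h.re - h.im * Complex.I := by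
    apply Complex.ext <;> simp
  rw [h2, wirtinger, wirtingerBar, h4]
  conv_rhs => rw [h3]
  simp only [Complex.add_re, Complex.ofReal_re, Complex.mul_re, Complex.I_re, mul_zero,
    Complex.ofReal_im, Complex.I_im, mul_one, sub_self, add_zero, Complex.add_im, Complex.mul_im,
    zero_add]
  linear_combination ((h.im : ℂ) * fderiv ℝ u z Complex.I) * Complex.I_sq

lemma norm_fderiv_le_wirtinger (u : ℂ → ℂ) (z : ℂ) :
    ‖fderiv ℝ u z‖ ≤ ‖wirtinger u z‖ + ‖wirtingerBar u z‖ := by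
  refine ContinuousLinearMap.opNorm_le_bound _ (by positivity) fun h => ?_
  rw [fderiv_apply_eq_wirtinger, add_mul]
  refine (norm_add_le _ _).trans (le_of_eq ?_)
  simp

lemma det_fderiv_eq_wirtinger (u : ℂ → ℂ) (z : ℂ) :
    (fderiv ℝ u z).det = ‖wirtinger u z‖ ^ 2 - ‖wirtingerBar u z‖ ^ 2 := by
  have h1 := fderiv_apply_eq_wirtinger u z 1
  have h2 := fderiv_apply_eq_wirtinger u z Complex.I
  rw [ContinuousLinearMap.det, ← LinearMap.det_toMatrix Complex.basisOneI, Matrix.det_fin_two]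
  simp only [LinearMap.toMatrix_apply, Complex.coe_basisOneI, Complex.coe_basisOneI_repr,
    ContinuousLinearMap.coe_coe, Matrix.cons_val_zero, Matrix.cons_val_one]
  rw [h1, h2, ← Complex.normSq_eq_norm_sq, ← Complex.normSq_eq_norm_sq]
  simp [Complex.normSq_apply]
  ring

lemma continuousOn_wirtinger (hu : ContDiffOn ℝ 1 u unitDisk) :
    ContinuousOn (wirtinger u) unitDisk := by
  have h := hu.continuousOn_fderiv_of_isOpen isOpen_unitDisk le_rfl
  exact ((h.clm_apply continuousOn_const).sub
    (continuousOn_const.mul (h.clm_apply continuousOn_const))).div_const _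

lemma continuousOn_wirtingerBar (hu : ContDiffOn ℝ 1 u unitDisk) :
    ContinuousOn (wirtingerBar u) unitDisk := by
  have h := hu.continuousOn_fderiv_of_isOpen isOpen_unitDisk le_rfl
  exact ((h.clm_apply continuousOn_const).add
    (continuousOn_const.mul (h.clm_apply continuousOn_const))).div_const _

end wirtinger

/-- The weak derivative of a continuously differentiable function is the classical one. -/
lemma IsWeakDirDerivOn.ae_eq_fderiv {Ω : Set ℂ} {u g : ℂ → ℂ} {v : ℂ}
    (h : IsWeakDirDerivOn Ω v u g) (hΩ : IsOpen Ω) (hu : ContDiffOn ℝ 1 u Ω) (hg : IsLocL2On Ω g) :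
    ∀ᵐ z ∂(volume.restrict Ω), g z = fderiv ℝ u z v := by
  have hdu : ContinuousOn (fun z => fderiv ℝ u z v) Ω :=
    (hu.continuousOn_fderiv_of_isOpen hΩ le_rfl).clm_apply continuousOn_const
  have hgi : ∀ C ⊆ Ω, IsCompact C → IntegrableOn g C := fun C hC hCc => by
    have : IsFiniteMeasure (volume.restrict C) := ⟨by simpa using hCc.measure_lt_top⟩
    exact (hg C hC hCc).integrable one_le_two
  have hloc : LocallyIntegrableOn (fun z => g z - fderiv ℝ u z v) Ω :=
    ((locallyIntegrableOn_iff hΩ.isLocallyClosed).2 hgi).sub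
      (hdu.locallyIntegrableOn hΩ.measurableSet)
  have hz : ∀ᵐ z ∂(volume : Measure ℂ), z ∈ Ω → g z - fderiv ℝ u z v = 0 := by
    refine hΩ.ae_eq_zero_of_integral_contDiff_smul_eq_zero hloc fun φ hφ hφc hφs => ?_
    have hsupp : ∀ f : ℂ → ℂ, Function.support (fun z => φ z • f z) ⊆ tsupport φ := fun f z hz => by
      refine subset_tsupport φ fun h0 => hz ?_
      simp [h0]
    have hint : ∀ f : ℂ → ℂ, IntegrableOn f (tsupport φ) → Integrable fun z => φ z • f z :=
      fun f hf => (integrableOn_iff_integrable_of_support_subset (hsupp f)).1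
        (hf.continuousOn_smul hφ.continuous.continuousOn hφc)
    have hint1 : Integrable fun z => φ z • g z := hint g (hgi _ hφs hφc)
    have hint2 : Integrable fun z => φ z • fderiv ℝ u z v :=
      hint _ ((hdu.mono hφs).integrableOn_compact hφc)
    have hint3 : Integrable fun z => φ z • u z :=
      hint _ ((hu.continuousOn.mono hφs).integrableOn_compact hφc)
    have hsupp' : Function.support (fun z => fderiv ℝ φ z v • u z) ⊆ tsupport φ := fun z hz => by
      refine support_fderiv_subset ℝ fun h0 => hz ?_
      simp [h0]
    have hint4 : Integrable fun z => fderiv ℝ φ z v • u z := by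
      refine (integrableOn_iff_integrable_of_support_subset hsupp').1 ?_
      refine ((hu.continuousOn.mono hφs).integrableOn_compact hφc).continuousOn_smul ?_ hφc
      exact ((hφ.continuous_fderiv (by simp)).clm_apply continuous_const).continuousOn
    have hibp := integral_smul_fderiv_eq_neg_fderiv_smul_of_integrable hint4 hint2 hint3
      (fun x _ => (hφ.differentiable (by simp)).differentiableAt)
      (fun x hx => (hu.differentiableOn one_ne_zero).differentiableAt (hΩ.mem_nhds (hφs hx)))
    have hw := h φ hφ hφc hφs
    rw [setIntegral_eq_integral_of_forall_compl_eq_zero fun z hz => by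
        by_contra hne
        exact hz (hφs (hsupp' hne)),
      setIntegral_eq_integral_of_forall_compl_eq_zero fun z hz => by
        by_contra hne
        exact hz (hφs (hsupp g hne))] at hw
    simp only [smul_sub]
    rw [integral_sub hint1 hint2, hibp, hw]
    simp
  rw [ae_restrict_iff' hΩ.measurableSet]
  filter_upwards [hz] with z hz hzΩ
  exact sub_eq_zero.1 (hz hzΩ)

/-- A continuously differentiable quasiconformal map satisfies the dilatation inequality
everywhere. -/
lemma IsQuasiconformal.norm_wirtingerBar_le {K : ℝ} {Ω : Set ℂ} {u : ℂ → ℂ}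
    (h : IsQuasiconformal K unitDisk Ω u) (hu : ContDiffOn ℝ 1 u unitDisk) {z : ℂ}
    (hz : z ∈ unitDisk) : ‖wirtingerBar u z‖ ≤ (K - 1) / (K + 1) * ‖wirtinger u z‖ := by
  obtain ⟨fx, fy, μ, -, hfx, hfy, hwx, hwy, -, hμ, hb⟩ := h.sobolev_beltrami
  -- Taking the positive part turns the almost everywhere inequality into an almost everywhere
  -- equality of continuous functions, which holds everywhere on an open set.
  have hae : (fun z => max (‖wirtingerBar u z‖ - (K - 1) / (K + 1) * ‖wirtinger u z‖) 0)
      =ᵐ[volume.restrict unitDisk] fun _ => 0 := by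
    filter_upwards [hμ, hb, hwx.ae_eq_fderiv isOpen_unitDisk hu hfx,
      hwy.ae_eq_fderiv isOpen_unitDisk hu hfy] with z h1 h2 h3 h4
    rw [h3, h4] at h2
    have h5 : wirtingerBar u z = μ z * wirtinger u z := h2
    rw [h5, norm_mul, max_eq_right_iff]
    have := mul_le_mul_of_nonneg_right h1 (norm_nonneg (wirtinger u z))
    linarith
  have hc1 := (continuousOn_wirtinger hu).norm
  have hc2 := (continuousOn_wirtingerBar hu).norm
  have := Measure.eqOn_open_of_ae_eq hae isOpen_unitDisk
    ((hc2.sub (continuousOn_const.mul hc1)).sup continuousOn_const) continuousOn_const hz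
  simp only [sup_eq_right] at this
  linarith

/-- With `a = |∂u|` and `b = |∂̄u|`, the dilatation bound says `a + b ≤ K (a - b)`. Multiplying by
`a + b` gives `(a + b)² ≤ K (a² - b²)`, that is `K` times the Jacobian. -/
lemma IsQuasiconformal.norm_fderiv_sq_le {K : ℝ} (hK : 1 ≤ K) {Ω : Set ℂ} {u : ℂ → ℂ}
    (h : IsQuasiconformal K unitDisk Ω u) (hu : ContDiffOn ℝ 1 u unitDisk) {z : ℂ}
    (hz : z ∈ unitDisk) : ‖fderiv ℝ u z‖ ^ 2 ≤ K * |(fderiv ℝ u z).det| := by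
  have hb := h.norm_wirtingerBar_le hu hz
  have hn := norm_fderiv_le_wirtinger u z
  rw [det_fderiv_eq_wirtinger]
  set a := ‖wirtinger u z‖
  set b := ‖wirtingerBar u z‖
  have ha : 0 ≤ a := norm_nonneg _
  have hb0 : 0 ≤ b := norm_nonneg _
  rw [div_mul_eq_mul_div, le_div_iff₀ (by linarith)] at hb
  have h1 : ‖fderiv ℝ u z‖ ^ 2 ≤ (a + b) ^ 2 := by gcongr
  have h2 : K * (a ^ 2 - b ^ 2) ≤ K * |a ^ 2 - b ^ 2| := by
    gcongr
    exact le_abs_self _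
  nlinarith

/-- The Dirichlet integral of a quasiconformal map onto a bounded domain is finite. -/
lemma IsQuasiconformal.lintegral_norm_fderiv_sq_lt_top {K : ℝ} (hK : 1 ≤ K) {Ω : Set ℂ}
    {u : ℂ → ℂ} (h : IsQuasiconformal K unitDisk Ω u) (hu : ContDiffOn ℝ 1 u unitDisk)
    (hΩ : Bornology.IsBounded Ω) :
    ∫⁻ z in unitDisk, ENNReal.ofReal (‖fderiv ℝ u z‖ ^ 2) < ⊤ := by
  obtain ⟨e, he⟩ := h.homeo
  have hinj : InjOn u unitDisk := fun x hx y hy hxy => by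
    have h1 := he ⟨x, hx⟩
    have h2 := he ⟨y, hy⟩
    have : e ⟨x, hx⟩ = e ⟨y, hy⟩ := Subtype.ext (by rw [h1, h2, hxy])
    exact congrArg Subtype.val (e.injective this)
  have himage : u '' unitDisk ⊆ Ω := by
    rintro _ ⟨z, hz, rfl⟩
    rw [← he ⟨z, hz⟩]
    exact (e ⟨z, hz⟩).2
  have hder : ∀ z ∈ unitDisk, HasFDerivWithinAt u (fderiv ℝ u z) unitDisk z := fun z hz =>
    ((hu.differentiableOn one_ne_zero).differentiableAt
      (isOpen_unitDisk.mem_nhds hz)).hasFDerivAt.hasFDerivWithinAt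
  -- By injectivity the Jacobian integrates to the area of the image, which is bounded.
  have hcov := lintegral_abs_det_fderiv_eq_addHaar_image volume isOpen_unitDisk.measurableSet
    hder hinj
  calc ∫⁻ z in unitDisk, ENNReal.ofReal (‖fderiv ℝ u z‖ ^ 2)
      ≤ ∫⁻ z in unitDisk, ENNReal.ofReal K * ENNReal.ofReal |(fderiv ℝ u z).det| := by
        refine setLIntegral_mono' isOpen_unitDisk.measurableSet fun z hz => ?_
        rw [← ENNReal.ofReal_mul (by linarith)]
        exact ENNReal.ofReal_le_ofReal (h.norm_fderiv_sq_le hK hu hz)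
    _ = ENNReal.ofReal K * volume (u '' unitDisk) := by
        rw [lintegral_const_mul' _ _ ENNReal.ofReal_ne_top, hcov]
    _ < ⊤ := ENNReal.mul_lt_top ENNReal.ofReal_lt_top
        ((measure_mono himage).trans_lt hΩ.measure_lt_top)

lemma hasDerivAt_circleMap_left (r θ : ℝ) :
    HasDerivAt (fun r : ℝ => circleMap 0 r θ) (circleMap 0 1 θ) r := by
  simp only [circleMap_zero, Complex.ofReal_one, one_mul]
  simpa using (Complex.ofRealCLM.hasDerivAt (x := r)).mul_const (Complex.exp (θ * Complex.I))

lemma hasDerivAt_comp_circleMap_left {u : ℂ → ℂ} {r θ : ℝ}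
    (hu : DifferentiableAt ℝ u (circleMap 0 r θ)) :
    HasDerivAt (fun r : ℝ => u (circleMap 0 r θ)) (fderiv ℝ u (circleMap 0 r θ) (circleMap 0 1 θ))
      r :=
  hu.hasFDerivAt.comp_hasDerivAt r (hasDerivAt_circleMap_left r θ)

/-- The radial derivative is integrable up to `r = 1`, so `u` along the radius is a primitive with a
limit there. -/
lemma exists_hasRadialLimit_of_lintegral_lt_top {u : ℂ → ℂ} (hu : ContDiffOn ℝ 1 u unitDisk)
    {θ : ℝ} (h : ∫⁻ r in Ioo (0 : ℝ) 1, ENNReal.ofReal r *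
      ENNReal.ofReal (‖fderiv ℝ u (circleMap 0 r θ)‖ ^ 2) < ⊤) : ∃ w, HasRadialLimit u θ w := by
  have hmem : ∀ r ∈ Ioo (0 : ℝ) 1, circleMap 0 r θ ∈ unitDisk := fun r hr =>
    circleMap_mem_unitDisk hr.1.le hr.2 θ
  have hfd := hu.continuousOn_fderiv_of_isOpen isOpen_unitDisk le_rfl
  set f' : ℝ → ℂ := fun r => fderiv ℝ u (circleMap 0 r θ) (circleMap 0 1 θ) with hf'
  have hcont : ContinuousOn f' (Ioo 0 1) :=
    (hfd.comp (continuous_circleMap_left θ).continuousOn hmem).clm_apply continuousOn_const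
  have hint : IntegrableOn f' (Ioo (1 / 2) 1) := by
    have hsub : Ioo (1 / 2 : ℝ) 1 ⊆ Ioo 0 1 := Ioo_subset_Ioo_left (by norm_num)
    refine ⟨(hcont.mono hsub).aestronglyMeasurable measurableSet_Ioo, ?_⟩
    -- This uses `x ≤ 1 + x²` together with `2r > 1`. Staying away from the origin keeps the polar
    -- weight `r` bounded below.
    have hle : ∫⁻ r in Ioo (1 / 2 : ℝ) 1, ‖f' r‖ₑ ≤ ∫⁻ r in Ioo (1 / 2 : ℝ) 1,
        (1 + ENNReal.ofReal 2 * (ENNReal.ofReal r *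
          ENNReal.ofReal (‖fderiv ℝ u (circleMap 0 r θ)‖ ^ 2))) := by
      refine setLIntegral_mono' measurableSet_Ioo fun r hr => ?_
      have hr1 : 1 / 2 < r := hr.1
      rw [← ofReal_norm, ← ENNReal.ofReal_mul (by linarith),
        ← ENNReal.ofReal_mul (by norm_num), ← ENNReal.ofReal_one,
        ← ENNReal.ofReal_add (by norm_num) (by have := hr1; positivity)]
      refine ENNReal.ofReal_le_ofReal ?_
      have h1 : ‖f' r‖ ≤ ‖fderiv ℝ u (circleMap 0 r θ)‖ := by
        simpa using (fderiv ℝ u (circleMap 0 r θ)).le_opNorm (circleMap 0 1 θ)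
      nlinarith [sq_nonneg (‖fderiv ℝ u (circleMap 0 r θ)‖ - 1),
        sq_nonneg ‖fderiv ℝ u (circleMap 0 r θ)‖]
    refine hle.trans_lt ?_
    rw [lintegral_add_left measurable_const, lintegral_const_mul' _ _ ENNReal.ofReal_ne_top]
    refine ENNReal.add_lt_top.2 ⟨by simp, ENNReal.mul_lt_top ENNReal.ofReal_lt_top ?_⟩
    exact (lintegral_mono_set hsub).trans_lt h
  have hint' : IntegrableOn f' (uIcc (1 / 2) 1) := by
    rw [uIcc_of_le (by norm_num), integrableOn_Icc_iff_integrableOn_Ioo]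
    exact hint
  have hprim := intervalIntegral.continuousOn_primitive_interval hint'
  have hlim : Tendsto (fun x => ∫ t in (1 / 2 : ℝ)..x, f' t) (𝓝[<] 1)
      (𝓝 (∫ t in (1 / 2 : ℝ)..1, f' t)) := by
    have := hprim 1 right_mem_uIcc
    refine this.tendsto.mono_left ?_
    rw [← nhdsWithin_Ioo_eq_nhdsLT (show (1 / 2 : ℝ) < 1 by norm_num)]
    refine nhdsWithin_mono _ fun r hr => ?_
    rw [uIcc_of_le (by norm_num)]
    exact Ioo_subset_Icc_self hr
  refine ⟨u (circleMap 0 (1 / 2) θ) + ∫ t in (1 / 2 : ℝ)..1, f' t,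
    (tendsto_const_nhds.add hlim).congr' ?_⟩
  have hev : ∀ᶠ r : ℝ in 𝓝[<] 1, r ∈ Ioo (1 / 2 : ℝ) 1 := Ioo_mem_nhdsLT (by norm_num)
  filter_upwards [hev] with r hr
  have hsub : uIcc (1 / 2) r ⊆ Ioo (0 : ℝ) 1 := by
    rw [uIcc_of_le hr.1.le]
    exact fun t ht => ⟨by linarith [ht.1], by linarith [ht.2, hr.2]⟩
  rw [intervalIntegral.integral_eq_sub_of_hasDerivAt
    (f := fun r => u (circleMap 0 r θ)) (fun t ht => hasDerivAt_comp_circleMap_left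
      ((hu.differentiableOn one_ne_zero).differentiableAt
        (isOpen_unitDisk.mem_nhds (hmem t (hsub ht)))))
    (hcont.mono hsub).intervalIntegrable]
  ring

/-- Tonelli in polar coordinates makes the weighted radial energy finite for almost every angle in
`(-π, π)`. Periodicity carries this to all of `ℝ`. -/
lemma ae_exists_hasRadialLimit {u : ℂ → ℂ} (hu : ContDiffOn ℝ 1 u unitDisk)
    (h : ∫⁻ z in unitDisk, ENNReal.ofReal (‖fderiv ℝ u z‖ ^ 2) < ⊤) :
    ∀ᵐ θ : ℝ, ∃ w, HasRadialLimit u θ w := by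
  classical
  have hfd := hu.continuousOn_fderiv_of_isOpen isOpen_unitDisk le_rfl
  set F : ℂ → ℝ≥0∞ := unitDisk.indicator fun z => ENNReal.ofReal (‖fderiv ℝ u z‖ ^ 2) with hF
  have hFm : Measurable F := by
    have : Measurable (fun z => ENNReal.ofReal (‖fderiv ℝ u z‖ ^ 2)) :=
      ((measurable_fderiv ℝ u).norm.pow_const 2).ennreal_ofReal
    exact this.indicator isOpen_unitDisk.measurableSet
  have hFint : ∫⁻ z, F z < ⊤ := by
    rwa [hF, lintegral_indicator isOpen_unitDisk.measurableSet]
  have hsymm : ∀ p : ℝ × ℝ, Complex.polarCoord.symm p = circleMap 0 p.1 p.2 := fun p => by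
    rw [Complex.polarCoord_symm_apply, circleMap_zero, Complex.exp_mul_I]
    simp
  rw [← Complex.lintegral_comp_polarCoord_symm, polarCoord_target] at hFint
  simp only [hsymm] at hFint
  have hGm : Measurable fun p : ℝ × ℝ => ENNReal.ofReal p.1 • F (circleMap 0 p.1 p.2) := by
    have hc : Measurable fun p : ℝ × ℝ => circleMap 0 p.1 p.2 := by
      simp only [circleMap]
      fun_prop
    exact (measurable_fst.ennreal_ofReal).mul (hFm.comp hc)
  rw [Measure.volume_eq_prod, ← Measure.prod_restrict, lintegral_prod_symm _ hGm.aemeasurable]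
    at hFint
  have hae := ae_lt_top (hGm.lintegral_prod_left') hFint.ne
  have hae' : ∀ᵐ θ ∂(volume.restrict (Ioo (-Real.pi) Real.pi)), ∃ w, HasRadialLimit u θ w := by
    filter_upwards [hae] with θ hθ
    refine exists_hasRadialLimit_of_lintegral_lt_top hu (lt_of_le_of_lt ?_ hθ)
    calc _ = ∫⁻ r in Ioo (0 : ℝ) 1, ENNReal.ofReal r • F (circleMap 0 r θ) := by
          refine setLIntegral_congr_fun measurableSet_Ioo fun r hr => ?_
          simp only [hF, indicator_of_mem (circleMap_mem_unitDisk hr.1.le hr.2 θ), smul_eq_mul]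
      _ ≤ _ := lintegral_mono_set Ioo_subset_Ioi_self
  have hper : ∀ θ, ∀ n : ℤ, (∃ w, HasRadialLimit u (θ + n * (2 * Real.pi)) w) ↔
      ∃ w, HasRadialLimit u θ w := fun θ n => by
    have : ∀ r : ℝ, circleMap 0 r (θ + n * (2 * Real.pi)) = circleMap 0 r θ := fun r => by
      simpa using (periodic_circleMap 0 r).int_mul n θ
    simp only [HasRadialLimit, this]
  rw [ae_iff]
  -- The exceptional set is invariant under translation by `2π`, so it is null once it is null on a
  -- fundamental domain.
  refine (isAddFundamentalDomain_Ioc Real.two_pi_pos (-Real.pi)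
    volume).measure_zero_of_invariant _ ?_ ?_
  · rintro ⟨g, hg⟩
    obtain ⟨n, rfl⟩ := AddSubgroup.mem_zmultiples_iff.1 hg
    ext θ
    rw [mem_vadd_set_iff_neg_vadd_mem]
    have := hper θ (-n)
    simp only [mem_ofPred_eq]
    rw [← this]
    simp [AddSubgroup.vadd_def, add_comm]
  · rw [ae_restrict_iff' measurableSet_Ioo, ae_iff] at hae'
    have he : -Real.pi + 2 * Real.pi = Real.pi := by ring
    rw [he]
    refine measure_mono_null (t := {θ | ¬ (θ ∈ Ioo (-Real.pi) Real.pi → ∃ w, HasRadialLimit u θ w)} ∪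
      {Real.pi}) ?_ (measure_union_null hae' (by simp))
    rintro θ ⟨h1, h2⟩
    rcases h2.2.eq_or_lt with h3 | h3
    · exact Or.inr h3
    · exact Or.inl fun h4 => h1 (h4 ⟨h2.1, h3⟩)

end

/-! ### Regularized moduli, radial subsolutions and monotone circular means. -/

section

/-- The smooth approximation `√(‖v‖² + ε²)` of the modulus. -/
def regNorm (ε : ℝ) (v : ℂ) : ℝ := √(‖v‖ ^ 2 + ε ^ 2)

section regNorm

variable {ε : ℝ}

lemma regNorm_sq (ε : ℝ) (v : ℂ) : regNorm ε v ^ 2 = ‖v‖ ^ 2 + ε ^ 2 :=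
  Real.sq_sqrt (by positivity)

lemma regNorm_pos (hε : 0 < ε) (v : ℂ) : 0 < regNorm ε v := Real.sqrt_pos.2 (by positivity)

lemma le_regNorm (ε : ℝ) (v : ℂ) : ε ≤ regNorm ε v :=
  Real.le_sqrt_of_sq_le (by nlinarith [sq_nonneg ‖v‖])

lemma norm_le_regNorm (ε : ℝ) (v : ℂ) : ‖v‖ ≤ regNorm ε v :=
  Real.le_sqrt_of_sq_le (by nlinarith [sq_nonneg ε])

lemma regNorm_le (hε : 0 < ε) (v : ℂ) : regNorm ε v ≤ ‖v‖ + ε :=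
  Real.sqrt_le_iff.2 ⟨by positivity, by nlinarith [mul_nonneg hε.le (norm_nonneg v)]⟩

lemma continuous_regNorm (ε : ℝ) : Continuous (regNorm ε) := by
  unfold regNorm
  fun_prop

lemma hasDerivAt_regNorm (hε : 0 < ε) {f : ℝ → ℂ} {f' : ℂ} {x : ℝ} (hf : HasDerivAt f f' x) :
    HasDerivAt (fun x => regNorm ε (f x)) (inner ℝ (f x) f' / regNorm ε (f x)) x := by
  have h := (hf.norm_sq.add_const (ε ^ 2)).sqrt (by positivity)
  refine h.congr_deriv ?_
  rw [regNorm]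
  field_simp

lemma hasDerivAt_regNorm_deriv (hε : 0 < ε) {f f' : ℝ → ℂ} {f'' : ℂ} {x : ℝ}
    (hf : HasDerivAt f (f' x) x) (hf' : HasDerivAt f' f'' x) :
    HasDerivAt (fun x => inner ℝ (f x) (f' x) / regNorm ε (f x))
      ((‖f' x‖ ^ 2 + inner ℝ (f x) f'') / regNorm ε (f x)
        - inner ℝ (f x) (f' x) ^ 2 / regNorm ε (f x) ^ 3) x := by
  have hpos := regNorm_pos hε (f x)
  have h := (hf.inner ℝ hf').div (hasDerivAt_regNorm hε hf) hpos.ne'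
  refine h.congr_deriv ?_
  rw [real_inner_self_eq_norm_sq]
  field_simp
  ring

/-- Kato's inequality: the discarded part `‖v'‖²/g - ⟨v,v'⟩²/g³` of the second derivative of the
regularized modulus `g` is nonnegative by Cauchy–Schwarz. -/
lemma inner_div_regNorm_le_deriv (hε : 0 < ε) (v v' v'' : ℂ) :
    inner ℝ v v'' / regNorm ε v ≤ (‖v'‖ ^ 2 + inner ℝ v v'') / regNorm ε v
        - inner ℝ v v' ^ 2 / regNorm ε v ^ 3 := by
  have hpos := regNorm_pos hε v
  have h1 : (inner ℝ v v' : ℝ) ^ 2 ≤ ‖v'‖ ^ 2 * regNorm ε v ^ 2 := by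
    rw [regNorm_sq]
    have h2 : (inner ℝ v v' : ℝ) ^ 2 ≤ (‖v‖ * ‖v'‖) ^ 2 := by
      rw [← sq_abs (inner ℝ v v' : ℝ)]
      gcongr
      exact abs_real_inner_le_norm v v'
    nlinarith [mul_nonneg (sq_nonneg ‖v'‖) (sq_nonneg ε)]
  have h3 : (inner ℝ v v' : ℝ) ^ 2 / regNorm ε v ^ 3 ≤ ‖v'‖ ^ 2 / regNorm ε v := by
    rw [div_le_div_iff₀ (by positivity) hpos]
    nlinarith [mul_le_mul_of_nonneg_right h1 hpos.le]
  rw [add_div]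
  linarith

end regNorm

/-- A solution of the equation `T_α V = 0` in polar coordinates on the punctured disk, together
with its partial derivatives, that is bounded near the origin with its radial derivative. -/
structure IsPolarSolution (α : ℝ) (V Vr Vrr Vs Vss : ℝ → ℝ → ℂ) : Prop where
  hasDerivAt_r : ∀ r ∈ Ioo (0 : ℝ) 1, ∀ s, HasDerivAt (fun r => V r s) (Vr r s) r
  hasDerivAt_rr : ∀ r ∈ Ioo (0 : ℝ) 1, ∀ s, HasDerivAt (fun r => Vr r s) (Vrr r s) r
  hasDerivAt_s : ∀ r ∈ Ioo (0 : ℝ) 1, ∀ s, HasDerivAt (V r) (Vs r s) s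
  hasDerivAt_ss : ∀ r ∈ Ioo (0 : ℝ) 1, ∀ s, HasDerivAt (Vs r) (Vss r s) s
  continuousOn : ContinuousOn (fun q : ℝ × ℝ => V q.1 q.2) (Ioo 0 1 ×ˢ univ)
  continuousOn_r : ContinuousOn (fun q : ℝ × ℝ => Vr q.1 q.2) (Ioo 0 1 ×ˢ univ)
  continuousOn_rr : ContinuousOn (fun q : ℝ × ℝ => Vrr q.1 q.2) (Ioo 0 1 ×ˢ univ)
  continuous_ss : ∀ r ∈ Ioo (0 : ℝ) 1, Continuous (Vss r)
  periodic : ∀ r ∈ Ioo (0 : ℝ) 1, ∀ s, V r (s + 2 * Real.pi) = V r s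
  periodic_s : ∀ r ∈ Ioo (0 : ℝ) 1, ∀ s, Vs r (s + 2 * Real.pi) = Vs r s
  bounded : ∃ C, ∀ r ∈ Ioo (0 : ℝ) (1 / 2), ∀ s, ‖V r s‖ ≤ C ∧ ‖Vr r s‖ ≤ C
  eq_zero : ∀ r ∈ Ioo (0 : ℝ) 1, ∀ s,
    ((1 - r ^ 2 : ℝ) : ℂ) * (Vrr r s + Vr r s / r + Vss r s / r ^ 2) + 2 * α * r * Vr r s
      - α ^ 2 * V r s = 0

lemma hasDerivAt_integral_of_continuousOn_Ioo {f f' : ℝ → ℝ → ℝ} {a b c d : ℝ}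
    (hf : ∀ r ∈ Ioo a b, ∀ s, HasDerivAt (fun r => f r s) (f' r s) r)
    (hc : ContinuousOn (fun q : ℝ × ℝ => f q.1 q.2) (Ioo a b ×ˢ univ))
    (hc' : ContinuousOn (fun q : ℝ × ℝ => f' q.1 q.2) (Ioo a b ×ˢ univ)) {r : ℝ}
    (hr : r ∈ Ioo a b) :
    HasDerivAt (fun r => ∫ s in c..d, f r s) (∫ s in c..d, f' r s) r := by
  obtain ⟨a', ha'⟩ := exists_between hr.1
  obtain ⟨b', hb'⟩ := exists_between hr.2
  have hsub : Icc a' b' ×ˢ uIcc c d ⊆ Ioo a b ×ˢ univ := fun q hq =>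
    ⟨⟨ha'.1.trans_le hq.1.1, hq.1.2.trans_lt hb'.2⟩, mem_univ _⟩
  have hslice : ∀ g : ℝ → ℝ → ℝ, ContinuousOn (fun q : ℝ × ℝ => g q.1 q.2) (Ioo a b ×ˢ univ) →
      ∀ x ∈ Ioo a b, Continuous (g x) := fun g hg x hx => by
    rw [← continuousOn_univ]
    exact hg.comp (f := fun s => (x, s)) (by fun_prop) fun s _ => ⟨hx, mem_univ _⟩
  obtain ⟨C, hC⟩ := (isCompact_Icc.prod isCompact_uIcc).exists_bound_of_continuousOn (hc'.mono hsub)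
  have hnhds : Icc a' b' ∈ 𝓝 r := Icc_mem_nhds ha'.2 hb'.1
  refine (intervalIntegral.hasDerivAt_integral_of_dominated_loc_of_deriv_le (bound := fun _ => C)
    hnhds ?_ ((hslice f hc r hr).intervalIntegrable _ _)
    (hslice f' hc' r hr).aestronglyMeasurable ?_ (by simp) ?_).2
  · filter_upwards [isOpen_Ioo.mem_nhds hr] with x hx
    exact (hslice f hc x hx).aestronglyMeasurable
  · exact Eventually.of_forall fun t ht x hx => hC (x, t) ⟨hx, uIoc_subset_uIcc ht⟩
  · exact Eventually.of_forall fun t _ x hx =>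
      hf x ⟨ha'.1.trans_le hx.1, hx.2.trans_lt hb'.2⟩ t

/-- Comparison of a radial subsolution with a positive radial solution. -/
lemma monotoneOn_div_of_radial_subsolution {α : ℝ} {M M' M'' F F' F'' : ℝ → ℝ}
    (hM : ∀ r ∈ Ioo (0 : ℝ) 1, HasDerivAt M (M' r) r)
    (hM' : ∀ r ∈ Ioo (0 : ℝ) 1, HasDerivAt M' (M'' r) r)
    (hF : ∀ r ∈ Ioo (0 : ℝ) 1, HasDerivAt F (F' r) r)
    (hF' : ∀ r ∈ Ioo (0 : ℝ) 1, HasDerivAt F' (F'' r) r)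
    (hpos : ∀ r ∈ Ioo (0 : ℝ) 1, 0 < F r)
    (hMb : ∃ C, ∀ r ∈ Ioo (0 : ℝ) (1 / 2), |M r| ≤ C ∧ |M' r| ≤ C)
    (hFb : ∃ C, ∀ r ∈ Ioo (0 : ℝ) (1 / 2), |F r| ≤ C ∧ |F' r| ≤ C)
    (hMeq : ∀ r ∈ Ioo (0 : ℝ) 1,
      0 ≤ (1 - r ^ 2) * (M'' r + M' r / r) + 2 * α * r * M' r - α ^ 2 * M r)
    (hFeq : ∀ r ∈ Ioo (0 : ℝ) 1,
      (1 - r ^ 2) * (F'' r + F' r / r) + 2 * α * r * F' r - α ^ 2 * F r = 0) :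
    MonotoneOn (fun r => M r / F r) (Ioo 0 1) := by
  have hr1 : ∀ r ∈ Ioo (0 : ℝ) 1, 0 < 1 - r ^ 2 := fun r hr => by nlinarith [hr.1, hr.2]
  -- `p` is the integrating factor that puts the radial operator into self-adjoint form.
  set p : ℝ → ℝ := fun r => r * (1 - r ^ 2) ^ (-α) with hp
  have hp' : ∀ r ∈ Ioo (0 : ℝ) 1, HasDerivAt p
      ((1 - r ^ 2) ^ (-α) * (1 + 2 * α * r ^ 2 / (1 - r ^ 2))) r := by
    intro r hr
    have h1 : HasDerivAt (fun r : ℝ => 1 - r ^ 2) (-(2 * r)) r := by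
      simpa using (hasDerivAt_pow 2 r).const_sub 1
    refine ((hasDerivAt_id r).mul (h1.rpow_const (p := -α) (Or.inl (hr1 r hr).ne'))).congr_deriv ?_
    rw [Real.rpow_sub_one (hr1 r hr).ne']
    have := (hr1 r hr).ne'
    simp only [id]
    field_simp
  -- `W` is the weighted Wronskian. Up to a positive factor, `W'` is `F` times the operator applied
  -- to `M`, minus `M` times the operator applied to `F`, hence nonnegative. As `W` tends to `0` at
  -- the origin, it is nonnegative, and it has the sign of `(M/F)'`.
  set W : ℝ → ℝ := fun r => p r * (M' r * F r - M r * F' r) with hW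
  have hWd : ∀ r ∈ Ioo (0 : ℝ) 1, HasDerivAt W
      (((1 - r ^ 2) ^ (-α) * (1 + 2 * α * r ^ 2 / (1 - r ^ 2))) * (M' r * F r - M r * F' r)
        + p r * (M'' r * F r + M' r * F' r - (M' r * F' r + M r * F'' r))) r := fun r hr =>
    (hp' r hr).mul (((hM' r hr).mul (hF r hr)).sub ((hM r hr).mul (hF' r hr)))
  have hWmono : MonotoneOn W (Ioo 0 1) := by
    refine monotoneOn_of_deriv_nonneg (convex_Ioo 0 1)
      (fun r hr => (hWd r hr).continuousAt.continuousWithinAt)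
      (fun r hr => (hWd r (interior_subset hr)).differentiableAt.differentiableWithinAt)
      fun r hr => ?_
    have hr := interior_subset hr
    have h0 := hr1 r hr
    have hr0 : 0 < r := hr.1
    rw [(hWd r hr).deriv]
    have e : ((1 - r ^ 2) ^ (-α) * (1 + 2 * α * r ^ 2 / (1 - r ^ 2))) * (M' r * F r - M r * F' r)
        + p r * (M'' r * F r + M' r * F' r - (M' r * F' r + M r * F'' r))
        = r * (1 - r ^ 2) ^ (-α) / (1 - r ^ 2) *
          (F r * ((1 - r ^ 2) * (M'' r + M' r / r) + 2 * α * r * M' r - α ^ 2 * M r)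
          - M r * ((1 - r ^ 2) * (F'' r + F' r / r) + 2 * α * r * F' r - α ^ 2 * F r)) := by
      simp only [hp]
      field_simp
      ring
    rw [e, hFeq r hr, mul_zero, sub_zero]
    have := hpos r hr
    have := hMeq r hr
    positivity
  -- `p` vanishes at the origin while the functions and their derivatives stay bounded there.
  have hW0 : Tendsto W (𝓝[>] 0) (𝓝 0) := by
    obtain ⟨C, hC⟩ := hMb
    obtain ⟨D, hD⟩ := hFb
    have hp0 : Tendsto p (𝓝[>] 0) (𝓝 0) := by
      have : ContinuousAt p 0 := by
        refine continuousAt_id.mul (ContinuousAt.rpow_const (by fun_prop) (Or.inl (by norm_num)))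
      have h := this.tendsto.mono_left (nhdsWithin_le_nhds (s := Ioi 0))
      simpa [hp] using h
    refine hp0.zero_mul_isBoundedUnder_le ?_
    refine isBoundedUnder_of_eventually_le (a := C * D + C * D) ?_
    filter_upwards [Ioo_mem_nhdsGT (show (0 : ℝ) < 1 / 2 by norm_num)] with r hr
    have h1 := hC r hr
    have h2 := hD r hr
    simp only [Function.comp_apply, Real.norm_eq_abs]
    refine (abs_sub _ _).trans ?_
    rw [abs_mul, abs_mul]
    have hC0 : 0 ≤ C := (abs_nonneg _).trans h1.1
    exact add_le_add (mul_le_mul h1.2 h2.1 (abs_nonneg _) hC0)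
      (mul_le_mul h1.1 h2.2 (abs_nonneg _) hC0)
  have hWnn : ∀ r ∈ Ioo (0 : ℝ) 1, 0 ≤ W r := by
    intro r hr
    refine le_of_tendsto hW0 ?_
    filter_upwards [Ioo_mem_nhdsGT hr.1] with x hx
    exact hWmono ⟨hx.1, hx.2.trans hr.2⟩ hr hx.2.le
  have hd : ∀ r ∈ Ioo (0 : ℝ) 1, HasDerivAt (fun r => M r / F r)
      ((M' r * F r - M r * F' r) / F r ^ 2) r := fun r hr =>
    (hM r hr).div (hF r hr) (hpos r hr).ne'
  refine monotoneOn_of_deriv_nonneg (convex_Ioo 0 1)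
    (fun r hr => (hd r hr).continuousAt.continuousWithinAt)
    (fun r hr => (hd r (interior_subset hr)).differentiableAt.differentiableWithinAt)
    fun r hr => ?_
  have hr := interior_subset hr
  rw [(hd r hr).deriv]
  have hppos : 0 < p r := mul_pos hr.1 (Real.rpow_pos_of_pos (hr1 r hr) _)
  exact div_nonneg (nonneg_of_mul_nonneg_right (hWnn r hr) hppos) (sq_nonneg _)

section IsPolarSolution

variable {α : ℝ} {V Vr Vrr Vs Vss : ℝ → ℝ → ℂ}

lemma IsPolarSolution.continuous (h : IsPolarSolution α V Vr Vrr Vs Vss) {r : ℝ}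
    (hr : r ∈ Ioo (0 : ℝ) 1) : Continuous (V r) :=
  continuous_iff_continuousAt.2 fun s => (h.hasDerivAt_s r hr s).continuousAt

/-- Subtracting `ε` is essential because of the zeroth-order term `-α²`: for the regularized modulus
`g`, the function `g - ε` is a subsolution, whereas Kato's inequality for `g` alone leaves the
negative error `-α² ε² / g`. Integration over the angle then yields a radial subsolution. -/
lemma IsPolarSolution.monotoneOn_integral_regNorm_div
    (h : IsPolarSolution α V Vr Vrr Vs Vss) {ε : ℝ} (hε : 0 < ε) {F F' F'' : ℝ → ℝ}
    (hF : ∀ r ∈ Ioo (0 : ℝ) 1, HasDerivAt F (F' r) r)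
    (hF' : ∀ r ∈ Ioo (0 : ℝ) 1, HasDerivAt F' (F'' r) r)
    (hpos : ∀ r ∈ Ioo (0 : ℝ) 1, 0 < F r)
    (hFb : ∃ C, ∀ r ∈ Ioo (0 : ℝ) (1 / 2), |F r| ≤ C ∧ |F' r| ≤ C)
    (hFeq : ∀ r ∈ Ioo (0 : ℝ) 1,
      (1 - r ^ 2) * (F'' r + F' r / r) + 2 * α * r * F' r - α ^ 2 * F r = 0) :
    MonotoneOn (fun r => (∫ s in 0..2 * Real.pi, (regNorm ε (V r s) - ε)) / F r) (Ioo 0 1) := by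
  set g : ℝ → ℝ → ℝ := fun r s => regNorm ε (V r s) with hg
  have hgpos : ∀ r s, 0 < g r s := fun r s => regNorm_pos hε _
  set gr : ℝ → ℝ → ℝ := fun r s => inner ℝ (V r s) (Vr r s) / g r s with hgr
  set grr : ℝ → ℝ → ℝ := fun r s => (‖Vr r s‖ ^ 2 + inner ℝ (V r s) (Vrr r s)) / g r s
    - inner ℝ (V r s) (Vr r s) ^ 2 / g r s ^ 3 with hgrr
  set gs : ℝ → ℝ → ℝ := fun r s => inner ℝ (V r s) (Vs r s) / g r s with hgs
  set gss : ℝ → ℝ → ℝ := fun r s => (‖Vs r s‖ ^ 2 + inner ℝ (V r s) (Vss r s)) / g r s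
    - inner ℝ (V r s) (Vs r s) ^ 2 / g r s ^ 3 with hgss
  have hcg : ContinuousOn (fun q : ℝ × ℝ => g q.1 q.2) (Ioo 0 1 ×ˢ univ) :=
    (continuous_regNorm ε).comp_continuousOn h.continuousOn
  have hcgr : ContinuousOn (fun q : ℝ × ℝ => gr q.1 q.2) (Ioo 0 1 ×ˢ univ) :=
    (h.continuousOn.inner h.continuousOn_r).div hcg fun q _ => (hgpos _ _).ne'
  have hcgrr : ContinuousOn (fun q : ℝ × ℝ => grr q.1 q.2) (Ioo 0 1 ×ˢ univ) := by
    refine ContinuousOn.sub (ContinuousOn.div ?_ hcg fun q _ => (hgpos _ _).ne')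
      (ContinuousOn.div ((h.continuousOn.inner h.continuousOn_r).pow 2) (hcg.pow 3)
        fun q _ => (pow_pos (hgpos _ _) 3).ne')
    exact (h.continuousOn_r.norm.pow 2).add (h.continuousOn.inner h.continuousOn_rr)
  have hslice : ∀ k : ℝ → ℝ → ℝ, ContinuousOn (fun q : ℝ × ℝ => k q.1 q.2) (Ioo 0 1 ×ˢ univ) →
      ∀ x ∈ Ioo (0 : ℝ) 1, Continuous (k x) := fun k hk x hx => by
    rw [← continuousOn_univ]
    exact hk.comp (f := fun s => (x, s)) (by fun_prop) fun s _ => ⟨hx, mem_univ _⟩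
  have hdr : ∀ r ∈ Ioo (0 : ℝ) 1, ∀ s, HasDerivAt (fun r => g r s - ε) (gr r s) r := fun r hr s =>
    (hasDerivAt_regNorm hε (h.hasDerivAt_r r hr s)).sub_const ε
  have hdrr : ∀ r ∈ Ioo (0 : ℝ) 1, ∀ s, HasDerivAt (fun r => gr r s) (grr r s) r := fun r hr s =>
    hasDerivAt_regNorm_deriv hε (f' := fun r => Vr r s) (h.hasDerivAt_r r hr s)
      (h.hasDerivAt_rr r hr s)
  have hdss : ∀ r ∈ Ioo (0 : ℝ) 1, ∀ s, HasDerivAt (gs r) (gss r s) s := fun r hr s =>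
    hasDerivAt_regNorm_deriv hε (f' := Vs r) (h.hasDerivAt_s r hr s) (h.hasDerivAt_ss r hr s)
  have hcgss : ∀ r ∈ Ioo (0 : ℝ) 1, Continuous (gss r) := fun r hr => by
    have h1 := h.continuous hr
    have h2 : Continuous (Vs r) :=
      continuous_iff_continuousAt.2 fun s => (h.hasDerivAt_ss r hr s).continuousAt
    have h3 := h.continuous_ss r hr
    have h4 := hslice g hcg r hr
    refine Continuous.sub (Continuous.div ?_ h4 fun s => (hgpos _ _).ne')
      (Continuous.div ((h1.inner h2).pow 2) (h4.pow 3) fun s => (pow_pos (hgpos _ _) 3).ne')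
    exact (h2.norm.pow 2).add (h1.inner h3)
  -- The angular second derivative drops out of the mean by periodicity.
  have hss0 : ∀ r ∈ Ioo (0 : ℝ) 1, ∫ s in 0..2 * Real.pi, gss r s = 0 := fun r hr => by
    rw [intervalIntegral.integral_eq_sub_of_hasDerivAt (fun s _ => hdss r hr s)
      ((hcgss r hr).intervalIntegrable _ _)]
    have h1 := h.periodic r hr 0
    have h2 := h.periodic_s r hr 0
    rw [zero_add] at h1 h2
    simp only [hgs, hg, h1, h2, sub_self]
  have hpoint : ∀ r ∈ Ioo (0 : ℝ) 1, ∀ s, 0 ≤ (1 - r ^ 2) * (grr r s + gr r s / r + gss r s / r ^ 2)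
      + 2 * α * r * gr r s - α ^ 2 * (g r s - ε) := by
    intro r hr s
    have hr0 : 0 < r := hr.1
    have hr1 : 0 < 1 - r ^ 2 := by nlinarith [hr.1, hr.2]
    have e1 := inner_div_regNorm_le_deriv hε (V r s) (Vr r s) (Vrr r s)
    have e2 := inner_div_regNorm_le_deriv hε (V r s) (Vs r s) (Vss r s)
    have e3 : inner ℝ (V r s) (Vrr r s) / g r s ≤ grr r s := e1
    have e4 : inner ℝ (V r s) (Vss r s) / g r s ≤ gss r s := e2
    have hin := congrArg (fun z => (inner ℝ (V r s) z : ℝ)) (h.eq_zero r hr s)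
    have hcast : ((1 - r ^ 2 : ℝ) : ℂ) * (Vrr r s + Vr r s / r + Vss r s / r ^ 2)
        + 2 * α * r * Vr r s - α ^ 2 * V r s =
        (1 - r ^ 2) • (Vrr r s + r⁻¹ • Vr r s + (r ^ 2)⁻¹ • Vss r s) + (2 * α * r) • Vr r s
          - (α ^ 2) • V r s := by
      simp only [Complex.real_smul]
      push_cast
      ring
    rw [hcast] at hin
    simp only [inner_sub_right, inner_add_right, inner_smul_right, inner_zero_right,
      real_inner_self_eq_norm_sq] at hin
    have hgp := hgpos r s
    have hsq : g r s ^ 2 = ‖V r s‖ ^ 2 + ε ^ 2 := regNorm_sq ε _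
    have hge : ε ≤ g r s := le_regNorm ε _
    -- The inner product of the equation with `V`, divided by `g`, gives `α² ‖V‖² / g`. With `‖V‖² =
    -- g² - ε²`, what remains after subtracting `α² (g - ε)` is the nonnegative right-hand side.
    have hmain : (1 - r ^ 2) * (inner ℝ (V r s) (Vrr r s) / g r s + gr r s / r
        + inner ℝ (V r s) (Vss r s) / g r s / r ^ 2) + 2 * α * r * gr r s - α ^ 2 * (g r s - ε)
        = α ^ 2 * ε * (g r s - ε) / g r s := by
      have : (1 - r ^ 2) * (inner ℝ (V r s) (Vrr r s) / g r s + gr r s / r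
        + inner ℝ (V r s) (Vss r s) / g r s / r ^ 2) + 2 * α * r * gr r s
        = α ^ 2 * ‖V r s‖ ^ 2 / g r s := by
        rw [eq_div_iff hgp.ne', hgr]
        field_simp
        field_simp at hin
        linear_combination hin
      rw [this, eq_div_iff hgp.ne', sub_mul, div_mul_cancel₀ _ hgp.ne']
      linear_combination (-α ^ 2) * hsq
    have hnn : 0 ≤ α ^ 2 * ε * (g r s - ε) / g r s := by
      have : 0 ≤ g r s - ε := by linarith
      positivity
    refine hnn.trans (hmain.symm.le.trans ?_)
    gcongr
  refine monotoneOn_div_of_radial_subsolution (α := α)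
    (M' := fun r => ∫ s in 0..2 * Real.pi, gr r s) (M'' := fun r => ∫ s in 0..2 * Real.pi, grr r s)
    (fun r hr => hasDerivAt_integral_of_continuousOn_Ioo hdr (hcg.sub continuousOn_const) hcgr hr)
    (fun r hr => hasDerivAt_integral_of_continuousOn_Ioo hdrr hcgr hcgrr hr)
    hF hF' hpos ?_ hFb ?_ hFeq
  · obtain ⟨C, hC⟩ := h.bounded
    refine ⟨C * |2 * Real.pi - 0|, fun r hr => ⟨?_, ?_⟩⟩
    · rw [← Real.norm_eq_abs]
      refine intervalIntegral.norm_integral_le_of_norm_le_const fun s _ => ?_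
      have h1 := regNorm_le hε (V r s)
      have h2 := le_regNorm ε (V r s)
      rw [Real.norm_eq_abs, abs_of_nonneg (by linarith)]
      linarith [(hC r hr s).1]
    · rw [← Real.norm_eq_abs]
      refine intervalIntegral.norm_integral_le_of_norm_le_const fun s _ => ?_
      rw [hgr, norm_div, Real.norm_eq_abs, Real.norm_eq_abs, abs_of_pos (hgpos r s),
        div_le_iff₀ (hgpos r s)]
      refine (abs_real_inner_le_norm _ _).trans ?_
      rw [mul_comm]
      exact mul_le_mul (hC r hr s).2 (norm_le_regNorm ε _) (norm_nonneg _)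
        ((norm_nonneg _).trans (hC r hr s).2)
  · intro r hr
    have i1 : ∀ k : ℝ → ℝ → ℝ, ContinuousOn (fun q : ℝ × ℝ => k q.1 q.2) (Ioo 0 1 ×ˢ univ) →
      IntervalIntegrable (k r) volume 0 (2 * Real.pi) := fun k hk =>
        (hslice k hk r hr).intervalIntegrable _ _
    have igss : IntervalIntegrable (gss r) volume 0 (2 * Real.pi) :=
      (hcgss r hr).intervalIntegrable _ _
    have hnn : 0 ≤ ∫ s in 0..2 * Real.pi, ((1 - r ^ 2) * (grr r s + gr r s / r + gss r s / r ^ 2)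
      + 2 * α * r * gr r s - α ^ 2 * (g r s - ε)) :=
      intervalIntegral.integral_nonneg Real.two_pi_pos.le fun s _ => hpoint r hr s
    have ig := (i1 g hcg).sub (intervalIntegrable_const (c := ε))
    rw [intervalIntegral.integral_sub
        ((((((i1 grr hcgrr).add ((i1 gr hcgr).div_const r)).add
          (igss.div_const (r ^ 2)))).const_mul _).add ((i1 gr hcgr).const_mul _))
        (ig.const_mul _),
      intervalIntegral.integral_add
        (((((i1 grr hcgrr).add ((i1 gr hcgr).div_const r)).add
          (igss.div_const (r ^ 2)))).const_mul _) ((i1 gr hcgr).const_mul _),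
      intervalIntegral.integral_const_mul, intervalIntegral.integral_const_mul,
      intervalIntegral.integral_const_mul,
      intervalIntegral.integral_add ((i1 grr hcgrr).add ((i1 gr hcgr).div_const r))
        (igss.div_const (r ^ 2)),
      intervalIntegral.integral_add (i1 grr hcgrr) ((i1 gr hcgr).div_const r),
      intervalIntegral.integral_div, intervalIntegral.integral_div, hss0 r hr, zero_div,
      add_zero] at hnn
    exact hnn

/-- The mean modulus of a solution on circles, relative to the positive radial solution, is
nondecreasing. -/
lemma IsPolarSolution.monotoneOn_integral_norm_div
    (h : IsPolarSolution α V Vr Vrr Vs Vss) {F F' F'' : ℝ → ℝ}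
    (hF : ∀ r ∈ Ioo (0 : ℝ) 1, HasDerivAt F (F' r) r)
    (hF' : ∀ r ∈ Ioo (0 : ℝ) 1, HasDerivAt F' (F'' r) r)
    (hpos : ∀ r ∈ Ioo (0 : ℝ) 1, 0 < F r)
    (hFb : ∃ C, ∀ r ∈ Ioo (0 : ℝ) (1 / 2), |F r| ≤ C ∧ |F' r| ≤ C)
    (hFeq : ∀ r ∈ Ioo (0 : ℝ) 1,
      (1 - r ^ 2) * (F'' r + F' r / r) + 2 * α * r * F' r - α ^ 2 * F r = 0) :
    MonotoneOn (fun r => (∫ s in 0..2 * Real.pi, ‖V r s‖) / F r) (Ioo 0 1) := by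
  intro r hr ρ hρ hle
  have hpi := Real.two_pi_pos
  -- From `‖V‖ - ε ≤ g - ε ≤ ‖V‖`, passing to the modulus costs only a term of order `ε` at the
  -- inner radius and nothing at the outer one.
  have key : ∀ ε > 0, (∫ s in 0..2 * Real.pi, ‖V r s‖) / F r
      ≤ (∫ s in 0..2 * Real.pi, ‖V ρ s‖) / F ρ + ε * (2 * Real.pi / F r) := by
    intro ε hε
    have hm := h.monotoneOn_integral_regNorm_div hε hF hF' hpos hFb hFeq hr hρ hle
    have hci : ∀ x ∈ Ioo (0 : ℝ) 1, IntervalIntegrable (fun s => ‖V x s‖) volume 0 (2 * Real.pi) :=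
      fun x hx => (h.continuous hx).norm.intervalIntegrable _ _
    have hcr : ∀ x ∈ Ioo (0 : ℝ) 1,
        IntervalIntegrable (fun s => regNorm ε (V x s) - ε) volume 0 (2 * Real.pi) := fun x hx =>
      (((continuous_regNorm ε).comp (h.continuous hx)).sub continuous_const).intervalIntegrable _ _
    have h1 : (∫ s in 0..2 * Real.pi, ‖V r s‖) - 2 * Real.pi * ε
        ≤ ∫ s in 0..2 * Real.pi, (regNorm ε (V r s) - ε) := by
      have : (∫ s in 0..2 * Real.pi, ‖V r s‖) - 2 * Real.pi * ε
          = ∫ s in 0..2 * Real.pi, (‖V r s‖ - ε) := by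
        rw [intervalIntegral.integral_sub (hci r hr) intervalIntegrable_const]
        simp
      rw [this]
      exact intervalIntegral.integral_mono_on hpi.le ((hci r hr).sub intervalIntegrable_const)
        (hcr r hr) fun s _ => by linarith [norm_le_regNorm ε (V r s)]
    have h2 : ∫ s in 0..2 * Real.pi, (regNorm ε (V ρ s) - ε) ≤ ∫ s in 0..2 * Real.pi, ‖V ρ s‖ :=
      intervalIntegral.integral_mono_on hpi.le (hcr ρ hρ) (hci ρ hρ) fun s _ => by
        linarith [regNorm_le hε (V ρ s)]
    have h3 := div_le_div_of_nonneg_right h1 (hpos r hr).le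
    have h4 := div_le_div_of_nonneg_right h2 (hpos ρ hρ).le
    rw [sub_div] at h3
    have h5 : 2 * Real.pi * ε / F r = ε * (2 * Real.pi / F r) := by ring
    simp only at hm
    linarith
  have hlim : Tendsto (fun ε : ℝ => (∫ s in 0..2 * Real.pi, ‖V ρ s‖) / F ρ
      + ε * (2 * Real.pi / F r)) (𝓝[>] 0) (𝓝 ((∫ s in 0..2 * Real.pi, ‖V ρ s‖) / F ρ)) := by
    have : Continuous (fun ε : ℝ => (∫ s in 0..2 * Real.pi, ‖V ρ s‖) / F ρ
      + ε * (2 * Real.pi / F r)) := by fun_prop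
    have h := (this.tendsto 0).mono_left (nhdsWithin_le_nhds (s := Ioi 0))
    simpa using h
  exact ge_of_tendsto hlim (eventually_nhdsWithin_of_forall fun ε hε => key ε hε)

end IsPolarSolution

end

/-! ### The equation in polar coordinates and its rotation invariance. -/

section

/-- The sum of the second derivatives in two orthonormal directions does not depend on them. -/
lemma bilin_apply_add_apply_mul_I (B : ℂ →L[ℝ] ℂ →L[ℝ] ℂ) (e : ℂ) :
    B e e + B (e * Complex.I) (e * Complex.I)
      = (‖e‖ ^ 2 : ℝ) • (B 1 1 + B Complex.I Complex.I) := by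
  have key : ∀ a b : ℝ, B (a • (1 : ℂ) + b • Complex.I) (a • (1 : ℂ) + b • Complex.I)
      + B ((-b) • (1 : ℂ) + a • Complex.I) ((-b) • (1 : ℂ) + a • Complex.I)
      = (a ^ 2 + b ^ 2 : ℝ) • (B 1 1 + B Complex.I Complex.I) := by
    intro a b
    simp only [map_add, map_smul, add_apply, smul_apply, smul_add]
    module
  have h1 : e = e.re • (1 : ℂ) + e.im • Complex.I := by simp
  have h2 : e * Complex.I = (-e.im) • (1 : ℂ) + e.re • Complex.I := by
    apply Complex.ext <;> simp
  have h3 : ‖e‖ ^ 2 = e.re ^ 2 + e.im ^ 2 := by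
    rw [← Complex.normSq_eq_norm_sq, Complex.normSq_apply]
    ring
  rw [h2, h3, ← key, ← h1]

/-- This is the equation multiplied by `4 (1 - |z|²)^(α+1)`, after the first-order term `z ∂u + z̄
∂̄u` is recognised as the derivative of `u` in the direction `z`. -/
lemma IsAlphaHarmonic.mul_laplacian_add {α : ℝ} {u : ℂ → ℂ} (h : IsAlphaHarmonic α u) {z : ℂ}
    (hz : z ∈ unitDisk) :
    ((1 - ‖z‖ ^ 2 : ℝ) : ℂ) * (Δ u) z + 2 * α * fderiv ℝ u z z - α ^ 2 * u z = 0 := by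
  have hz1 : ‖z‖ < 1 := by simpa [unitDisk] using hz
  have hpos : 0 < 1 - ‖z‖ ^ 2 := by nlinarith [norm_nonneg z]
  have h0 := h.eq_zero z hz
  have h1 : z * wirtinger u z + (starRingEnd ℂ) z * wirtingerBar u z = fderiv ℝ u z z := by
    rw [fderiv_apply_eq_wirtinger]
    ring
  have h2 : (1 - ‖z‖ ^ 2) ^ (-α) = (1 - ‖z‖ ^ 2) ^ (-α - 1) * (1 - ‖z‖ ^ 2) := by
    rw [Real.rpow_sub_one hpos.ne', div_mul_cancel₀ _ hpos.ne']
  have h3 : ((1 - ‖z‖ ^ 2) ^ (-α - 1) : ℝ) ≠ 0 := (Real.rpow_pos_of_pos hpos _).ne'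
  rw [opT, h1, h2] at h0
  set X := (1 - ‖z‖ ^ 2) ^ (-α - 1)
  have h4 : (X : ℂ) ≠ 0 := by exact_mod_cast h3
  have h5 : (X : ℂ) * (((1 - ‖z‖ ^ 2 : ℝ) : ℂ) * (Δ u) z + 2 * α * fderiv ℝ u z z
      - α ^ 2 * u z) = 0 := by
    push_cast at h0 ⊢
    linear_combination 4 * h0
  exact (mul_eq_zero.1 h5).resolve_left h4

lemma circleMap_mul_one (r s : ℝ) : circleMap 0 r s = r * circleMap 0 1 s := by
  simp [circleMap_zero]

/-- In polar coordinates, an `α`-harmonic function solves the polar form of the equation. -/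
lemma IsAlphaHarmonic.isPolarSolution {α : ℝ} {u : ℂ → ℂ} (h : IsAlphaHarmonic α u) :
    IsPolarSolution α (fun r s => u (circleMap 0 r s))
      (fun r s => fderiv ℝ u (circleMap 0 r s) (circleMap 0 1 s))
      (fun r s => fderiv ℝ (fderiv ℝ u) (circleMap 0 r s) (circleMap 0 1 s) (circleMap 0 1 s))
      (fun r s => fderiv ℝ u (circleMap 0 r s) (circleMap 0 r s * Complex.I))
      (fun r s => fderiv ℝ (fderiv ℝ u) (circleMap 0 r s) (circleMap 0 r s * Complex.I)
        (circleMap 0 r s * Complex.I)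
        + fderiv ℝ u (circleMap 0 r s) (circleMap 0 r s * Complex.I * Complex.I)) := by
  have hmem : ∀ r ∈ Ioo (0 : ℝ) 1, ∀ s, circleMap 0 r s ∈ unitDisk := fun r hr s =>
    circleMap_mem_unitDisk hr.1.le hr.2 s
  have hfd : ContDiffOn ℝ 1 (fderiv ℝ u) unitDisk :=
    h.contDiffOn.fderiv_of_isOpen isOpen_unitDisk (by norm_num)
  have hfdd : ContinuousOn (fderiv ℝ (fderiv ℝ u)) unitDisk :=
    hfd.continuousOn_fderiv_of_isOpen isOpen_unitDisk le_rfl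
  have hdu : ∀ r ∈ Ioo (0 : ℝ) 1, ∀ s, HasFDerivAt u (fderiv ℝ u (circleMap 0 r s))
      (circleMap 0 r s) := fun r hr s =>
    ((h.contDiffOn.differentiableOn two_ne_zero).differentiableAt
      (isOpen_unitDisk.mem_nhds (hmem r hr s))).hasFDerivAt
  have hddu : ∀ r ∈ Ioo (0 : ℝ) 1, ∀ s, HasFDerivAt (fderiv ℝ u)
      (fderiv ℝ (fderiv ℝ u) (circleMap 0 r s)) (circleMap 0 r s) := fun r hr s =>
    ((hfd.differentiableOn one_ne_zero).differentiableAt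
      (isOpen_unitDisk.mem_nhds (hmem r hr s))).hasFDerivAt
  have hcm : Continuous fun q : ℝ × ℝ => circleMap 0 q.1 q.2 := by
    simp only [circleMap]
    fun_prop
  have hcm1 : Continuous fun q : ℝ × ℝ => circleMap 0 1 q.2 := by
    simp only [circleMap]
    fun_prop
  have hmaps : MapsTo (fun q : ℝ × ℝ => circleMap 0 q.1 q.2) (Ioo 0 1 ×ˢ univ) unitDisk :=
    fun q hq => hmem q.1 hq.1 q.2
  have hs : ∀ r s : ℝ, HasDerivAt (fun s => circleMap 0 r s * Complex.I)
      (circleMap 0 r s * Complex.I * Complex.I) s := fun r s =>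
    (hasDerivAt_circleMap 0 r s).mul_const _
  have hc0 := h.contDiffOn.continuousOn.comp hcm.continuousOn hmaps
  have hc1 := hfd.continuousOn.comp hcm.continuousOn hmaps
  have hc2 := hfdd.comp hcm.continuousOn hmaps
  refine
    { hasDerivAt_r := fun r hr s => (hdu r hr s).comp_hasDerivAt r (hasDerivAt_circleMap_left r s)
      hasDerivAt_rr := fun r hr s => ?_
      hasDerivAt_s := fun r hr s => (hdu r hr s).comp_hasDerivAt s (hasDerivAt_circleMap 0 r s)
      hasDerivAt_ss := fun r hr s => ?_
      continuousOn := hc0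
      continuousOn_r := hc1.clm_apply hcm1.continuousOn
      continuousOn_rr := (hc2.clm_apply hcm1.continuousOn).clm_apply hcm1.continuousOn
      continuous_ss := fun r hr => ?_
      periodic := fun r _ s => ?_
      periodic_s := fun r _ s => ?_
      bounded := ?_
      eq_zero := fun r hr s => ?_ }
  · have h1 : HasDerivAt (fun r : ℝ => fderiv ℝ u (circleMap 0 r s))
        (fderiv ℝ (fderiv ℝ u) (circleMap 0 r s) (circleMap 0 1 s)) r :=
      (hddu r hr s).comp_hasDerivAt r (hasDerivAt_circleMap_left r s)
    simpa using h1.clm_apply (hasDerivAt_const r (circleMap 0 1 s))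
  · have h1 : HasDerivAt (fun s : ℝ => fderiv ℝ u (circleMap 0 r s))
        (fderiv ℝ (fderiv ℝ u) (circleMap 0 r s) (circleMap 0 r s * Complex.I)) s :=
      (hddu r hr s).comp_hasDerivAt s (hasDerivAt_circleMap 0 r s)
    exact h1.clm_apply (hs r s)
  · have hc : Continuous (circleMap 0 r) := continuous_circleMap 0 r
    rw [← continuousOn_univ]
    have h1 : ContinuousOn (circleMap 0 r) univ := hc.continuousOn
    have hm : MapsTo (circleMap 0 r) univ unitDisk := fun s _ => hmem r hr s
    have h2 := hfdd.comp h1 hm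
    have h3 := hfd.continuousOn.comp h1 hm
    have h4 : ContinuousOn (fun s => circleMap 0 r s * Complex.I) univ := by fun_prop
    have h5 : ContinuousOn (fun s => circleMap 0 r s * Complex.I * Complex.I) univ := by fun_prop
    exact ((h2.clm_apply h4).clm_apply h4).add (h3.clm_apply h5)
  · simp only [periodic_circleMap 0 r s]
  · simp only [periodic_circleMap 0 r s]
  · have hsub : Metric.closedBall (0 : ℂ) (1 / 2) ⊆ unitDisk :=
      Metric.closedBall_subset_ball (by norm_num)
    obtain ⟨C, hC⟩ := (isCompact_closedBall (0 : ℂ) (1 / 2)).exists_bound_of_continuousOn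
      (h.contDiffOn.continuousOn.mono hsub)
    obtain ⟨D, hD⟩ := (isCompact_closedBall (0 : ℂ) (1 / 2)).exists_bound_of_continuousOn
      (hfd.continuousOn.mono hsub)
    refine ⟨max C D, fun r hr s => ?_⟩
    have hz : circleMap 0 r s ∈ Metric.closedBall (0 : ℂ) (1 / 2) := by
      simpa [abs_of_pos hr.1] using hr.2.le
    refine ⟨(hC _ hz).trans (le_max_left _ _), ?_⟩
    refine ((fderiv ℝ u (circleMap 0 r s)).le_opNorm _).trans ?_
    simpa using Or.inr (hD _ hz)
  · have hz := hmem r hr s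
    have heq := h.mul_laplacian_add hz
    have hr0 : (r : ℂ) ≠ 0 := by exact_mod_cast hr.1.ne'
    have hn : ‖circleMap 0 r s‖ = r := by simp [abs_of_pos hr.1]
    set B := fderiv ℝ (fderiv ℝ u) (circleMap 0 r s) with hB
    set A := fderiv ℝ u (circleMap 0 r s) with hA
    set e := circleMap 0 1 s with he
    -- The Laplacian is computed in the rotated frame of radial and tangential unit vectors.
    have hlap : (Δ u) (circleMap 0 r s) = B e e + B (e * Complex.I) (e * Complex.I) := by
      rw [InnerProductSpace.laplacian_eq_iteratedFDeriv_complexPlane, bilin_apply_add_apply_mul_I]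
      simp [iteratedFDeriv_two_apply, hB, he]
    have hze : circleMap 0 r s = r • e := by
      rw [circleMap_mul_one, Complex.real_smul]
    have h1 : A (circleMap 0 r s) = r * A e := by
      rw [hze, map_smul, Complex.real_smul]
    -- The curvature of the circle contributes `-r` times the radial derivative to the angular
    -- second derivative. Divided by `r²`, it cancels the first-order term `Vr / r` of the polar
    -- Laplacian.
    have h2 : A (circleMap 0 r s * Complex.I * Complex.I) = -(r * A e) := by
      rw [mul_assoc, Complex.I_mul_I, mul_neg_one, map_neg, h1]
    have h3 : B (circleMap 0 r s * Complex.I) (circleMap 0 r s * Complex.I)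
        = r ^ 2 * B (e * Complex.I) (e * Complex.I) := by
      rw [hze, smul_mul_assoc, map_smul, map_smul, smul_apply,
        Complex.real_smul, Complex.real_smul]
      ring
    rw [hlap, hn, h1] at heq
    rw [h2, h3]
    field_simp
    linear_combination (r : ℂ) * heq

/-- The difference of a solution and its rotation is a solution. -/
lemma IsPolarSolution.shift_sub {α : ℝ} {V Vr Vrr Vs Vss : ℝ → ℝ → ℂ}
    (h : IsPolarSolution α V Vr Vrr Vs Vss) (δ : ℝ) :
    IsPolarSolution α (fun r s => V r (s + δ) - V r s) (fun r s => Vr r (s + δ) - Vr r s)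
      (fun r s => Vrr r (s + δ) - Vrr r s) (fun r s => Vs r (s + δ) - Vs r s)
      (fun r s => Vss r (s + δ) - Vss r s) := by
  have hc : ∀ k : ℝ → ℝ → ℂ, ContinuousOn (fun q : ℝ × ℝ => k q.1 q.2) (Ioo 0 1 ×ˢ univ) →
      ContinuousOn (fun q : ℝ × ℝ => k q.1 (q.2 + δ) - k q.1 q.2) (Ioo 0 1 ×ˢ univ) := fun k hk =>
    (hk.comp (f := fun q : ℝ × ℝ => (q.1, q.2 + δ)) (by fun_prop)
      fun q hq => ⟨hq.1, mem_univ _⟩).sub hk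
  have hp : ∀ s, s + 2 * Real.pi + δ = s + δ + 2 * Real.pi := fun s => by ring
  obtain ⟨C, hC⟩ := h.bounded
  refine ⟨fun r hr s => (h.hasDerivAt_r r hr _).sub (h.hasDerivAt_r r hr s),
    fun r hr s => (h.hasDerivAt_rr r hr _).sub (h.hasDerivAt_rr r hr s),
    fun r hr s => ((h.hasDerivAt_s r hr _).comp_add_const s δ).sub (h.hasDerivAt_s r hr s),
    fun r hr s => ((h.hasDerivAt_ss r hr _).comp_add_const s δ).sub (h.hasDerivAt_ss r hr s),
    hc _ h.continuousOn, hc _ h.continuousOn_r, hc _ h.continuousOn_rr,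
    fun r hr => ((h.continuous_ss r hr).comp (continuous_add_const δ)).sub (h.continuous_ss r hr),
    fun r hr s => ?_, fun r hr s => ?_, ⟨C + C, fun r hr s => ⟨?_, ?_⟩⟩, fun r hr s => ?_⟩
  · simp only [hp, h.periodic r hr]
  · simp only [hp, h.periodic_s r hr]
  · exact (norm_sub_le _ _).trans (add_le_add (hC r hr _).1 (hC r hr s).1)
  · exact (norm_sub_le _ _).trans (add_le_add (hC r hr _).2 (hC r hr s).2)
  · linear_combination h.eq_zero r hr (s + δ) - h.eq_zero r hr s

end

/-! ### The radial solution given by the hypergeometric series. -/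

section

lemma summable_polynomial_mul_geometric {C x : ℝ} (k : ℕ) (hx : |x| < 1) :
    Summable fun n : ℕ => C * (n + 1 : ℝ) ^ k * |x| ^ n := by
  have h1 : Summable fun n : ℕ => ((n + 1 : ℕ) : ℝ) ^ k * |x| ^ (n + 1) :=
    (summable_nat_add_iff (f := fun n : ℕ => (n : ℝ) ^ k * |x| ^ n) 1).2
      (summable_pow_mul_geometric_of_norm_lt_one k
      (by rwa [Real.norm_eq_abs, abs_abs]))
  rcases eq_or_ne x 0 with rfl | h0
  · refine summable_of_ne_finset_zero (s := {0}) fun n hn => ?_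
    simp [Finset.mem_singleton.not.1 hn]
  · have h2 : |x| ≠ 0 := abs_ne_zero.2 h0
    have h3 := h1.mul_left (C / |x|)
    refine h3.congr fun n => ?_
    rw [pow_succ]
    push_cast
    field_simp

/-- Termwise differentiation of a power series with coefficients of polynomial growth. -/
lemma hasDerivAt_tsum_pow {a : ℕ → ℝ} {C : ℝ} {k : ℕ} (ha : ∀ n, |a n| ≤ C * (n + 1 : ℝ) ^ k)
    {x : ℝ} (hx : |x| < 1) :
    HasDerivAt (fun x => ∑' n, a n * x ^ n) (∑' n : ℕ, (n + 1 : ℝ) * a (n + 1) * x ^ n) x := by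
  obtain ⟨ρ, hxρ, hρ⟩ := exists_between hx
  have hρ0 : 0 ≤ ρ := (abs_nonneg x).trans hxρ.le
  have hC : 0 ≤ C := by simpa using (abs_nonneg _).trans (ha 0)
  have hsum : ∀ y : ℝ, |y| < 1 → Summable fun n => a n * y ^ n := fun y hy =>
    Summable.of_norm_bounded (summable_polynomial_mul_geometric (C := C) k hy) fun n => by
      rw [norm_mul, norm_pow, Real.norm_eq_abs, Real.norm_eq_abs]
      gcongr
      exact ha n
  have hbound : Summable fun n : ℕ => C * (n + 1 : ℝ) ^ k * (n * ρ ^ (n - 1)) := by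
    rw [← summable_nat_add_iff 1]
    have := summable_polynomial_mul_geometric (C := C * 2 ^ k) (k + 1) (x := ρ)
      (by rwa [abs_of_nonneg hρ0])
    refine Summable.of_nonneg_of_le (fun n => by positivity) (fun n => ?_) this
    rw [abs_of_nonneg hρ0]
    rw [Nat.add_sub_cancel]
    push_cast
    have h2 : ((n : ℝ) + 1 + 1) ^ k ≤ (2 * (n + 1)) ^ k := by
      gcongr
      linarith
    rw [mul_pow] at h2
    calc C * ((n : ℝ) + 1 + 1) ^ k * ((n + 1) * ρ ^ n)
        ≤ C * (2 ^ k * (n + 1) ^ k) * ((n + 1) * ρ ^ n) := by gcongr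
      _ = C * 2 ^ k * (n + 1) ^ (k + 1) * ρ ^ n := by ring
  have hd := hasDerivAt_tsum_of_isPreconnected (g := fun n (y : ℝ) => a n * y ^ n)
    (g' := fun n y => a n * (n * y ^ (n - 1))) hbound (isOpen_Ioo (a := -ρ) (b := ρ))
    isPreconnected_Ioo (fun n y _ => (hasDerivAt_pow n y).const_mul (a n)) (fun n y hy => ?_)
    (abs_lt.1 hxρ) (hsum x hx) (abs_lt.1 hxρ)
  · refine hd.congr_deriv ?_
    have hs : Summable fun n : ℕ => a n * (n * x ^ (n - 1)) := by
      refine Summable.of_norm_bounded hbound fun n => ?_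
      rw [norm_mul, norm_mul, norm_pow, Real.norm_eq_abs, Real.norm_eq_abs, Real.norm_eq_abs,
        Nat.abs_cast]
      gcongr
      exact ha n
    rw [hs.tsum_eq_zero_add]
    simp only [Nat.cast_zero, zero_mul, mul_zero, zero_add, Nat.add_sub_cancel]
    refine tsum_congr fun n => ?_
    push_cast
    ring
  · rw [norm_mul, norm_mul, norm_pow, Real.norm_eq_abs, Real.norm_eq_abs, Real.norm_eq_abs,
      Nat.abs_cast]
    gcongr
    · exact ha n
    · exact (abs_lt.2 hy).le

/-- The coefficients of `₂F₁ t t 1`. -/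
def hypCoeff (t : ℝ) (n : ℕ) : ℝ := ((ascPochhammer ℝ n).eval t / n.factorial) ^ 2

lemma hypCoeff_nonneg (t : ℝ) (n : ℕ) : 0 ≤ hypCoeff t n := sq_nonneg _

lemma hypCoeff_zero (t : ℝ) : hypCoeff t 0 = 1 := by simp [hypCoeff]

lemma hypCoeff_succ (t : ℝ) (n : ℕ) :
    (n + 1 : ℝ) ^ 2 * hypCoeff t (n + 1) = (t + n) ^ 2 * hypCoeff t n := by
  rw [hypCoeff, hypCoeff, ascPochhammer_succ_eval, Nat.factorial_succ]
  push_cast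
  have : (n.factorial : ℝ) ≠ 0 := by positivity
  field_simp

/-- The ratio of successive coefficients is `((t+n)/(n+1))²`, at most `1` once `n ≥ -t` because `t ≤
1`. Only finitely many initial coefficients can exceed the later ones. -/
lemma exists_hypCoeff_le {t : ℝ} (ht : t ≤ 1) : ∃ C, ∀ n, hypCoeff t n ≤ C := by
  obtain ⟨N, hN⟩ := exists_nat_ge (-t)
  have hstep : ∀ n ≥ N, hypCoeff t (n + 1) ≤ hypCoeff t n := by
    intro n hn
    have hn' : (N : ℝ) ≤ n := by exact_mod_cast hn
    have h1 : (t + n) ^ 2 ≤ (n + 1 : ℝ) ^ 2 := by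
      rw [sq_le_sq₀ (by linarith) (by positivity)]
      linarith
    have h2 := hypCoeff_succ t n
    have h3 := mul_le_mul_of_nonneg_right h1 (hypCoeff_nonneg t n)
    rw [← h2] at h3
    exact le_of_mul_le_mul_left h3 (by positivity)
  refine ⟨∑ i ∈ Finset.range (N + 1), hypCoeff t i, fun n => ?_⟩
  have hle : ∀ i ≤ N, hypCoeff t i ≤ ∑ i ∈ Finset.range (N + 1), hypCoeff t i := fun i hi =>
    Finset.single_le_sum (fun i _ => hypCoeff_nonneg t i) (Finset.mem_range.2 (by omega))
  rcases le_total n N with h | h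
  · exact hle n h
  · induction n, h using Nat.le_induction with
    | base => exact hle N le_rfl
    | succ n hn ih => exact (hstep n hn).trans ih

/-- The sum of the hypergeometric series `₂F₁ t t 1`. -/
def hypSum (t x : ℝ) : ℝ := ∑' n, hypCoeff t n * x ^ n

/-- The first derivative of `hypSum`. -/
def hypSum' (t x : ℝ) : ℝ := ∑' n : ℕ, (n + 1 : ℝ) * hypCoeff t (n + 1) * x ^ n

/-- The second derivative of `hypSum`. -/
def hypSum'' (t x : ℝ) : ℝ :=
  ∑' n : ℕ, (n + 1 : ℝ) * (((n + 1 : ℕ) + 1 : ℝ) * hypCoeff t (n + 1 + 1)) * x ^ n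

lemma ordinaryHypergeometric_eq_hypSum (t x : ℝ) : ₂F₁ t t (1 : ℝ) x = hypSum t x := by
  rw [ordinaryHypergeometric_eq_tsum, hypSum]
  refine tsum_congr fun n => ?_
  rw [ascPochhammer_eval_one, hypCoeff, smul_eq_mul]
  field_simp

/-- Multiplying a power series by `x` shifts its index; the vanishing first coefficient makes the
shift exact. -/
lemma HasSum.mul_of_succ {b c : ℕ → ℝ} {S x : ℝ} (h : HasSum b S) (h0 : c 0 = 0)
    (hc : ∀ n, c (n + 1) = x * b n) : HasSum c (x * S) := by
  rw [← hasSum_nat_add_iff' 1]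
  simpa [h0, hc] using h.mul_left x

section hypSum

variable {t x : ℝ}

lemma hasDerivAt_hypSum (ht : t ≤ 1) (hx : |x| < 1) : HasDerivAt (hypSum t) (hypSum' t x) x := by
  obtain ⟨C, hC⟩ := exists_hypCoeff_le ht
  refine hasDerivAt_tsum_pow (C := C) (k := 0) (fun n => ?_) hx
  rw [abs_of_nonneg (hypCoeff_nonneg t n)]
  simpa using hC n

lemma abs_succ_mul_hypCoeff_le {C : ℝ} (hC : ∀ n, hypCoeff t n ≤ C) (n : ℕ) :
    |(n + 1 : ℝ) * hypCoeff t (n + 1)| ≤ C * (n + 1 : ℝ) ^ 1 := by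
  have := hypCoeff_nonneg t (n + 1)
  rw [abs_of_nonneg (by positivity), pow_one, mul_comm]
  have := hC (n + 1)
  gcongr

lemma hasDerivAt_hypSum' (ht : t ≤ 1) (hx : |x| < 1) :
    HasDerivAt (hypSum' t) (hypSum'' t x) x := by
  obtain ⟨C, hC⟩ := exists_hypCoeff_le ht
  exact hasDerivAt_tsum_pow (a := fun n => (n + 1 : ℝ) * hypCoeff t (n + 1)) (C := C) (k := 1)
    (abs_succ_mul_hypCoeff_le hC) hx

lemma summable_hypSum (ht : t ≤ 1) (hx : |x| < 1) : Summable fun n => hypCoeff t n * x ^ n := by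
  obtain ⟨C, hC⟩ := exists_hypCoeff_le ht
  refine Summable.of_norm_bounded (summable_polynomial_mul_geometric (C := C) 0 hx) fun n => ?_
  rw [norm_mul, norm_pow, Real.norm_eq_abs, Real.norm_eq_abs,
    abs_of_nonneg (hypCoeff_nonneg t n), pow_zero, mul_one]
  have := hC n
  gcongr

/-- The hypergeometric differential equation. -/
lemma hypSum_ode (ht : t ≤ 1) (hx : |x| < 1) :
    (1 - x) * (x * hypSum'' t x + hypSum' t x) - 2 * t * x * hypSum' t x - t ^ 2 * hypSum t x
      = 0 := by
  obtain ⟨C, hC⟩ := exists_hypCoeff_le ht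
  have hC0 : 0 ≤ C := (hypCoeff_nonneg t 0).trans (hC 0)
  set a := hypCoeff t with ha
  have hb : ∀ n, |a n| ≤ C := fun n => by
    rw [abs_of_nonneg (hypCoeff_nonneg t n)]
    exact hC n
  have hs0 : HasSum (fun n : ℕ => a n * x ^ n) (hypSum t x) := (summable_hypSum ht hx).hasSum
  have hs1' : HasSum (fun n : ℕ => (n + 1 : ℝ) * a (n + 1) * x ^ n) (hypSum' t x) := by
    refine (Summable.of_norm_bounded (summable_polynomial_mul_geometric (C := C) 1 hx)
      fun n => ?_).hasSum
    rw [norm_mul, norm_pow, Real.norm_eq_abs, Real.norm_eq_abs]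
    gcongr
    exact abs_succ_mul_hypCoeff_le hC n
  have hs2' : HasSum (fun n : ℕ => (n + 1 : ℝ) * (((n + 1 : ℕ) + 1 : ℝ) * a (n + 1 + 1)) * x ^ n)
      (hypSum'' t x) := by
    refine (Summable.of_norm_bounded (summable_polynomial_mul_geometric (C := 2 * C) 2 hx)
      fun n => ?_).hasSum
    rw [norm_mul, norm_mul, norm_pow, Real.norm_eq_abs, Real.norm_eq_abs, Real.norm_eq_abs]
    refine mul_le_mul_of_nonneg_right ?_ (by positivity)
    have h1 := abs_succ_mul_hypCoeff_le hC (n + 1)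
    rw [abs_of_nonneg (by positivity : (0 : ℝ) ≤ (n : ℝ) + 1)]
    push_cast at h1 ⊢
    have h2 : (0 : ℝ) ≤ n := by positivity
    calc ((n : ℝ) + 1) * |((n : ℝ) + 1 + 1) * a (n + 1 + 1)|
        ≤ ((n : ℝ) + 1) * (C * ((n : ℝ) + 1 + 1) ^ 1) := by gcongr
      _ ≤ ((n : ℝ) + 1) * (C * (2 * ((n : ℝ) + 1))) := by
        gcongr
        linarith
      _ = 2 * C * ((n : ℝ) + 1) ^ 2 := by ring
  have hs1 : HasSum (fun n : ℕ => (n : ℝ) * a n * x ^ n) (x * hypSum' t x) :=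
    hs1'.mul_of_succ (by simp) fun n => by
      push_cast
      ring
  have hs2 : HasSum (fun n : ℕ => (n : ℝ) * ((n + 1 : ℝ) * a (n + 1)) * x ^ n)
      (x * hypSum'' t x) := hs2'.mul_of_succ (by simp) fun n => by
    push_cast
    ring
  have hH := hs2.add hs1'
  have hxH : HasSum (fun n : ℕ => (n : ℝ) ^ 2 * a n * x ^ n)
      (x * (x * hypSum'' t x + hypSum' t x)) := hH.mul_of_succ (by simp) fun n => by
    push_cast
    ring
  -- With `H = x S'' + S'`, the equation is `H = t² S + 2t x S' + x H`. Comparing coefficients of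
  -- `x^n` gives `(n+1)² a_{n+1} = (t+n)² a_n`, the recurrence of the coefficients.
  have hR := ((hs0.mul_left (t ^ 2)).add (hs1.mul_left (2 * t))).add hxH
  have hcoef : (fun n : ℕ => (n : ℝ) * ((n + 1 : ℝ) * a (n + 1)) * x ^ n
      + (n + 1 : ℝ) * a (n + 1) * x ^ n) = fun n : ℕ => t ^ 2 * (a n * x ^ n)
      + 2 * t * (n * a n * x ^ n) + (n : ℝ) ^ 2 * a n * x ^ n := by
    funext n
    have := hypCoeff_succ t n
    linear_combination x ^ n * this
  rw [hcoef] at hH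
  linear_combination hH.unique hR

/-- The radial solution `₂F₁ t t 1 (r²)` with `t = -α / 2` of `T_α u = 0`. -/
lemma hypSum_radial_ode {α r : ℝ} (hα : -1 < α) (hr : r ∈ Ioo (0 : ℝ) 1) :
    (1 - r ^ 2) * ((2 * hypSum' (-α / 2) (r ^ 2) + 4 * r ^ 2 * hypSum'' (-α / 2) (r ^ 2))
      + (2 * r * hypSum' (-α / 2) (r ^ 2)) / r) + 2 * α * r * (2 * r * hypSum' (-α / 2) (r ^ 2))
      - α ^ 2 * hypSum (-α / 2) (r ^ 2) = 0 := by
  have hx : |r ^ 2| < 1 := by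
    rw [abs_of_nonneg (sq_nonneg r)]
    nlinarith [hr.1, hr.2]
  have := hypSum_ode (t := -α / 2) (by linarith) hx
  have hr0 := hr.1.ne'
  rw [mul_div_right_comm, mul_div_cancel_right₀ _ hr0]
  linear_combination 4 * this

lemma hasDerivAt_hypSum_sq {α r : ℝ} (hα : -1 < α) (hr : r ∈ Ioo (0 : ℝ) 1) :
    HasDerivAt (fun r => hypSum (-α / 2) (r ^ 2)) (2 * r * hypSum' (-α / 2) (r ^ 2)) r := by
  have hx : |r ^ 2| < 1 := by
    rw [abs_of_nonneg (sq_nonneg r)]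
    nlinarith [hr.1, hr.2]
  have h1 := HasDerivAt.comp (h₂ := hypSum (-α / 2)) (h := fun r : ℝ => r ^ 2) r
    (hasDerivAt_hypSum (by linarith) hx) (hasDerivAt_pow 2 r)
  refine h1.congr_deriv ?_
  simp
  ring

lemma hasDerivAt_hypSum'_sq {α r : ℝ} (hα : -1 < α) (hr : r ∈ Ioo (0 : ℝ) 1) :
    HasDerivAt (fun r => 2 * r * hypSum' (-α / 2) (r ^ 2))
      (2 * hypSum' (-α / 2) (r ^ 2) + 4 * r ^ 2 * hypSum'' (-α / 2) (r ^ 2)) r := by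
  have hx : |r ^ 2| < 1 := by
    rw [abs_of_nonneg (sq_nonneg r)]
    nlinarith [hr.1, hr.2]
  have h1 := HasDerivAt.comp (h₂ := hypSum' (-α / 2)) (h := fun r : ℝ => r ^ 2) r
    (hasDerivAt_hypSum' (by linarith) hx) (hasDerivAt_pow 2 r)
  refine (((hasDerivAt_id r).const_mul 2).mul h1).congr_deriv ?_
  simp
  ring

lemma one_le_hypSum (ht : t ≤ 1) (hx0 : 0 ≤ x) (hx : x < 1) : 1 ≤ hypSum t x := by
  have h := (summable_hypSum ht (by rwa [abs_of_nonneg hx0])).le_tsum 0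
    fun n _ => mul_nonneg (hypCoeff_nonneg t n) (pow_nonneg hx0 n)
  rw [hypSum]
  simpa [hypCoeff_zero] using h

lemma hypSum_mono (ht : t ≤ 1) {y : ℝ} (hx0 : 0 ≤ x) (hxy : x ≤ y) (hy : y < 1) :
    hypSum t x ≤ hypSum t y := by
  refine (summable_hypSum ht (by rw [abs_of_nonneg hx0]; linarith)).tsum_le_tsum (fun n => ?_)
    (summable_hypSum ht (by rwa [abs_of_nonneg (hx0.trans hxy)]))
  have := hypCoeff_nonneg t n
  gcongr

end hypSum

/-- The mean modulus of a solution of `T_α V = 0` grows at least like the radial solution. -/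
lemma IsPolarSolution.monotoneOn_integral_norm_div_hypSum {α : ℝ} (hα : -1 < α)
    {V Vr Vrr Vs Vss : ℝ → ℝ → ℂ} (h : IsPolarSolution α V Vr Vrr Vs Vss) :
    MonotoneOn (fun r => (∫ s in 0..2 * Real.pi, ‖V r s‖) / hypSum (-α / 2) (r ^ 2))
      (Ioo 0 1) := by
  have hx : ∀ r ∈ Ioo (0 : ℝ) 1, r ^ 2 < 1 := fun r hr => by nlinarith [hr.1, hr.2]
  refine h.monotoneOn_integral_norm_div (fun r hr => hasDerivAt_hypSum_sq hα hr)
    (fun r hr => hasDerivAt_hypSum'_sq hα hr)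
    (fun r hr => one_pos.trans_le (one_le_hypSum (by linarith) (sq_nonneg r) (hx r hr))) ?_
    (fun r hr => hypSum_radial_ode hα hr)
  have hmaps : MapsTo (fun r : ℝ => r ^ 2) (Icc 0 (1 / 2)) {x | |x| < 1} := fun r hr => by
    simp only [mem_ofPred_eq, abs_of_nonneg (sq_nonneg r)]
    nlinarith [hr.1, hr.2]
  have hc1 : ContinuousOn (fun r : ℝ => hypSum (-α / 2) (r ^ 2)) (Icc 0 (1 / 2)) :=
    ContinuousOn.comp (g := hypSum (-α / 2)) (fun x hx =>
      (hasDerivAt_hypSum (by linarith) hx).continuousAt.continuousWithinAt) (by fun_prop) hmaps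
  have hc2 : ContinuousOn (fun r : ℝ => 2 * r * hypSum' (-α / 2) (r ^ 2)) (Icc 0 (1 / 2)) :=
    ContinuousOn.mul (by fun_prop) (ContinuousOn.comp (g := hypSum' (-α / 2)) (fun x hx =>
      (hasDerivAt_hypSum' (by linarith) hx).continuousAt.continuousWithinAt) (by fun_prop) hmaps)
  obtain ⟨C, hC⟩ := isCompact_Icc.exists_bound_of_continuousOn hc1
  obtain ⟨D, hD⟩ := isCompact_Icc.exists_bound_of_continuousOn hc2
  exact ⟨max C D, fun r hr => ⟨(hC r (Ioo_subset_Icc_self hr)).trans (le_max_left _ _),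
    (hD r (Ioo_subset_Icc_self hr)).trans (le_max_right _ _)⟩⟩

end

/-! ### Gauss's value at `1`, by Parseval's identity and a beta integral. -/

section

lemma integral_exp_int_mul_I (k : ℤ) :
    ∫ s in (0 : ℝ)..2 * Real.pi, Complex.exp (k * Complex.I * s) = if k = 0 then 2 * Real.pi else 0 := by
  split_ifs with hk
  · simp [hk]
  · have hc : (k : ℂ) * Complex.I ≠ 0 := mul_ne_zero (by exact_mod_cast hk) Complex.I_ne_zero
    rw [integral_exp_mul_complex hc]
    have : (k : ℂ) * Complex.I * ((2 * Real.pi : ℝ) : ℂ) = k * (2 * Real.pi * Complex.I) := by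
      push_cast
      ring
    rw [this, Complex.exp_int_mul_two_pi_mul_I]
    simp

/-- Parseval's identity for an absolutely convergent power series on the unit circle. -/
lemma integral_norm_sq_of_hasSum {c : ℕ → ℝ} (hc : Summable fun n => |c n|) {f : ℝ → ℂ}
    (hf : ∀ s : ℝ, HasSum (fun n : ℕ => (c n : ℂ) * Complex.exp (n * Complex.I * s)) (f s)) :
    ∫ s in (0 : ℝ)..2 * Real.pi, ‖f s‖ ^ 2 = 2 * Real.pi * ∑' n, c n ^ 2 := by
  have hnorm : ∀ (n : ℕ) (s : ℝ), ‖(c n : ℂ) * Complex.exp (n * Complex.I * s)‖ = |c n| := by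
    intro n s
    have : (n : ℂ) * Complex.I * s = ((n * s : ℝ) : ℂ) * Complex.I := by
      push_cast
      ring
    rw [norm_mul, this, Complex.norm_exp_ofReal_mul_I, mul_one, Complex.norm_real, Real.norm_eq_abs]
  have hterm : ∀ (n m : ℕ) (s : ℝ), (c n : ℂ) * Complex.exp (n * Complex.I * s)
      * (starRingEnd ℂ) ((c m : ℂ) * Complex.exp (m * Complex.I * s))
      = ((c n * c m : ℝ) : ℂ) * Complex.exp (((n - m : ℤ) : ℂ) * Complex.I * s) := by
    intro n m s
    rw [map_mul, ← Complex.exp_conj, Complex.conj_ofReal, mul_mul_mul_comm, ← Complex.exp_add]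
    simp only [map_mul, Complex.conj_ofReal, Complex.conj_I, map_natCast]
    push_cast
    congr 2
    ring
  -- `|f|²` is expanded as an absolutely convergent double series; after integration only its
  -- diagonal survives.
  have hpair : ∀ s : ℝ, HasSum (fun q : ℕ × ℕ => ((c q.1 * c q.2 : ℝ) : ℂ)
      * Complex.exp (((q.1 - q.2 : ℤ) : ℂ) * Complex.I * s)) ((‖f s‖ ^ 2 : ℝ) : ℂ) := by
    intro s
    have h1 := hf s
    have h2 : HasSum (fun n : ℕ => (starRingEnd ℂ) ((c n : ℂ) * Complex.exp (n * Complex.I * s)))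
      ((starRingEnd ℂ) (f s)) := h1.star
    have h3 : Summable fun n : ℕ => ‖(c n : ℂ) * Complex.exp (n * Complex.I * s)‖ := by
      simpa only [hnorm] using hc
    have h4 : Summable fun n : ℕ =>
        ‖(starRingEnd ℂ) ((c n : ℂ) * Complex.exp (n * Complex.I * s))‖ := by
      simpa only [RCLike.norm_conj, hnorm] using hc
    generalize hF : (fun n : ℕ => (c n : ℂ) * Complex.exp (n * Complex.I * s)) = F at h1
    generalize hG : (fun n : ℕ => (starRingEnd ℂ) ((c n : ℂ) * Complex.exp (n * Complex.I * s))) = G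
      at h2
    have hF' : ∀ n, F n = (c n : ℂ) * Complex.exp (n * Complex.I * s) := fun n => by rw [← hF]
    have hG' : ∀ n, G n = (starRingEnd ℂ) ((c n : ℂ) * Complex.exp (n * Complex.I * s)) :=
      fun n => by rw [← hG]
    simp only [← hF'] at h3
    simp only [← hF'] at h4
    have h6 : Summable fun q : ℕ × ℕ => F q.1 * G q.2 :=
      summable_mul_of_summable_norm h3 (by simpa only [hF', hG'] using h4)
    have h5 := h1.mul h2 h6
    rw [Complex.mul_conj, Complex.normSq_eq_norm_sq] at h5
    refine h5.congr_fun fun q => ?_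
    rw [hF', hG', hterm]
  have hint := intervalIntegral.hasSum_integral_of_dominated_convergence
    (μ := volume) (a := 0) (b := 2 * Real.pi)
    (F := fun (q : ℕ × ℕ) (s : ℝ) => ((c q.1 * c q.2 : ℝ) : ℂ)
      * Complex.exp (((q.1 - q.2 : ℤ) : ℂ) * Complex.I * s))
    (bound := fun q _ => |c q.1| * |c q.2|)
    (fun q => (Continuous.aestronglyMeasurable (by fun_prop))) (fun q => ?_) ?_ ?_
    (Eventually.of_forall fun s _ => hpair s)
  · simp only [intervalIntegral.integral_const_mul, integral_exp_int_mul_I] at hint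
    rw [intervalIntegral.integral_ofReal] at hint
    have hdiag := (Function.Injective.hasSum_iff (g := fun n : ℕ => (n, n))
      (fun a b h => congrArg Prod.fst h) ?_).2 hint
    · have h6 : HasSum (fun n : ℕ => ((c n ^ 2 * (2 * Real.pi) : ℝ) : ℂ))
          ((∫ s in (0 : ℝ)..2 * Real.pi, ‖f s‖ ^ 2 : ℝ) : ℂ) := by
        refine hdiag.congr_fun fun n => ?_
        simp [pow_two]
      have h7 := Complex.hasSum_ofReal.1 h6
      rw [← h7.tsum_eq, tsum_mul_right, mul_comm]
    · rintro ⟨n, m⟩ hnm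
      have : (n : ℤ) - m ≠ 0 := fun h0 => hnm ⟨n, by
        have : n = m := by omega
        rw [this]⟩
      simp [this]
  · refine Eventually.of_forall fun s _ => ?_
    rw [norm_mul, Complex.norm_real, norm_mul, Real.norm_eq_abs, Real.norm_eq_abs]
    have : (((q.1 - q.2 : ℤ) : ℂ) * Complex.I * s) = (((q.1 - q.2 : ℤ) * s : ℝ) : ℂ) * Complex.I := by
      push_cast
      ring
    rw [this, Complex.norm_exp_ofReal_mul_I, mul_one]
  · exact Eventually.of_forall fun s _ => hc.mul_of_nonneg hc (fun _ => abs_nonneg _)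
      fun _ => abs_nonneg _
  · exact intervalIntegrable_const

/-- The binomial series, with its generalized binomial coefficients rewritten as `(t)_n / n!`. The
squares of these are the coefficients of the radial solution. -/
lemma hasSum_one_sub_cpow (t : ℝ) {z : ℂ} (hz : ‖z‖ < 1) :
    HasSum (fun n : ℕ => (((ascPochhammer ℝ n).eval t / n.factorial : ℝ) : ℂ) * z ^ n)
      (1 / (1 - z) ^ (t : ℂ)) := by
  have h := (Complex.one_div_one_sub_cpow_hasFPowerSeriesOnBall_zero (t : ℂ)).hasSum
    (y := z) (by
    rw [Metric.mem_eball, edist_zero_right, ← ofReal_norm, ENNReal.ofReal_lt_one]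
    exact hz)
  rw [zero_add] at h
  have hcoef : (fun n : ℕ => (((ascPochhammer ℝ n).eval t / n.factorial : ℝ) : ℂ) * z ^ n) =
    fun n => (FormalMultilinearSeries.ofScalars ℂ fun n => Ring.choose ((t : ℂ) + ↑n - 1) n) n
      fun _ => z := by
    funext n
    rw [FormalMultilinearSeries.ofScalars_apply_eq, smul_eq_mul]
    congr 1
    have h1 := Ring.factorial_nsmul_multichoose_eq_ascPochhammer (t : ℂ) n
    rw [Ring.multichoose_eq, Polynomial.ascPochhammer_smeval_eq_eval, nsmul_eq_mul] at h1
    have hn : (n.factorial : ℂ) ≠ 0 := by exact_mod_cast n.factorial_ne_zero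
    push_cast
    rw [div_eq_iff hn, mul_comm, h1, ← ascPochhammer_map Complex.ofRealHom n, Polynomial.eval_map]
    exact (Polynomial.eval₂_at_apply Complex.ofRealHom t).symm
  rw [hcoef]
  exact h

lemma norm_one_sub_exp (s : ℝ) (hs : s ∈ Ioo 0 (2 * Real.pi)) :
    ‖1 - Complex.exp (s * Complex.I)‖ = 2 * Real.sin (s / 2) := by
  rw [norm_sub_rev, mul_comm, Complex.norm_exp_I_mul_ofReal_sub_one, Real.norm_eq_abs, abs_of_pos]
  have := Real.sin_pos_of_pos_of_lt_pi (x := s / 2) (by linarith [hs.1]) (by linarith [hs.2])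
  positivity

/-- The beta integral in trigonometric form. -/
lemma lintegral_two_sin_rpow {α : ℝ} (hα : -1 < α) :
    ∫⁻ s in Ioo 0 (2 * Real.pi), ENNReal.ofReal ((2 * Real.sin (s / 2)) ^ α)
      = ENNReal.ofReal (2 * Real.pi * (Real.Gamma (1 + α) / Real.Gamma (α / 2 + 1) ^ 2)) := by
  set b := (α + 1) / 2 with hb
  have hb0 : 0 < b := by rw [hb]; linarith
  -- The substitution `x = sin²(s/4)` gives `x(1-x) = (sin(s/2)/2)²` and `dx = sin(s/2)/4 ds`, which
  -- turns the integrand into the symmetric beta density with parameter `b = (α+1)/2`.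
  set φ : ℝ → ℝ := fun s => Real.sin (s / 4) ^ 2 with hφ
  have hpi := Real.pi_pos
  have hmono : StrictMonoOn φ (Icc 0 (2 * Real.pi)) := by
    intro x hx y hy hxy
    have h1 := Real.strictMonoOn_sin (a := x / 4) (b := y / 4)
      ⟨by linarith [hx.1], by linarith [hx.2]⟩ ⟨by linarith [hy.1], by linarith [hy.2]⟩
      (by linarith)
    have h2 : 0 ≤ Real.sin (x / 4) :=
      Real.sin_nonneg_of_nonneg_of_le_pi (by linarith [hx.1]) (by linarith [hx.2])
    simp only [hφ]
    gcongr
  have hφ0 : φ 0 = 0 := by simp [hφ]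
  have hφ1 : φ (2 * Real.pi) = 1 := by
    have : 2 * Real.pi / 4 = Real.pi / 2 := by ring
    simp [hφ, this]
  have himg : φ '' Ioo 0 (2 * Real.pi) = Ioo 0 1 := by
    refine Subset.antisymm ?_ ?_
    · rintro _ ⟨s, hs, rfl⟩
      rw [← hφ0, ← hφ1]
      exact ⟨hmono ⟨le_rfl, by positivity⟩ (Ioo_subset_Icc_self hs) hs.1,
        hmono (Ioo_subset_Icc_self hs) ⟨by positivity, le_rfl⟩ hs.2⟩
    · have := intermediate_value_Ioo (f := φ) (by positivity : (0 : ℝ) ≤ 2 * Real.pi)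
        (by fun_prop)
      rwa [hφ0, hφ1] at this
  have hinj : InjOn φ (Ioo 0 (2 * Real.pi)) := hmono.injOn.mono Ioo_subset_Icc_self
  have hd : ∀ s ∈ Ioo 0 (2 * Real.pi), HasDerivWithinAt φ (Real.sin (s / 2) / 4)
      (Ioo 0 (2 * Real.pi)) s := by
    intro s _
    have h1 : HasDerivAt (fun s : ℝ => s / 4) (1 / 4) s := (hasDerivAt_id s).div_const 4
    have h2 := (h1.sin.pow 2).hasDerivWithinAt (s := Ioo 0 (2 * Real.pi))
    refine h2.congr_deriv ?_
    have : s / 2 = 2 * (s / 4) := by ring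
    rw [this, Real.sin_two_mul]
    norm_num
    ring
  have hcov := lintegral_image_eq_lintegral_abs_deriv_mul measurableSet_Ioo hd hinj
    (ProbabilityTheory.betaPDF b b)
  have hone : ∫⁻ x in Ioo (0 : ℝ) 1, ProbabilityTheory.betaPDF b b x = 1 := by
    rw [← ProbabilityTheory.lintegral_betaPDF_eq_one hb0 hb0]
    rw [← lintegral_indicator measurableSet_Ioo]
    congr 1
    funext x
    by_cases hx : x ∈ Ioo (0 : ℝ) 1
    · rw [indicator_of_mem hx]
    · rw [indicator_of_notMem hx]
      rcases le_or_gt x 0 with h0 | h0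
      · exact (ProbabilityTheory.betaPDF_eq_zero_of_nonpos h0).symm
      · exact (ProbabilityTheory.betaPDF_eq_zero_of_one_le
          (not_lt.1 fun h1 => hx ⟨h0, h1⟩)).symm
  rw [himg, hone] at hcov
  have hB := ProbabilityTheory.beta_pos hb0 hb0
  have hpt : ∀ s ∈ Ioo 0 (2 * Real.pi), ENNReal.ofReal ((2 * Real.sin (s / 2)) ^ α)
      = ENNReal.ofReal (2 * 4 ^ α * ProbabilityTheory.beta b b) *
        (ENNReal.ofReal |Real.sin (s / 2) / 4| * ProbabilityTheory.betaPDF b b (φ s)) := by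
    intro s hs
    have hm : φ s ∈ Ioo (0 : ℝ) 1 := himg ▸ mem_image_of_mem φ hs
    have hsin := Real.sin_pos_of_pos_of_lt_pi (x := s / 2) (by linarith [hs.1])
      (by linarith [hs.2])
    rw [ProbabilityTheory.betaPDF_of_pos_lt_one hm.1 hm.2, ← ENNReal.ofReal_mul (abs_nonneg _),
      ← ENNReal.ofReal_mul (by positivity), abs_of_pos (by positivity)]
    congr 1
    have h1 : φ s * (1 - φ s) = (Real.sin (s / 2) / 2) ^ 2 := by
      have : s / 2 = 2 * (s / 4) := by ring
      rw [this, Real.sin_two_mul]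
      have := Real.sin_sq_add_cos_sq (s / 4)
      simp only [hφ]
      linear_combination (-Real.sin (s / 4) ^ 2) * this
    rw [mul_assoc (1 / ProbabilityTheory.beta b b),
      ← Real.mul_rpow hm.1.le (by linarith [hm.2]), h1]
    have h2 : (((Real.sin (s / 2) / 2) ^ 2) ^ (b - 1) : ℝ) = (Real.sin (s / 2) / 2) ^ (α - 1) := by
      rw [← Real.rpow_natCast, ← Real.rpow_mul (by positivity)]
      congr 1
      rw [hb]
      push_cast
      ring
    rw [h2, Real.rpow_sub_one (by positivity)]
    have h3 : (2 * Real.sin (s / 2)) ^ α = 4 ^ α * (Real.sin (s / 2) / 2) ^ α := by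
      rw [← Real.mul_rpow (by norm_num) (by positivity)]
      congr 1
      ring
    rw [h3]
    field_simp
    ring
  rw [setLIntegral_congr_fun measurableSet_Ioo hpt, lintegral_const_mul' _ _ ENNReal.ofReal_ne_top,
    ← hcov, mul_one]
  congr 1
  -- Legendre's duplication formula converts `Γ(b)²/Γ(2b)` into `Γ(1+α)/Γ(α/2+1)²`.
  have hdup := Real.Gamma_mul_Gamma_add_half b
  have e1 : b + 1 / 2 = α / 2 + 1 := by rw [hb]; ring
  have e2 : 2 * b = 1 + α := by rw [hb]; ring
  have e3 : b + b = 1 + α := by rw [hb]; ring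
  rw [e1, e2] at hdup
  rw [ProbabilityTheory.beta, e3]
  have g1 : 0 < Real.Gamma (1 + α) := Real.Gamma_pos_of_pos (by linarith)
  have g2 : 0 < Real.Gamma (α / 2 + 1) := Real.Gamma_pos_of_pos (by linarith)
  have h4 : Real.Gamma b = Real.Gamma (1 + α) * 2 ^ (1 - (1 + α)) * √Real.pi /
      Real.Gamma (α / 2 + 1) := by
    rw [eq_div_iff g2.ne', hdup]
  have h5 : (4 : ℝ) ^ α * (2 ^ (1 - (1 + α))) ^ 2 = 1 := by
    have : (4 : ℝ) = 2 ^ (2 : ℝ) := by norm_num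
    rw [this, ← Real.rpow_natCast, ← Real.rpow_mul (by norm_num), ← Real.rpow_mul (by norm_num),
      ← Real.rpow_add (by norm_num)]
    push_cast
    have : 2 * α + (1 - (1 + α)) * 2 = 0 := by ring
    rw [this, Real.rpow_zero]
  have h6 : √Real.pi ^ 2 = Real.pi := Real.sq_sqrt hpi.le
  rw [h4]
  generalize Real.Gamma (α / 2 + 1) = G at g2
  field_simp
  linear_combination (Real.pi) * h5 + (4 : ℝ) ^ α * (2 ^ (1 - (1 + α))) ^ 2 * h6

/-- Gauss's value at `1` bounds every upper bound of the radial solution from below. -/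
lemma Gamma_div_le_of_forall_hypSum_le {α S : ℝ} (hα : -1 < α)
    (hS : ∀ r ∈ Ioo (0 : ℝ) 1, hypSum (-α / 2) (r ^ 2) ≤ S) :
    Real.Gamma (1 + α) / Real.Gamma (α / 2 + 1) ^ 2 ≤ S := by
  have hpi := Real.pi_pos
  set t := -α / 2 with ht
  have hS0 : 0 ≤ S := zero_le_one.trans ((one_le_hypSum (t := t) (by linarith) (sq_nonneg (1 / 2))
    (by norm_num)).trans (hS (1 / 2) ⟨by norm_num, by norm_num⟩))
  -- With `t = -α/2` one has `|(1-z)^(-t)|² = |1-z|^α`, so Parseval identifies the radial solution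
  -- with a circular mean of `|1-z|^α`.
  have hpars : ∀ r ∈ Ioo (0 : ℝ) 1, ∫ s in (0 : ℝ)..2 * Real.pi,
      ‖1 - r * Complex.exp (s * Complex.I)‖ ^ α = 2 * Real.pi * hypSum t (r ^ 2) := by
    intro r hr
    have hz : ∀ s : ℝ, ‖(r : ℂ) * Complex.exp (s * Complex.I)‖ < 1 := fun s => by
      simpa [Complex.norm_exp_ofReal_mul_I, abs_of_pos hr.1] using hr.2
    have h1 := integral_norm_sq_of_hasSum
      (c := fun n => (ascPochhammer ℝ n).eval t / n.factorial * r ^ n)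
      (f := fun s => 1 / (1 - (r : ℂ) * Complex.exp (s * Complex.I)) ^ (t : ℂ)) ?_ fun s => ?_
    · have h2 : ∀ s : ℝ, ‖1 / (1 - (r : ℂ) * Complex.exp (s * Complex.I)) ^ (t : ℂ)‖ ^ 2
          = ‖1 - r * Complex.exp (s * Complex.I)‖ ^ α := fun s => by
        rw [norm_div, norm_one, Complex.norm_cpow_real, one_div, ← Real.rpow_neg (norm_nonneg _),
          ← Real.rpow_natCast, ← Real.rpow_mul (norm_nonneg _)]
        congr 1
        rw [ht]
        push_cast
        ring
      simp only [h2] at h1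
      rw [h1, hypSum]
      congr 1
      refine tsum_congr fun n => ?_
      rw [hypCoeff, mul_pow, ← pow_mul, ← pow_mul, mul_comm n 2]
    · have h3 := (hasSum_one_sub_cpow t (z := r) (by simpa [abs_of_pos hr.1] using hr.2)).summable
      refine h3.norm.congr fun n => ?_
      rw [← Complex.ofReal_pow, ← Complex.ofReal_mul, Complex.norm_real, Real.norm_eq_abs]
    · refine (hasSum_one_sub_cpow t (hz s)).congr_fun fun n => ?_
      rw [mul_pow, ← Complex.exp_nat_mul]
      have h4 : (n : ℂ) * (s * Complex.I) = n * Complex.I * s := by ring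
      rw [h4]
      push_cast
      rw [mul_assoc]
  set ρ : ℕ → ℝ := fun m => 1 - 1 / (m + 2) with hρ
  have hρmem : ∀ m, ρ m ∈ Ioo (0 : ℝ) 1 := fun m => by
    have h2 : (0 : ℝ) < m + 2 := by positivity
    have h3 : 1 / (m + 2 : ℝ) < 1 := by
      rw [div_lt_one h2]
      linarith [(Nat.cast_nonneg m : (0 : ℝ) ≤ m)]
    have h4 : 0 < 1 / (m + 2 : ℝ) := by positivity
    exact ⟨by simp only [hρ]; linarith, by simp only [hρ]; linarith⟩
  have hρlim : Tendsto ρ atTop (𝓝 1) := by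
    have h1 : Tendsto (fun m : ℕ => 1 / ((m : ℝ) + 2)) atTop (𝓝 0) :=
      tendsto_const_nhds.div_atTop (tendsto_atTop_add_const_right _ _ tendsto_natCast_atTop_atTop)
    simpa [hρ] using h1.const_sub 1
  set g : ℕ → ℝ → ℝ≥0∞ := fun m s =>
    ENNReal.ofReal (‖1 - ρ m * Complex.exp (s * Complex.I)‖ ^ α) with hg
  have hne : ∀ m (s : ℝ), ‖1 - ρ m * Complex.exp (s * Complex.I)‖ ≠ 0 := fun m s h0 => by
    rw [norm_eq_zero, sub_eq_zero] at h0
    have h1 := congrArg norm h0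
    rw [norm_one, norm_mul, Complex.norm_exp_ofReal_mul_I, mul_one, Complex.norm_real,
      Real.norm_eq_abs, abs_of_pos (hρmem m).1] at h1
    exact (hρmem m).2.ne h1.symm
  have hcont : ∀ m, Continuous fun s : ℝ => ‖1 - ρ m * Complex.exp (s * Complex.I)‖ ^ α :=
    fun m => Continuous.rpow_const (by fun_prop) fun s => Or.inl (hne m s)
  have hgm : ∀ m, Measurable (g m) := fun m => (hcont m).measurable.ennreal_ofReal
  have hgint : ∀ m, ∫⁻ s in Ioo 0 (2 * Real.pi), g m s ≤ ENNReal.ofReal (2 * Real.pi * S) := by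
    intro m
    rw [setLIntegral_congr Ioo_ae_eq_Ioc, ← ofReal_integral_eq_lintegral_ofReal
      ((intervalIntegrable_iff_integrableOn_Ioc_of_le (by positivity)).1
        ((hcont m).intervalIntegrable _ _))
      (Eventually.of_forall fun s => Real.rpow_nonneg (norm_nonneg _) _),
      ← intervalIntegral.integral_of_le (by positivity), hpars _ (hρmem m)]
    refine ENNReal.ofReal_le_ofReal ?_
    have := hS _ (hρmem m)
    gcongr
  have hlim : ∀ s ∈ Ioo 0 (2 * Real.pi),
      ENNReal.ofReal ((2 * Real.sin (s / 2)) ^ α) = liminf (fun m => g m s) atTop := by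
    intro s hs
    have hsin := Real.sin_pos_of_pos_of_lt_pi (x := s / 2) (by linarith [hs.1])
      (by linarith [hs.2])
    have h1 : Tendsto (fun m => ‖1 - ρ m * Complex.exp (s * Complex.I)‖) atTop
        (𝓝 (2 * Real.sin (s / 2))) := by
      rw [← norm_one_sub_exp s hs]
      have h2 : Continuous fun x : ℝ => ‖1 - (x : ℂ) * Complex.exp (s * Complex.I)‖ := by fun_prop
      have h3 := (h2.tendsto 1).comp hρlim
      simpa [Function.comp_def] using h3
    have h2 := ENNReal.tendsto_ofReal (h1.rpow_const (p := α) (Or.inl (by positivity)))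
    exact h2.liminf_eq.symm
  -- Fatou's lemma along radii tending to `1` suffices, since only a lower bound for the supremum is
  -- needed.
  have hfatou : ENNReal.ofReal (2 * Real.pi * (Real.Gamma (1 + α) / Real.Gamma (α / 2 + 1) ^ 2))
      ≤ ENNReal.ofReal (2 * Real.pi * S) := by
    rw [← lintegral_two_sin_rpow hα, setLIntegral_congr_fun measurableSet_Ioo hlim]
    refine (lintegral_liminf_le hgm).trans ?_
    exact liminf_le_of_le (by isBoundedDefault) fun b hb => by
      obtain ⟨m, hm⟩ := hb.exists
      exact hm.trans (hgint m)
  rw [ENNReal.ofReal_le_ofReal_iff (by positivity)] at hfatou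
  exact le_of_mul_le_mul_left hfatou (by positivity)

end

/-! ### The upper estimates. -/

section

lemma Function.Periodic.intervalIntegral_comp_add {f : ℝ → ℝ} {T : ℝ} (hf : Function.Periodic f T)
    (d : ℝ) : ∫ s in (0 : ℝ)..T, f (s + d) = ∫ s in (0 : ℝ)..T, f s := by
  rw [intervalIntegral.integral_comp_add_right, zero_add, add_comm T d,
    hf.intervalIntegral_add_eq d 0, zero_add]

/-- Every summand has the same integral by translation over a period. Thus `n` times one mean
oscillation is the mean length of an inscribed polygon when `d = 2π/n`. -/
lemma Function.Periodic.sum_integral_norm_sub {f : ℝ → ℂ} (hf : Function.Periodic f (2 * Real.pi))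
    (hc : Continuous f) (n : ℕ) (d : ℝ) :
    n * ∫ s in (0 : ℝ)..2 * Real.pi, ‖f (s + d) - f s‖ =
      ∫ s in (0 : ℝ)..2 * Real.pi,
        ∑ j ∈ Finset.range n, ‖f (s + (j + 1 : ℕ) * d) - f (s + j * d)‖ := by
  have hg : Function.Periodic (fun s => ‖f (s + d) - f s‖) (2 * Real.pi) := fun s => by
    simp only [add_right_comm s (2 * Real.pi) d, hf (s + d), hf s]
  rw [intervalIntegral.integral_finsetSum
    fun j _ => Continuous.intervalIntegrable (by fun_prop) _ _]
  have : ∀ j ∈ Finset.range n,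
      ∫ s in (0 : ℝ)..2 * Real.pi, ‖f (s + (j + 1 : ℕ) * d) - f (s + j * d)‖
        = ∫ s in (0 : ℝ)..2 * Real.pi, ‖f (s + d) - f s‖ := by
    intro j _
    rw [← hg.intervalIntegral_comp_add (j * d)]
    congr 1
    funext s
    push_cast
    rw [add_mul, one_mul, add_assoc]
  rw [Finset.sum_congr rfl this]
  simp

variable {α K : ℝ} {Ω : Set ℂ} {γ : ℝ → ℂ} {u : ℂ → ℂ}

/-- The sum of the oscillations of `u` between `n` equidistributed radii, integrated over all
rotations, has a limit at the boundary, which is controlled by the length of the boundary. -/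
lemma exists_tendsto_sum_integral_norm_sub (hK : 1 ≤ K) (hΩ : IsDomainBoundedBy Ω γ)
    (hq : IsQuasiconformal K unitDisk Ω u) (hu : ContDiffOn ℝ 1 u unitDisk) {n : ℕ} (hn : n ≠ 0) :
    ∃ I ≤ 2 * Real.pi * (curveLength γ).toReal,
      Tendsto (fun r => n * ∫ s in (0 : ℝ)..2 * Real.pi,
        ‖u (circleMap 0 r (s + 2 * Real.pi / n)) - u (circleMap 0 r s)‖) (𝓝[<] 1) (𝓝 I) := by
  classical
  have hpi := Real.pi_pos
  set d := 2 * Real.pi / n with hd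
  obtain ⟨e, he⟩ := hq.homeo
  obtain ⟨C, hC⟩ := hΩ.isBounded.exists_norm_le
  have hCu : ∀ z ∈ unitDisk, ‖u z‖ ≤ C := fun z hz => by
    rw [← he ⟨z, hz⟩]
    exact hC _ (e ⟨z, hz⟩).2
  have hae := ae_exists_hasRadialLimit hu
    (hq.lintegral_norm_fderiv_sq_lt_top hK hu hΩ.isBounded)
  set w : ℝ → ℂ := fun θ => if h : ∃ w, HasRadialLimit u θ w then h.choose else 0 with hw
  have hwspec : ∀ θ, (∃ w, HasRadialLimit u θ w) → HasRadialLimit u θ (w θ) := fun θ h => by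
    simp only [hw, dif_pos h]
    exact h.choose_spec
  -- Countably many translates of a null set are null, so almost every `s` has limits at all the
  -- vertices simultaneously.
  have hae' : ∀ᵐ s : ℝ, ∀ j : ℕ, HasRadialLimit u (s + j * d) (w (s + j * d)) := by
    rw [ae_all_iff]
    intro j
    filter_upwards [(measurePreserving_add_right volume ((j : ℝ) * d)).quasiMeasurePreserving.ae hae]
      with s hs
    exact hwspec _ hs
  have hIoo : ∀ᶠ r : ℝ in 𝓝[<] 1, r ∈ Ioo (0 : ℝ) 1 := Ioo_mem_nhdsLT one_pos
  have hcont : ∀ r ∈ Ioo (0 : ℝ) 1, Continuous fun s => u (circleMap 0 r s) := fun r hr =>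
    hu.continuousOn.comp_continuous (continuous_circleMap 0 r)
      fun s => circleMap_mem_unitDisk hr.1.le hr.2 s
  set G : ℝ → ℝ := fun s => ∑ j ∈ Finset.range n, ‖w (s + (j + 1 : ℕ) * d) - w (s + j * d)‖ with hG
  have hGle : ∀ᵐ s : ℝ, ‖G s‖ ≤ (curveLength γ).toReal := by
    filter_upwards [hae'] with s hs
    rw [Real.norm_eq_abs, abs_of_nonneg (Finset.sum_nonneg fun _ _ => norm_nonneg _)]
    have h1 := sum_edist_radial_limits_le e he hΩ hn (w := w) (θ := s) fun j _ => hs j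
    have h2 := ENNReal.toReal_mono hΩ.jordan.rectifiable h1
    rw [ENNReal.toReal_sum fun _ _ => edist_ne_top _ _] at h2
    refine le_trans (le_of_eq ?_) h2
    refine Finset.sum_congr rfl fun j _ => ?_
    rw [edist_dist, ENNReal.toReal_ofReal dist_nonneg, dist_eq_norm]
  refine ⟨∫ s in (0 : ℝ)..2 * Real.pi, G s, ?_, ?_⟩
  · have h1 := intervalIntegral.norm_integral_le_of_norm_le_const_ae (a := 0) (b := 2 * Real.pi)
      (f := G) (C := (curveLength γ).toReal) (by filter_upwards [hGle] with s hs _ using hs)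
    rw [sub_zero, abs_of_pos (by positivity), mul_comm (curveLength γ).toReal] at h1
    exact (le_abs_self _).trans h1
  · have h1 : Tendsto (fun r => ∫ s in (0 : ℝ)..2 * Real.pi, ∑ j ∈ Finset.range n,
        ‖u (circleMap 0 r (s + (j + 1 : ℕ) * d)) - u (circleMap 0 r (s + j * d))‖) (𝓝[<] 1)
        (𝓝 (∫ s in (0 : ℝ)..2 * Real.pi, G s)) := by
      refine intervalIntegral.tendsto_integral_filter_of_dominated_convergence
        (fun _ => n * (C + C)) ?_ ?_ intervalIntegrable_const ?_
      · filter_upwards [hIoo] with r hr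
        refine Continuous.aestronglyMeasurable ?_
        refine continuous_finsetSum _ fun j _ => ?_
        have := hcont r hr
        exact ((this.comp (continuous_add_const _)).sub (this.comp (continuous_add_const _))).norm
      · filter_upwards [hIoo] with r hr
        refine Eventually.of_forall fun s _ => ?_
        rw [Real.norm_eq_abs, abs_of_nonneg (Finset.sum_nonneg fun _ _ => norm_nonneg _)]
        refine (Finset.sum_le_card_nsmul _ _ (C + C) fun j _ => ?_).trans (by simp [mul_add])
        exact (norm_sub_le _ _).trans (add_le_add (hCu _ (circleMap_mem_unitDisk hr.1.le hr.2 _))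
          (hCu _ (circleMap_mem_unitDisk hr.1.le hr.2 _)))
      · filter_upwards [hae'] with s hs _
        exact tendsto_finsetSum _ fun j _ => ((hs (j + 1)).sub (hs j)).norm
    refine h1.congr' ?_
    filter_upwards [hIoo] with r hr
    rw [← Function.Periodic.sum_integral_norm_sub (f := fun s => u (circleMap 0 r s))
      (fun s => by simp only [periodic_circleMap 0 r s]) (hcont r hr)]

/-- Difference quotients of `u` in the angular direction are bounded in mean by the length of the
boundary curve. -/
lemma integral_norm_sub_le (hα : -1 < α) (hK : 1 ≤ K) (hΩ : IsDomainBoundedBy Ω γ)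
    (hq : IsQuasiconformal K unitDisk Ω u) (hu : IsAlphaHarmonic α u) {n : ℕ} (hn : n ≠ 0)
    {r : ℝ} (hr : r ∈ Ioo (0 : ℝ) 1) :
    n / (2 * Real.pi) * ∫ s in (0 : ℝ)..2 * Real.pi,
        ‖u (circleMap 0 r (s + 2 * Real.pi / n)) - u (circleMap 0 r s)‖
      ≤ min 1 (cF α r) * (curveLength γ).toReal := by
  have hpi := Real.pi_pos
  have hn0 : (0 : ℝ) < n := by positivity
  obtain ⟨I, hI, hlim⟩ := exists_tendsto_sum_integral_norm_sub hK hΩ hq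
    (hu.contDiffOn.of_le (by norm_num)) hn
  have hmono := (hu.isPolarSolution.shift_sub
    (2 * Real.pi / n)).monotoneOn_integral_norm_div_hypSum hα
  set A : ℝ → ℝ := fun r => ∫ s in (0 : ℝ)..2 * Real.pi,
        ‖u (circleMap 0 r (s + 2 * Real.pi / n)) - u (circleMap 0 r s)‖ with hA
  set F : ℝ → ℝ := fun r => hypSum (-α / 2) (r ^ 2) with hF
  set L := (curveLength γ).toReal with hL
  have hL0 : 0 ≤ L := ENNReal.toReal_nonneg
  change n / (2 * Real.pi) * A r ≤ _
  have hsq : ∀ r ∈ Ioo (0 : ℝ) 1, r ^ 2 < 1 := fun r hr => by nlinarith [hr.1, hr.2]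
  have hF1 : ∀ r ∈ Ioo (0 : ℝ) 1, 1 ≤ F r := fun r hr =>
    one_le_hypSum (by linarith) (sq_nonneg r) (hsq r hr)
  have hA0 : ∀ r, 0 ≤ A r := fun r =>
    intervalIntegral.integral_nonneg (by positivity) fun _ _ => norm_nonneg _
  -- Comparison is made with a radius `ρ` beyond both `r` and `r₀`, and `F r₀ ≤ F ρ` keeps the
  -- inequality free of `ρ` on the left. Only then does `ρ → 1`, so no limit of `F` at `1` is
  -- required.
  have key : ∀ r₀ ∈ Ioo (0 : ℝ) 1, F r₀ * (n / (2 * Real.pi) * A r) ≤ F r * L := by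
    intro r₀ hr₀
    have h1 : ∀ᶠ ρ in 𝓝[<] (1 : ℝ), F r₀ * (n * A r) ≤ F r * (n * A ρ) := by
      filter_upwards [Ioo_mem_nhdsLT (max_lt hr.2 hr₀.2)] with ρ hρ
      have hρ' : ρ ∈ Ioo (0 : ℝ) 1 := ⟨hr.1.trans ((le_max_left _ _).trans_lt hρ.1), hρ.2⟩
      have h2 : A r / F r ≤ A ρ / F ρ := hmono hr hρ' ((le_max_left _ _).trans hρ.1.le)
      have h3 : F r₀ ≤ F ρ := hypSum_mono (by linarith) (sq_nonneg _)
        (pow_le_pow_left₀ hr₀.1.le ((le_max_right _ _).trans hρ.1.le) 2) (hsq ρ hρ')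
      rw [div_le_div_iff₀ (zero_lt_one.trans_le (hF1 r hr)) (zero_lt_one.trans_le (hF1 ρ hρ'))] at h2
      have h4 : F r₀ * A r ≤ F ρ * A r := mul_le_mul_of_nonneg_right h3 (hA0 r)
      have h5 : F r₀ * A r ≤ F r * A ρ := by linarith
      calc F r₀ * (n * A r) = n * (F r₀ * A r) := by ring
        _ ≤ n * (F r * A ρ) := by gcongr
        _ = F r * (n * A ρ) := by ring
    have h6 := ge_of_tendsto (hlim.const_mul (F r)) h1
    have h7 : F r * I ≤ F r * (2 * Real.pi * L) :=
      mul_le_mul_of_nonneg_left hI (zero_le_one.trans (hF1 r hr))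
    calc F r₀ * (n / (2 * Real.pi) * A r) = (F r₀ * (n * A r)) / (2 * Real.pi) := by ring
      _ ≤ (F r * (2 * Real.pi * L)) / (2 * Real.pi) := by
          exact div_le_div_of_nonneg_right (h6.trans h7) (by positivity)
      _ = F r * L := by field_simp
  set X := n / (2 * Real.pi) * A r with hX
  have hX0 : 0 ≤ X := mul_nonneg (by positivity) (hA0 r)
  rw [min_mul_of_nonneg _ _ hL0, one_mul]
  -- The choice `r₀ = r` gives the constant `1`. Below, the estimates for all `r₀` combine into an
  -- upper bound for `F`, to which Gauss's value applies.
  refine le_min (le_of_mul_le_mul_left (key r hr) (zero_lt_one.trans_le (hF1 r hr))) ?_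
  have g1 : 0 < Real.Gamma (1 + α) := Real.Gamma_pos_of_pos (by linarith)
  have g2 : 0 < Real.Gamma (α / 2 + 1) := Real.Gamma_pos_of_pos (by linarith)
  have hcF : cF α r = cConst α * F r := by rw [cF, ordinaryHypergeometric_eq_hypSum]
  have hF0 := zero_le_one.trans (hF1 r hr)
  rcases hX0.eq_or_lt with h0 | h0
  · rw [← h0, hcF, cConst]
    positivity
  · have h1 := Gamma_div_le_of_forall_hypSum_le hα (S := F r * L / X)
      fun r₀ hr₀ => (le_div_iff₀ h0).2 (key r₀ hr₀)
    rw [le_div_iff₀ h0] at h1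
    rw [hcF, cConst]
    calc X = Real.Gamma (α / 2 + 1) ^ 2 / Real.Gamma (1 + α) *
          (Real.Gamma (1 + α) / Real.Gamma (α / 2 + 1) ^ 2 * X) := by
          rw [← mul_assoc, div_mul_div_cancel₀ g1.ne', div_self (by positivity), one_mul]
      _ ≤ Real.Gamma (α / 2 + 1) ^ 2 / Real.Gamma (1 + α) * (F r * L) := by gcongr
      _ = _ := by ring

/-- Scaled by `n/(2π)`, the differences over the angle `2π/n` are difference quotients, and Fatou's
lemma passes their uniform mean bound to the derivative. -/
lemma lintegral_enorm_angular_deriv_le (hα : -1 < α) (hK : 1 ≤ K) (hΩ : IsDomainBoundedBy Ω γ)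
    (hq : IsQuasiconformal K unitDisk Ω u) (hu : IsAlphaHarmonic α u)
    {r : ℝ} (hr : r ∈ Ioo (0 : ℝ) 1) :
    ∫⁻ s in Ioc 0 (2 * Real.pi), ‖fderiv ℝ u (circleMap 0 r s) (circleMap 0 r s * Complex.I)‖ₑ
      ≤ ENNReal.ofReal (min 1 (cF α r)) * curveLength γ := by
  have hpi := Real.pi_pos
  have hP := hu.isPolarSolution
  have hc : Continuous fun s => u (circleMap 0 r s) := hP.continuous hr
  set g : ℕ → ℝ → ℝ≥0∞ := fun m s => ENNReal.ofReal ((m + 1 : ℕ) / (2 * Real.pi) *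
    ‖u (circleMap 0 r (s + 2 * Real.pi / (m + 1 : ℕ))) - u (circleMap 0 r s)‖) with hg
  have hcont : ∀ m : ℕ, Continuous fun s => (m + 1 : ℕ) / (2 * Real.pi) *
      ‖u (circleMap 0 r (s + 2 * Real.pi / (m + 1 : ℕ))) - u (circleMap 0 r s)‖ := fun m =>
    continuous_const.mul ((hc.comp (continuous_add_const _)).sub hc).norm
  have hgm : ∀ m, Measurable (g m) := fun m => (hcont m).measurable.ennreal_ofReal
  have hgint : ∀ m, ∫⁻ s in Ioc 0 (2 * Real.pi), g m s
      ≤ ENNReal.ofReal (min 1 (cF α r)) * curveLength γ := by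
    intro m
    have h1 := integral_norm_sub_le hα hK hΩ hq hu (Nat.succ_ne_zero m) hr
    rw [← intervalIntegral.integral_const_mul] at h1
    rw [← ofReal_integral_eq_lintegral_ofReal
      ((intervalIntegrable_iff_integrableOn_Ioc_of_le (by positivity)).1
        ((hcont m).intervalIntegrable _ _))
      (Eventually.of_forall fun s => by positivity),
      ← intervalIntegral.integral_of_le (by positivity)]
    refine (ENNReal.ofReal_le_ofReal h1).trans ?_
    rw [ENNReal.ofReal_mul' ENNReal.toReal_nonneg, ENNReal.ofReal_toReal hΩ.jordan.rectifiable]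
  have hstep : Tendsto (fun m : ℕ => 2 * Real.pi / ((m + 1 : ℕ) : ℝ)) atTop (𝓝[≠] 0) := by
    refine tendsto_nhdsWithin_iff.2 ⟨?_, Eventually.of_forall fun m => ?_⟩
    · exact (tendsto_const_nhds.div_atTop tendsto_natCast_atTop_atTop).comp (tendsto_add_atTop_nat 1)
    · simp only [mem_compl_iff, mem_singleton_iff]
      positivity
  have hlim : ∀ s, ‖fderiv ℝ u (circleMap 0 r s) (circleMap 0 r s * Complex.I)‖ₑ
      = liminf (fun m => g m s) atTop := by
    intro s
    have h1 := ((hasDerivAt_iff_tendsto_slope_zero.1 (hP.hasDerivAt_s r hr s)).comp hstep).norm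
    rw [← ofReal_norm]
    refine ((ENNReal.tendsto_ofReal h1).congr fun m => ?_).liminf_eq.symm
    simp only [hg, Function.comp_apply, norm_smul, norm_inv, Real.norm_eq_abs]
    rw [abs_of_pos (by positivity), inv_div]
  simp only [hlim]
  refine (lintegral_liminf_le hgm).trans ?_
  exact liminf_le_of_le (by isBoundedDefault) fun b hb => by
    obtain ⟨m, hm⟩ := hb.exists
    exact hm.trans (hgint m)

/-- With `k = (K-1)/(K+1)`, the reverse triangle inequality gives `|∂_θ u| ≥ r (1-k) |∂u|`. The
constants are `1/(1-k) = (K+1)/2` and `k/(1-k) = (K-1)/2`. -/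
lemma IsQuasiconformal.wirtinger_mul_le (hK : 1 ≤ K) (hq : IsQuasiconformal K unitDisk Ω u)
    (hu : ContDiffOn ℝ 1 u unitDisk) {r : ℝ} (hr : r ∈ Ioo (0 : ℝ) 1) (s : ℝ) :
    ‖wirtinger u (circleMap 0 r s)‖ * r
        ≤ (K + 1) / 2 * ‖fderiv ℝ u (circleMap 0 r s) (circleMap 0 r s * Complex.I)‖ ∧
      ‖wirtingerBar u (circleMap 0 r s)‖ * r
        ≤ (K - 1) / 2 * ‖fderiv ℝ u (circleMap 0 r s) (circleMap 0 r s * Complex.I)‖ := by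
  have hb := hq.norm_wirtingerBar_le hu (circleMap_mem_unitDisk hr.1.le hr.2 s)
  have hr0 := hr.1
  have hz : ‖circleMap 0 r s * Complex.I‖ = r := by simp [abs_of_pos hr0]
  have h1 : ‖wirtinger u (circleMap 0 r s)‖ * r - ‖wirtingerBar u (circleMap 0 r s)‖ * r
      ≤ ‖fderiv ℝ u (circleMap 0 r s) (circleMap 0 r s * Complex.I)‖ := by
    rw [fderiv_apply_eq_wirtinger]
    have := norm_sub_norm_le (wirtinger u (circleMap 0 r s) * (circleMap 0 r s * Complex.I))
      (-(wirtingerBar u (circleMap 0 r s) * (starRingEnd ℂ) (circleMap 0 r s * Complex.I)))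
    rwa [sub_neg_eq_add, norm_neg, norm_mul (wirtinger _ _), norm_mul (wirtingerBar _ _),
      RCLike.norm_conj, hz] at this
  set a := ‖wirtinger u (circleMap 0 r s)‖
  set b := ‖wirtingerBar u (circleMap 0 r s)‖
  set D := ‖fderiv ℝ u (circleMap 0 r s) (circleMap 0 r s * Complex.I)‖
  have hK1 : 0 < K + 1 := by linarith
  rw [div_mul_eq_mul_div, le_div_iff₀ hK1] at hb
  have h2 : b * (K + 1) * r ≤ (K - 1) * a * r := by gcongr
  constructor <;> nlinarith

lemma arcIntegral_le_of_forall {g : ℂ → ℂ} {r c : ℝ} (hc : 0 ≤ c) {f : ℝ → ℂ}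
    (h : ∀ s, ‖g (circleMap 0 r s)‖ * r ≤ c * ‖f s‖) {M : ℝ≥0∞}
    (hM : ∫⁻ s in Ioc 0 (2 * Real.pi), ‖f s‖ₑ ≤ M) : arcIntegral r g ≤ ENNReal.ofReal c * M := by
  calc arcIntegral r g ≤ ∫⁻ s in Ioc 0 (2 * Real.pi), ENNReal.ofReal c * ‖f s‖ₑ := by
        refine lintegral_mono fun s => ?_
        rw [← ofReal_norm, ← ofReal_norm, ← ENNReal.ofReal_mul (norm_nonneg _),
          ← ENNReal.ofReal_mul hc]
        exact ENNReal.ofReal_le_ofReal (h s)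
    _ = ENNReal.ofReal c * ∫⁻ s in Ioc 0 (2 * Real.pi), ‖f s‖ₑ :=
        lintegral_const_mul' _ _ ENNReal.ofReal_ne_top
    _ ≤ _ := by gcongr

/-- Both halves of `min 1 (cF α r)` are used: the second for a fixed radius, the first for the
supremum. No monotonicity of `cF` in `r` is needed. -/
theorem arcIntegral_wirtinger_le (hα : -1 < α) (hK : 1 ≤ K) (hΩ : IsDomainBoundedBy Ω γ)
    (hu : u ∈ QCH α Ω K) :
    (∀ r ∈ Ioo (0 : ℝ) 1,
      arcIntegral r (wirtinger u) ≤ ENNReal.ofReal ((K + 1) / 2 * cF α r) * curveLength γ ∧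
      arcIntegral r (wirtingerBar u) ≤ ENNReal.ofReal ((K - 1) / 2 * cF α r) * curveLength γ) ∧
    supArcIntegral (wirtinger u) ≤ ENNReal.ofReal ((K + 1) / 2) * curveLength γ ∧
    supArcIntegral (wirtingerBar u) ≤ ENNReal.ofReal ((K - 1) / 2) * curveLength γ := by
  obtain ⟨hq, hh⟩ := hu
  have h1 : 0 ≤ (K + 1) / 2 := by linarith
  have h2 : 0 ≤ (K - 1) / 2 := by linarith
  have hw := fun r (hr : r ∈ Ioo (0 : ℝ) 1) s =>
    hq.wirtinger_mul_le hK (hh.contDiffOn.of_le (by norm_num)) hr s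
  have hM := fun r (hr : r ∈ Ioo (0 : ℝ) 1) => lintegral_enorm_angular_deriv_le hα hK hΩ hq hh hr
  have hM1 := fun r (hr : r ∈ Ioo (0 : ℝ) 1) => (hM r hr).trans
    (mul_le_mul_left (ENNReal.ofReal_le_ofReal (min_le_right _ _)) _)
  have hM2 : ∀ r ∈ Ioo (0 : ℝ) 1, _ ≤ curveLength γ := fun r hr => (hM r hr).trans <|
    (mul_le_mul_left (ENNReal.ofReal_le_ofReal (min_le_left _ _)) _).trans (by simp)
  refine ⟨fun r hr => ⟨?_, ?_⟩, iSup₂_le fun r hr => ?_, iSup₂_le fun r hr => ?_⟩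
  · rw [ENNReal.ofReal_mul h1, mul_assoc]
    exact arcIntegral_le_of_forall h1 (fun s => (hw r hr s).1) (hM1 r hr)
  · rw [ENNReal.ofReal_mul h2, mul_assoc]
    exact arcIntegral_le_of_forall h2 (fun s => (hw r hr s).2) (hM1 r hr)
  · exact arcIntegral_le_of_forall h1 (fun s => (hw r hr s).1) (hM2 r hr)
  · exact arcIntegral_le_of_forall h2 (fun s => (hw r hr s).2) (hM2 r hr)

end

/-! ### Sharpness: affine maps onto ellipses. -/

section

lemma isWeakDirDerivOn_fderiv {Ω : Set ℂ} {u : ℂ → ℂ} (hu : ContDiff ℝ 1 u) (v : ℂ) :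
    IsWeakDirDerivOn Ω v u fun z => fderiv ℝ u z v := by
  intro φ hφ hφc hφs
  have hdu : Continuous fun z => fderiv ℝ u z v :=
    (hu.continuous_fderiv one_ne_zero).clm_apply continuous_const
  have hdφ : Continuous fun z => fderiv ℝ φ z v :=
    (hφ.continuous_fderiv (by simp)).clm_apply continuous_const
  have hcs : HasCompactSupport fun z => fderiv ℝ φ z v := hφc.fderiv_apply ℝ v
  have hsupp : Function.support (fun z => fderiv ℝ φ z v • u z) ⊆ tsupport φ := fun z hz => by
    refine support_fderiv_subset ℝ fun h0 => hz ?_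
    simp [h0]
  have hsupp' : Function.support (fun z => φ z • fderiv ℝ u z v) ⊆ tsupport φ := fun z hz => by
    refine subset_tsupport φ fun h0 => hz ?_
    simp [h0]
  have hibp := integral_smul_fderiv_eq_neg_fderiv_smul_of_integrable (μ := volume) (v := v)
    ((hdφ.smul hu.continuous).integrable_of_hasCompactSupport hcs.smul_right)
    ((hφ.continuous.smul hdu).integrable_of_hasCompactSupport hφc.smul_right)
    ((hφ.continuous.smul hu.continuous).integrable_of_hasCompactSupport hφc.smul_right)
    (fun x _ => (hφ.differentiable (by simp)).differentiableAt)
    (fun x _ => (hu.differentiable one_ne_zero).differentiableAt)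
  rw [setIntegral_eq_integral_of_forall_compl_eq_zero fun z hz => by
      by_contra hne
      exact hz (hφs (hsupp hne)),
    setIntegral_eq_integral_of_forall_compl_eq_zero fun z hz => by
      by_contra hne
      exact hz (hφs (hsupp' hne)), hibp, neg_neg]

lemma Continuous.isLocL2On {Ω : Set ℂ} {g : ℂ → ℂ} (hg : Continuous g) : IsLocL2On Ω g := by
  intro C _ hC
  have : IsFiniteMeasure (volume.restrict C) := ⟨by simpa using hC.measure_lt_top⟩
  obtain ⟨M, hM⟩ := hC.exists_bound_of_continuousOn hg.continuousOn
  exact MemLp.of_bound hg.aestronglyMeasurable M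
    ((ae_restrict_iff' hC.measurableSet).2 (Eventually.of_forall hM))

/-- The real linear map `z ↦ z + k z̄`. -/
def conjStretch (k : ℝ) : ℂ →L[ℝ] ℂ :=
  ContinuousLinearMap.id ℝ ℂ + k • (Complex.conjCLE : ℂ →L[ℝ] ℂ)

variable {k K : ℝ}

lemma conjStretch_apply (k : ℝ) (z : ℂ) : conjStretch k z = z + k * (starRingEnd ℂ) z := by
  simp [conjStretch]

/-- For `0 ≤ k < 1` the map `z ↦ z + k z̄` is a homeomorphism of the plane. -/
def conjStretchHomeo (hk0 : 0 ≤ k) (hk1 : k < 1) : ℂ ≃ₜ ℂ where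
  toFun z := conjStretch k z
  invFun z := conjStretch (-k) z / ((1 - k ^ 2 : ℝ) : ℂ)
  left_inv z := by
    have : ((1 - k ^ 2 : ℝ) : ℂ) ≠ 0 := by
      exact_mod_cast (by nlinarith : 1 - k ^ 2 ≠ 0)
    simp only [conjStretch_apply, map_add, map_mul, Complex.conj_conj, Complex.conj_ofReal]
    rw [div_eq_iff this]
    push_cast
    ring
  right_inv z := by
    have : ((1 - k ^ 2 : ℝ) : ℂ) ≠ 0 := by
      exact_mod_cast (by nlinarith : 1 - k ^ 2 ≠ 0)
    simp only [conjStretch_apply, map_add, map_mul, map_div₀, Complex.conj_conj,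
      Complex.conj_ofReal]
    field_simp
    push_cast
    ring
  continuous_toFun := (conjStretch k).continuous
  continuous_invFun := (conjStretch (-k)).continuous.div_const _

lemma isAlphaHarmonic_zero_continuousLinearMap (L : ℂ →L[ℝ] ℂ) : IsAlphaHarmonic 0 L where
  contDiffOn := L.contDiff.contDiffOn
  eq_zero z _ := by
    have h : fderiv ℝ (fderiv ℝ L) z = 0 := by
      have : fderiv ℝ L = fun _ => L := funext fun z => L.fderiv
      rw [this]
      simp
    have hΔ : (Δ ⇑L) z = 0 := by
      rw [InnerProductSpace.laplacian_eq_iteratedFDeriv_complexPlane]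
      simp [iteratedFDeriv_two_apply, h]
    simp [opT, hΔ]

lemma wirtinger_conjStretch (k : ℝ) (z : ℂ) : wirtinger (conjStretch k) z = 1 := by
  rw [wirtinger, (conjStretch k).fderiv, conjStretch_apply, conjStretch_apply]
  simp only [map_one, Complex.conj_I]
  linear_combination (-(1 - k : ℂ) / 2) * Complex.I_mul_I

lemma wirtingerBar_conjStretch (k : ℝ) (z : ℂ) : wirtingerBar (conjStretch k) z = k := by
  rw [wirtingerBar, (conjStretch k).fderiv, conjStretch_apply, conjStretch_apply]
  simp only [map_one, Complex.conj_I]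
  linear_combination ((1 - k : ℂ) / 2) * Complex.I_mul_I

/-- An affine map has the constant Beltrami coefficient `k`, and it is harmonic because its second
derivative vanishes. -/
lemma conjStretch_mem_QCH (hk : k = (K - 1) / (K + 1)) (hk0 : 0 ≤ k) (hk1 : k < 1) :
    ⇑(conjStretch k) ∈ QCH 0 (conjStretchHomeo hk0 hk1 '' unitDisk) K := by
  have hC : ContDiff ℝ 1 (conjStretch k) := (conjStretch k).contDiff
  refine ⟨⟨⟨(conjStretchHomeo hk0 hk1).image unitDisk, fun z => rfl⟩, _, _, fun _ => (k : ℂ),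
    hC.continuous.isLocL2On, ?_, ?_, isWeakDirDerivOn_fderiv hC 1,
    isWeakDirDerivOn_fderiv hC Complex.I, measurable_const, Eventually.of_forall fun z => ?_,
    Eventually.of_forall fun z => ?_⟩, isAlphaHarmonic_zero_continuousLinearMap _⟩
  · exact ((hC.continuous_fderiv one_ne_zero).clm_apply continuous_const).isLocL2On
  · exact ((hC.continuous_fderiv one_ne_zero).clm_apply continuous_const).isLocL2On
  · rw [Complex.norm_real, Real.norm_eq_abs, abs_of_nonneg hk0, hk]
  · change wirtingerBar (conjStretch k) z = k * wirtinger (conjStretch k) z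
    rw [wirtingerBar_conjStretch, wirtinger_conjStretch, mul_one]

/-- The parametrization of the ellipse that bounds the image of the unit disk under
`conjStretch k`. -/
def conjStretchCurve (k t : ℝ) : ℂ := conjStretch k (circleMap 0 1 (2 * Real.pi * t))

/-- The linear map stretches by at most `1 + k`. The resulting upper bound for the length of the
ellipse is all that sharpness needs; its exact length plays no role. -/
lemma lipschitzWith_conjStretchCurve (hk0 : 0 ≤ k) :
    LipschitzWith (Real.toNNReal (2 * Real.pi * (1 + k))) (conjStretchCurve k) := by
  have hpi := Real.pi_pos
  refine LipschitzWith.of_dist_le_mul fun s t => ?_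
  rw [Real.coe_toNNReal _ (by positivity), dist_eq_norm, conjStretchCurve, conjStretchCurve,
    ← map_sub, conjStretch_apply]
  set z := circleMap 0 1 (2 * Real.pi * s) - circleMap 0 1 (2 * Real.pi * t) with hz
  have h1 : ‖z‖ ≤ 2 * Real.pi * dist s t := by
    have := (lipschitzWith_circleMap 0 1).dist_le_mul (2 * Real.pi * s) (2 * Real.pi * t)
    rw [dist_eq_norm, ← hz] at this
    simpa [Real.dist_eq, ← mul_sub, abs_mul, abs_of_pos hpi] using this
  calc ‖z + k * (starRingEnd ℂ) z‖ ≤ ‖z‖ + ‖k * (starRingEnd ℂ) z‖ := norm_add_le _ _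
    _ = (1 + k) * ‖z‖ := by
        rw [norm_mul, RCLike.norm_conj, Complex.norm_real, Real.norm_eq_abs, abs_of_nonneg hk0]
        ring
    _ ≤ (1 + k) * (2 * Real.pi * dist s t) := by gcongr
    _ = _ := by ring

lemma curveLength_conjStretchCurve_le (hk0 : 0 ≤ k) :
    curveLength (conjStretchCurve k) ≤ ENNReal.ofReal (2 * Real.pi * (1 + k)) := by
  have h1 := ((lipschitzWith_conjStretchCurve hk0).lipschitzOnWith (s := univ)).comp_eVariationOn_le
    (f := conjStretchCurve k) (g := fun t : ℝ => t) (s := Icc 0 1) (mapsTo_univ _ _)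
  have h2 := (monotoneOn_id (s := Icc (0 : ℝ) 1)).eVariationOn_eq (a := 0) (b := 1)
    ⟨le_rfl, zero_le_one⟩ ⟨zero_le_one, le_rfl⟩
  rw [inter_self] at h2
  refine (h1.trans (mul_le_mul_right h2.le _)).trans ?_
  simp [ENNReal.ofReal]

lemma image_circleMap_two_pi_mul :
    (fun t : ℝ => circleMap 0 1 (2 * Real.pi * t)) '' Icc 0 1 = Metric.sphere 0 1 := by
  have hpi := Real.pi_pos
  refine Subset.antisymm ?_ ?_
  · rintro _ ⟨t, -, rfl⟩
    exact circleMap_mem_sphere 0 zero_le_one _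
  · have h := image_circleMap_Ioc 0 1
    rw [abs_one] at h
    rw [← h]
    rintro _ ⟨θ, hθ, rfl⟩
    refine ⟨θ / (2 * Real.pi), ⟨by have := hθ.1; positivity, ?_⟩, ?_⟩
    · rw [div_le_one (by positivity)]
      exact hθ.2
    · simp only
      rw [mul_div_cancel₀ _ (by positivity)]

lemma isDomainBoundedBy_conjStretch (hk0 : 0 ≤ k) (hk1 : k < 1) :
    IsDomainBoundedBy (conjStretchHomeo hk0 hk1 '' unitDisk) (conjStretchCurve k) where
  isOpen := (conjStretchHomeo hk0 hk1).isOpenMap _ isOpen_unitDisk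
  isConnected := ((convex_ball (0 : ℂ) 1).isConnected (Metric.nonempty_ball.2 one_pos)).image _
    (conjStretchHomeo hk0 hk1).continuous.continuousOn
  isBounded := (conjStretch k).lipschitz.isBounded_image Metric.isBounded_ball
  jordan :=
    { continuousOn := (lipschitzWith_conjStretchCurve hk0).continuous.continuousOn
      closed := by
        simp only [conjStretchCurve]
        congr 1
        simp [circleMap]
      injOn := by
        have hpi := Real.pi_pos
        intro s hs t ht hst
        have h1 := (conjStretchHomeo hk0 hk1).injective hst
        have h2 := injOn_circleMap_of_abs_sub_le' (c := 0) (a := 0) (b := 2 * Real.pi) one_ne_zero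
          (by simp) ⟨by have := hs.1; positivity, by nlinarith [hs.2]⟩
          ⟨by have := ht.1; positivity, by nlinarith [ht.2]⟩ h1
        exact mul_left_cancel₀ (by positivity) h2
      rectifiable := ne_top_of_le_ne_top ENNReal.ofReal_ne_top
        (curveLength_conjStretchCurve_le hk0) }
  frontier_eq := by
    rw [← Homeomorph.image_frontier, unitDisk, frontier_ball _ one_ne_zero,
      ← image_circleMap_two_pi_mul, image_image]
    rfl

lemma supArcIntegral_of_norm_eq {g : ℂ → ℂ} {c : ℝ} (hg : ∀ z, ‖g z‖ = c) :
    supArcIntegral g = ENNReal.ofReal (2 * Real.pi * c) := by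
  have hpi := Real.pi_pos
  have hc : 0 ≤ c := hg 0 ▸ norm_nonneg _
  have h1 : ∀ r ∈ Ioo (0 : ℝ) 1, arcIntegral r g = ENNReal.ofReal (2 * Real.pi * c * r) := by
    intro r hr
    simp only [arcIntegral, ← ofReal_norm, hg]
    rw [setLIntegral_const, Real.volume_Ioc, ← ENNReal.ofReal_mul hc,
      ← ENNReal.ofReal_mul (mul_nonneg hc hr.1.le)]
    congr 1
    ring
  refine le_antisymm (iSup₂_le fun r hr => ?_) ?_
  · rw [h1 r hr]
    refine ENNReal.ofReal_le_ofReal (mul_le_of_le_one_right (by positivity) hr.2.le)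
  -- The supremum is not attained: the integral is linear in `r` and approaches its bound as `r →
  -- 1`.
  · have h2 : Tendsto (fun r : ℝ => ENNReal.ofReal (2 * Real.pi * c * r)) (𝓝[<] 1)
        (𝓝 (ENNReal.ofReal (2 * Real.pi * c))) := by
      have : Continuous fun r : ℝ => ENNReal.ofReal (2 * Real.pi * c * r) :=
        ENNReal.continuous_ofReal.comp (by fun_prop)
      simpa using (this.tendsto 1).mono_left nhdsWithin_le_nhds
    refine le_of_tendsto h2 ?_
    filter_upwards [Ioo_mem_nhdsLT one_pos] with r hr
    rw [← h1 r hr]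
    exact le_iSup₂ (f := fun r (_ : r ∈ Ioo (0 : ℝ) 1) => arcIntegral r g) r hr

/-- For every `K ≥ 1` the affine map `z ↦ z + k z̄` with `k = (K - 1) / (K + 1)` maps the disk onto
a domain bounded by an ellipse of length at most `2 π (1 + k)`. -/
lemma exists_mem_QCH_zero (hK : 1 ≤ K) : ∃ (Ω : Set ℂ) (γ : ℝ → ℂ) (u : ℂ → ℂ),
    IsDomainBoundedBy Ω γ ∧ u ∈ QCH 0 Ω K ∧
      curveLength γ ≤ ENNReal.ofReal (4 * Real.pi * K / (K + 1)) ∧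
      supArcIntegral (wirtinger u) = ENNReal.ofReal (2 * Real.pi) ∧
      supArcIntegral (wirtingerBar u) = ENNReal.ofReal (2 * Real.pi * ((K - 1) / (K + 1))) := by
  have hK1 : 0 < K + 1 := by linarith
  have hk0 : 0 ≤ (K - 1) / (K + 1) := div_nonneg (by linarith) hK1.le
  have hk1 : (K - 1) / (K + 1) < 1 := by
    rw [div_lt_one hK1]
    linarith
  refine ⟨_, _, _, isDomainBoundedBy_conjStretch hk0 hk1, conjStretch_mem_QCH rfl hk0 hk1,
    (curveLength_conjStretchCurve_le hk0).trans_eq ?_, ?_, ?_⟩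
  · congr 1
    field_simp
    ring
  · rw [supArcIntegral_of_norm_eq (c := 1) fun z => by rw [wirtinger_conjStretch, norm_one], mul_one]
  · exact supArcIntegral_of_norm_eq fun z => by
      rw [wirtingerBar_conjStretch, Complex.norm_real, Real.norm_eq_abs, abs_of_nonneg hk0]

/-- For `K = 1` one has `k = 0` and the map is the identity. The length bound `2π` gives one
inequality and the general estimate the other; the second equality reads `0 = 0`. -/
theorem exists_supArcIntegral_eq :
    ∃ (Ω : Set ℂ) (γ : ℝ → ℂ) (u : ℂ → ℂ), IsDomainBoundedBy Ω γ ∧ u ∈ QCH 0 Ω 1 ∧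
      supArcIntegral (wirtinger u) = ENNReal.ofReal ((1 + 1) / 2) * curveLength γ ∧
      supArcIntegral (wirtingerBar u) = ENNReal.ofReal ((1 - 1) / 2) * curveLength γ := by
  obtain ⟨Ω, γ, u, hΩ, hu, hL, h1, h2⟩ := exists_mem_QCH_zero le_rfl
  refine ⟨Ω, γ, u, hΩ, hu, le_antisymm
    (arcIntegral_wirtinger_le (by norm_num) le_rfl hΩ hu).2.1 ?_, ?_⟩
  · rw [h1]
    have h3 : 4 * Real.pi * 1 / (1 + 1) = 2 * Real.pi := by ring
    have h4 : ((1 + 1) / 2 : ℝ) = 1 := by norm_num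
    rw [h4, ENNReal.ofReal_one, one_mul]
    rwa [h3] at hL
  · rw [h2]
    simp

theorem exists_le_supArcIntegral {ε : ℝ} (hε : 0 < ε) (hK : 1 ≤ K) (hKε : K < 1 + ε) :
    ∃ (Ω : Set ℂ) (γ : ℝ → ℂ) (u : ℂ → ℂ), IsDomainBoundedBy Ω γ ∧ u ∈ QCH 0 Ω K ∧
      ENNReal.ofReal ((1 - ε) * ((K + 1) / 2)) * curveLength γ ≤ supArcIntegral (wirtinger u) ∧
      ENNReal.ofReal ((1 - ε) * ((K - 1) / 2)) * curveLength γ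
        ≤ supArcIntegral (wirtingerBar u) := by
  obtain ⟨Ω, γ, u, hΩ, hu, hL, h1, h2⟩ := exists_mem_QCH_zero hK
  have hpi := Real.pi_pos
  have hK1 : 0 < K + 1 := by linarith
  -- With the length bound `4πK/(K+1)` in place of the length, both ratios of the integral to its
  -- bound are `1/K` (for the second, when `K > 1`), so `(1-ε)K ≤ 1` is all that matters. For `ε ≤
  -- 1` it follows from `(1-ε)(1+ε) ≤ 1`, and for larger `ε` the left side is negative.
  have hle : (1 - ε) * K ≤ 1 := by nlinarith
  refine ⟨Ω, γ, u, hΩ, hu, ?_, ?_⟩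
  · rw [h1]
    refine (mul_le_mul_right hL _).trans ?_
    rw [← ENNReal.ofReal_mul' (by positivity)]
    refine ENNReal.ofReal_le_ofReal ?_
    calc (1 - ε) * ((K + 1) / 2) * (4 * Real.pi * K / (K + 1))
        = 2 * Real.pi * ((1 - ε) * K) := by field_simp; ring
      _ ≤ 2 * Real.pi := mul_le_of_le_one_right (by positivity) hle
  · rw [h2]
    refine (mul_le_mul_right hL _).trans ?_
    rw [← ENNReal.ofReal_mul' (by positivity)]
    refine ENNReal.ofReal_le_ofReal ?_
    have : 0 ≤ 2 * Real.pi * ((K - 1) / (K + 1)) :=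
      mul_nonneg (by positivity) (div_nonneg (by linarith) hK1.le)
    calc (1 - ε) * ((K - 1) / 2) * (4 * Real.pi * K / (K + 1))
        = 2 * Real.pi * ((K - 1) / (K + 1)) * ((1 - ε) * K) := by field_simp; ring
      _ ≤ 2 * Real.pi * ((K - 1) / (K + 1)) := mul_le_of_le_one_right this hle

end

end

theorem theorem1p9 :
    -- the estimates
    (∀ (α K : ℝ) (Ω : Set ℂ) (γ : ℝ → ℂ) (u : ℂ → ℂ), -1 < α → 1 ≤ K →
      IsDomainBoundedBy Ω γ → u ∈ QCH α Ω K →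
        (∀ r ∈ Set.Ioo (0 : ℝ) 1,
          arcIntegral r (wirtinger u)
            ≤ ENNReal.ofReal ((K + 1) / 2 * cF α r) * curveLength γ ∧
          arcIntegral r (wirtingerBar u)
            ≤ ENNReal.ofReal ((K - 1) / 2 * cF α r) * curveLength γ) ∧
        supArcIntegral (wirtinger u)
            ≤ ENNReal.ofReal ((K + 1) / 2) * curveLength γ ∧
        supArcIntegral (wirtingerBar u)
            ≤ ENNReal.ofReal ((K - 1) / 2) * curveLength γ) ∧
    -- sharpness: equality is attained for `α = 0`, `K = 1`
    (∃ (Ω : Set ℂ) (γ : ℝ → ℂ) (u : ℂ → ℂ), IsDomainBoundedBy Ω γ ∧ u ∈ QCH 0 Ω 1 ∧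
        supArcIntegral (wirtinger u)
            = ENNReal.ofReal ((1 + 1) / 2) * curveLength γ ∧
        supArcIntegral (wirtingerBar u)
            = ENNReal.ofReal ((1 - 1) / 2) * curveLength γ) ∧
    -- sharpness: for `α = 0` both constants are asymptotically optimal as `K → 1`
    (∀ ε : ℝ, 0 < ε → ∃ δ : ℝ, 0 < δ ∧ ∀ K : ℝ, 1 ≤ K → K < 1 + δ →
      ∃ (Ω : Set ℂ) (γ : ℝ → ℂ) (u : ℂ → ℂ), IsDomainBoundedBy Ω γ ∧ u ∈ QCH 0 Ω K ∧
        ENNReal.ofReal ((1 - ε) * ((K + 1) / 2)) * curveLength γ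
            ≤ supArcIntegral (wirtinger u) ∧
        ENNReal.ofReal ((1 - ε) * ((K - 1) / 2)) * curveLength γ
            ≤ supArcIntegral (wirtingerBar u)) := by
  refine ⟨fun α K Ω γ u hα hK hΩ hu => arcIntegral_wirtinger_le hα hK hΩ hu,
    exists_supArcIntegral_eq, fun ε hε => ⟨ε, hε, fun K hK hKε => exists_le_supArcIntegral hε hK hKε⟩⟩
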